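/- **Model.** Fix $\lambda>0$, an integer $d\ge 1$, a finite label set $Z$, prior probabilities $\pi_i>0$ ($i\in Z$) with $\sum_{i\in Z}\pi_i=1$, and distributions $P_{ij}=P_{ji}$ on $\mathbb R$ ($i,j\in Z$) that are either all discrete, with probability mass functions $p_{ij}$, or all absolutely continuous, with probability density functions $p_{ij}$. For $n\in\mathbb N$, a graph $G\sim\mathrm{GHCM}(\lambda,n,\pi,P,d)$ is sampled as follows. The vertex set $V$ is a homogeneous Poisson point process of intensity $\lambda$ in the cube $[-n^{1/d}/2,n^{1/d}/2]^d$ (that is, a $\mathrm{Poisson}(\lambda n)$ number of independent uniform points). The vertices $u\in V$ receive independent labels $x^\star(u)\in Z$ with law $\pi$. Conditionally on locations and labels, the observations $Y_{uv}=Y_{vu}$, one for each unordered pair of distinct vertices, are independent; $Y_{uv}\sim P_{x^\star(u),x^\star(v)}$ if the toroidal distance of $u$ and $v$, $$\Big(\sum_{c=1}^d \min\{|u_c-v_c|,\,n^{1/d}-|u_c-v_c|\}^2\Big)^{1/2},$$ is at most $(\log n)^{1/d}$, and $Y_{uv}=0$ otherwise. **Exact recovery.** A permutation $\omega$ of $Z$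 is a *permissible relabeling* if $\pi_i=\pi_{\omega(i)}$ and $P_{ij}=P_{\omega(i),\omega(j)}$ for all $i,j\in Z$; let $\Omega_{\pi,P}$ be the set of these. An estimator $\widetilde x$ is, for each $n$, a (possibly randomized) measurable function of the locations and the observations with values in the labelings $V\to Z$. Its agreement with the truth is $A(\widetilde x,x^\star)=\frac1{|V|}\max_{\omega\in\Omega_{\pi,P}}\sum_{u\in V}\mathbf 1\{\widetilde x(u)=\omega(x^\star(u))\}$, and it *achieves exact recovery* if $\lim_{n\to\infty}\mathbb P(A(\widetilde x,x^\star)=1)=1$. **Theorem (Impossibility).** Let $\nu_d$ be the volume of the unit Euclidean ball in $\mathbb R^d$ and, for $\theta_i=(p_{ir})_{r\in Z}$, let $$D_+(\theta_i,\theta_j)=1-\inf_{t\in[0,1]}\sum_{r\in Z}\pi_r\int p_{ir}(y)^t\,p_{jr}(y)^{1-t}\,dy$$ be the Chernoff–Hellinger divergence (with a sum in place of the integral in the discrete case). No estimator achieves exact recovery if (a) $|Z|\ge 2$ and $\lambda\nu_d\min_{i\ne j}D_+(\theta_i,\theta_j)<1$; or (b) $d=1$, $\lambda<1$ and $|\Omega_{\pi,P}|\ge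 2$. -/

import Mathlib

open MeasureTheory ProbabilityTheory Filter Topology

/-- Parameters `(λ, π, P, d)` of the geometric hidden community model with label set `Z`.
The pairwise distributions `P i j` on `ℝ` are given by densities `p i j` with respect to a common
reference measure, which is either Lebesgue measure (the `p i j` are probability density functions)
or counting measure on a countable set (the `p i j` are probability mass functions). -/
structure GHCMParams (Z : Type*) [Fintype Z] where
  /-- intensity of the Poisson point process -/
  lam : ℝ
  lam_pos : 0 < lam
  /-- dimension -/
  d : ℕ
  d_pos : 1 ≤ d
  /-- prior probabilities of the communities -/
  prior : Z → ℝ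
  prior_pos : ∀ i, 0 < prior i
  prior_sum : ∑ i, prior i = 1
  /-- reference measure of the densities -/
  ref : Measure ℝ
  ref_eq : ref = volume ∨ ∃ S : Set ℝ, S.Countable ∧ ref = Measure.count.restrict S
  /-- PDF / PMF of the pairwise distributions -/
  p : Z → Z → ℝ → ℝ
  p_measurable : ∀ i j, Measurable (p i j)
  p_nonneg : ∀ i j y, 0 ≤ p i j y
  p_lintegral : ∀ i j, ∫⁻ y, ENNReal.ofReal (p i j y) ∂ref = 1
  /-- `P i j` and `P j i` are the same distribution -/
  p_symm : ∀ i j, ref.withDensity (fun y => ENNReal.ofReal (p i j y)) =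
    ref.withDensity (fun y => ENNReal.ofReal (p j i y))

/-- Volume `ν_d` of the unit Euclidean ball in dimension `d`. -/
noncomputable def unitBallVolume (d : ℕ) : ℝ :=
  (volume (Metric.ball (0 : EuclideanSpace ℝ (Fin d)) 1)).toReal

/-- Toroidal distance on a cube of side length `L` with opposite faces identified. -/
noncomputable def torusDist {d : ℕ} (L : ℝ) (u v : Fin d → ℝ) : ℝ :=
  √(∑ c, (min |u c - v c| (L - |u c - v c|)) ^ 2)

/-- Unordered pairs of distinct vertices among `N` vertices (each represented once). -/
abbrev VertexPair (N : ℕ) : Type := {e : Fin N × Fin N // e.1 < e.2}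

/-- Locations of `N` vertices in `ℝ^d`. -/
abbrev Locations (d N : ℕ) : Type := Fin N → Fin d → ℝ

/-- A labeling of `N` vertices. -/
abbrev Labeling (Z : Type*) (N : ℕ) : Type _ := Fin N → Z

/-- Pairwise observations, one for each undirected edge. -/
abbrev Observations (N : ℕ) : Type := VertexPair N → ℝ

/-- A labeled graph with `N` vertices: locations, ground truth labels, pairwise observations. -/
abbrev LabeledGraph (Z : Type*) (d N : ℕ) : Type _ :=
  (Locations d N × Labeling Z N) × Observations N

namespace GHCMParams

variable {Z : Type*} [Fintype Z]

/-- The pairwise distribution `P i j`. -/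
noncomputable def P (M : GHCMParams Z) (i j : Z) : Measure ℝ :=
  M.ref.withDensity (fun y => ENNReal.ofReal (M.p i j y))

instance (M : GHCMParams Z) (i j : Z) : IsProbabilityMeasure (M.P i j) :=
  ⟨by rw [P, withDensity_apply _ MeasurableSet.univ, Measure.restrict_univ, M.p_lintegral]⟩

/-- Chernoff–Hellinger divergence `D_+(θ_i, θ_j)` of the vectors `θ_i = (p i r)_r` and
`θ_j = (p j r)_r` with prior `π`. -/
noncomputable def chDiv (M : GHCMParams Z) (i j : Z) : ℝ :=
  1 - ⨅ t : Set.Icc (0 : ℝ) 1,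
    ∑ r, M.prior r * ∫ y, M.p i r y ^ (t : ℝ) * M.p j r y ^ (1 - (t : ℝ)) ∂M.ref

/-- The set of permissible relabelings. -/
def permissible (M : GHCMParams Z) : Set (Equiv.Perm Z) :=
  {ω | (∀ i, M.prior i = M.prior (ω i)) ∧ ∀ i j, M.P i j = M.P (ω i) (ω j)}

/-- Side length `n^{1/d}` of the cube. -/
noncomputable def side (M : GHCMParams Z) (n : ℕ) : ℝ := (n : ℝ) ^ (1 / (M.d : ℝ))

/-- The cube `[-n^{1/d}/2, n^{1/d}/2]^d`. -/
def cube (M : GHCMParams Z) (n : ℕ) : Set (Fin M.d → ℝ) :=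
  Set.Icc (fun _ => -(M.side n) / 2) (fun _ => M.side n / 2)

/-- Two locations are mutually visible if their toroidal distance is at most `(log n)^{1/d}`. -/
def Visible (M : GHCMParams Z) (n : ℕ) (u v : Fin M.d → ℝ) : Prop :=
  torusDist (M.side n) u v ≤ Real.log n ^ (1 / (M.d : ℝ))

open Classical in
/-- Law of the observation between vertices at `u`, `v` with labels `a`, `b`. -/
noncomputable def obsLaw (M : GHCMParams Z) (n : ℕ) (u v : Fin M.d → ℝ) (a b : Z) : Measure ℝ :=
  if M.Visible n u v then M.P a b else Measure.dirac 0

instance (M : GHCMParams Z) (n : ℕ) (u v : Fin M.d → ℝ) (a b : Z) :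
    IsProbabilityMeasure (M.obsLaw n u v a b) := by
  unfold obsLaw; split_ifs <;> infer_instance

lemma measurableSet_visible (M : GHCMParams Z) (n : ℕ) {N : ℕ} (i j : Fin N) :
    MeasurableSet {v : Locations M.d N | M.Visible n (v i) (v j)} := by
  unfold Visible torusDist
  refine measurableSet_le (Continuous.measurable ?_) measurable_const
  fun_prop

variable [MeasurableSpace Z]

/-- Law of one label. -/
noncomputable def labelLaw (M : GHCMParams Z) : Measure Z :=
  ∑ i, ENNReal.ofReal (M.prior i) • Measure.dirac i

instance (M : GHCMParams Z) : IsProbabilityMeasure M.labelLaw := by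
  constructor
  simp only [labelLaw, Measure.finsetSum_apply, Measure.smul_apply, measure_univ, smul_eq_mul,
    mul_one]
  rw [← ENNReal.ofReal_sum_of_nonneg (fun i _ => (M.prior_pos i).le), M.prior_sum,
    ENNReal.ofReal_one]

variable [DiscreteMeasurableSpace Z]

/-- Conditionally on locations and labels, the pairwise observations are independent. -/
noncomputable def obsKernel (M : GHCMParams Z) (n N : ℕ) :
    Kernel (Locations M.d N × Labeling Z N) (Observations N) where
  toFun w := Measure.pi fun e : VertexPair N =>
    M.obsLaw n (w.1 e.1.1) (w.1 e.1.2) (w.2 e.1.1) (w.2 e.1.2)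
  measurable' := by
    classical
    let g : (VertexPair N → Bool) × Labeling Z N → Measure (Observations N) := fun q =>
      Measure.pi fun e : VertexPair N =>
        if q.1 e = true then M.P (q.2 e.1.1) (q.2 e.1.2) else Measure.dirac 0
    have hg : Measurable g := Measurable.of_discrete
    have hf : Measurable fun w : Locations M.d N × Labeling Z N =>
        ((fun e : VertexPair N => decide (M.Visible n (w.1 e.1.1) (w.1 e.1.2))), w.2) := by
      refine Measurable.prodMk (measurable_pi_lambda _ fun e => ?_) measurable_snd
      refine measurable_to_bool ?_
      have h := (M.measurableSet_visible n e.1.1 e.1.2).preimage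
        (measurable_fst : Measurable (Prod.fst : Locations M.d N × Labeling Z N → _))
      convert h using 1
      ext w
      simp
    convert hg.comp hf using 1
    funext w
    simp only [g, Function.comp, obsLaw, decide_eq_true_eq]

instance (M : GHCMParams Z) (n N : ℕ) : IsMarkovKernel (M.obsKernel n N) :=
  ⟨fun w => inferInstanceAs (IsProbabilityMeasure (Measure.pi fun e : VertexPair N =>
    M.obsLaw n (w.1 e.1.1) (w.1 e.1.2) (w.2 e.1.1) (w.2 e.1.2)))⟩

/-- Law of the labeled graph given that there are `N` vertices: the locations are independent and
uniform in the cube, the labels are independent with law `π`, and the observations are drawn from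
`obsKernel`. -/
noncomputable def lawGiven (M : GHCMParams Z) (n N : ℕ) : Measure (LabeledGraph Z M.d N) :=
  ((Measure.pi fun _ : Fin N => ProbabilityTheory.cond volume (M.cube n)).prod
    (Measure.pi fun _ : Fin N => M.labelLaw)) ⊗ₘ M.obsKernel n N

/-- The law of `G ∼ GHCM(λ, n, π, P, d)` together with the ground truth labels. The vertex set is a
homogeneous Poisson point process with intensity `λ` in the cube of volume `n`: a
`Poisson(λ n)` number of independent uniform points. -/
noncomputable def law (M : GHCMParams Z) (n : ℕ) : Measure (Σ N, LabeledGraph Z M.d N) :=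
  Measure.sum fun N =>
    poissonMeasure (Real.toNNReal (M.lam * n)) {N} • (M.lawGiven n N).map (Sigma.mk N)

open Classical in
/-- Agreement `A(x', x)` of an estimate `x'` with a labeling `x`. -/
noncomputable def agreement (M : GHCMParams Z) {N : ℕ} (x' x : Labeling Z N) : ℝ :=
  (1 / (N : ℝ)) * ⨆ ω : M.permissible, ∑ u, if x' u = (ω : Equiv.Perm Z) (x u) then (1 : ℝ) else 0

/-- A (possibly randomized) estimator, for each scale `n`: a measurable function of the locations,
the pairwise observations and an auxiliary random seed. -/
structure Estimator (M : GHCMParams Z) where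
  toFun : (n N : ℕ) → (Locations M.d N × Observations N) × unitInterval → Labeling Z N
  measurable : ∀ n N, Measurable (toFun n N)

/-- The probability of `A(x', x) = 1` at scale `n`; the seed is uniform on `[0, 1]` and
independent of the labeled graph. -/
noncomputable def successProb (M : GHCMParams Z) (est : M.Estimator) (n : ℕ) : ENNReal :=
  ((M.law n).prod (volume : Measure unitInterval))
    {s | M.agreement (est.toFun n s.1.1 ((s.1.2.1.1, s.1.2.2), s.2)) s.1.2.1.2 = 1}

/-- The estimator achieves exact recovery. -/
def ExactRecovery (M : GHCMParams Z) (est : M.Estimator) : Prop :=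
  Tendsto (fun n => M.successProb est n) atTop (𝓝 1)

end GHCMParams

/-! No estimator can separate labelings under which the data are comparably likely. Fix the
locations and call a labeling accepted if the estimate agrees with it up to a permissible
relabeling; every outcome accepts at most `|Z|!` labelings. Suppose that, with probability bounded
below, the true labeling `x` has inequivalent competitors whose likelihoods relative to `x` add up
to at least a constant. Whenever `x` is accepted, all of them are rejected, so the same data would
be an error if one of them were the truth. Summing over `x`, where each error is counted at most
`|Z|!` times, bounds the failure probability below by a constant (`half_le_mul_failure`). The seed
of a randomized estimator is simply part of the data.

For (a), the competitors change the label of one vertex from `i` to `j`. The likelihood ratio is a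
product over the visible neighbors. With `k` neighbors, the mean of the ratio truncated at `1` is at
least `c * σ ^ k` for every positive `σ < 1 - D_+`, by Chernoff's lower bound via exponential
tilting (`exists_le_integral_min_prod`). The neighbors lie in a ball of volume `ν log n`, so `σ ^ k`
has mean about `n ^ (-λ ν (1 - σ))`, and the total over about `λ n` vertices diverges when `λ ν (1 -
σ) < 1`. Concentration needs independence. Hence only vertices that are alone in the core of one of
order `n / log n` disjoint cells are used, the cell containing everything visible from its core. Two
second moment bounds follow: one over the locations (`measure_sum_soleWeight_lt_le`) and one over
labels and observations given the locations (`sum_measure_starRatio_lt_le`).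

For (b), the same count with `σ = 0` yields many occupied cores followed by an empty gap longer than
the visibility radius. Two gaps cut the circle into two mutually invisible parts. Applying a
nontrivial permissible relabeling to one part changes neither the prior probability nor the law of
the observations, so this competitor is exactly as likely as the truth (`exists_invisible_cut`).

Competitors are inequivalent because, with probability at least `3/4`, every label occurs both in a
fixed large vertex set and in its complement (`AllLabels`). All bounds are uniform over numbers of
vertices within `ε n` of `λ n`, which removes the Poisson randomness
(`not_exactRecovery_of_failGiven`). -/

/-! ### Product measures and second moments -/

/-- A product of measures with densities has the product of the densities as its density. -/
lemma MeasureTheory.Measure.pi_withDensity_ofReal {ι : Type*} [Fintype ι] {X : ι → Type*}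
    [∀ i, MeasurableSpace (X i)] (μ : ∀ i, Measure (X i)) [∀ i, SigmaFinite (μ i)]
    (f : ∀ i, X i → ℝ) (hf : ∀ i, Integrable (f i) (μ i)) (hf0 : ∀ i x, 0 ≤ f i x) :
    (Measure.pi μ).withDensity (fun z => ENNReal.ofReal (∏ i, f i (z i))) =
      Measure.pi fun i => (μ i).withDensity fun x => ENNReal.ofReal (f i x) := by
  have (i : ι) : IsFiniteMeasure ((μ i).withDensity fun x => ENNReal.ofReal (f i x)) :=
    isFiniteMeasure_withDensity_ofReal (hf i).2
  symm
  refine Measure.pi_eq (μ := fun i => (μ i).withDensity fun x => ENNReal.ofReal (f i x))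
    fun s hs => ?_
  rw [withDensity_apply _ (MeasurableSet.univ_pi hs), Measure.restrict_pi_pi,
    ← ofReal_integral_eq_lintegral_ofReal
      (Integrable.fintype_prod_dep fun i => (hf i).restrict)
      (ae_of_all _ fun z => Finset.prod_nonneg fun i _ => hf0 i _),
    integral_fintype_prod_eq_prod (μ := fun i => (μ i).restrict (s i)),
    ENNReal.ofReal_prod_of_nonneg fun i _ => integral_nonneg (hf0 i)]
  refine Finset.prod_congr rfl fun i _ => ?_
  rw [withDensity_apply _ (hs i), ofReal_integral_eq_lintegral_ofReal (hf i).restrict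
    (ae_of_all _ (hf0 i))]

/-- Chebyshev's inequality in terms of the first two moments of a nonnegative variable. -/
lemma measure_lt_half_integral_le {Ω : Type*} [MeasurableSpace Ω] {μ : Measure Ω}
    [IsProbabilityMeasure μ] {X : Ω → ℝ} (hX : MemLp X 2 μ) {κ : ℝ} (hpos : 0 < ∫ x, X x ∂μ)
    (h2 : ∫ x, X x ^ 2 ∂μ ≤ ∫ x, X x ∂μ + κ * (∫ x, X x ∂μ) ^ 2) :
    μ.real {x | X x < (∫ x, X x ∂μ) / 2} ≤ 4 / (∫ x, X x ∂μ) + 4 * (κ - 1) := by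
  set E := ∫ x, X x ∂μ with hE
  have h1 := meas_ge_le_variance_div_sq (μ := μ) hX (half_pos hpos)
  rw [← hE] at h1
  have hv : variance X μ ≤ E + (κ - 1) * E ^ 2 := by
    rw [variance_eq_sub hX]
    simp only [Pi.pow_apply]
    linarith
  have h3 : μ.real {x | X x < E / 2} ≤ variance X μ / (E / 2) ^ 2 := by
    have h0 : 0 ≤ variance X μ / (E / 2) ^ 2 := div_nonneg (variance_nonneg _ _) (sq_nonneg _)
    rw [← ENNReal.toReal_ofReal h0, Measure.real]
    refine ENNReal.toReal_mono ENNReal.ofReal_ne_top (le_trans (measure_mono ?_) h1)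
    intro x hx
    simp only [Set.mem_ofPred_eq] at hx ⊢
    rw [abs_of_neg (by linarith)]
    linarith
  refine h3.trans ?_
  rw [div_le_iff₀ (by positivity)]
  refine hv.trans (le_of_eq ?_)
  field_simp
  ring

/-- The marginal of a product of probability measures along an injective reindexing. -/
lemma MeasureTheory.Measure.pi_map_comp_injective {E J : Type*} [Fintype E] [Fintype J]
    {X : Type*} [MeasurableSpace X] (Q : E → Measure X) [∀ e, IsProbabilityMeasure (Q e)]
    {φ : J → E} (hφ : Function.Injective φ) :
    (Measure.pi Q).map (fun y j => y (φ j)) = Measure.pi fun j => Q (φ j) := by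
  classical
  symm
  refine Measure.pi_eq fun s hs => ?_
  rw [Measure.map_apply (by fun_prop) (MeasurableSet.univ_pi hs)]
  -- Off the range of `φ` the condition is vacuous, so those coordinates contribute mass one.
  let B : E → Set X := fun e => {x | ∀ j, φ j = e → x ∈ s j}
  have hB : (fun (y : E → X) j => y (φ j)) ⁻¹' Set.univ.pi s = Set.univ.pi B := by
    ext y
    simp only [Set.mem_preimage, Set.mem_pi, Set.mem_univ, true_imp_iff, B, Set.mem_ofPred_eq]
    exact ⟨fun h e j hj => hj ▸ h j, fun h j => h _ j rfl⟩
  rw [hB, Measure.pi_pi]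
  have h1 : ∀ j, B (φ j) = s j := by
    intro j
    ext x
    exact ⟨fun h => h j rfl, fun h k hk => (hφ hk) ▸ h⟩
  have h2 : ∀ e ∉ Finset.univ.image φ, Q e (B e) = 1 := by
    intro e he
    have : B e = Set.univ := by
      ext x
      simp only [Set.mem_univ, iff_true]
      intro j hj
      exact absurd (Finset.mem_image.2 ⟨j, Finset.mem_univ _, hj⟩) he
    rw [this, measure_univ]
  rw [← Finset.prod_subset (Finset.subset_univ (Finset.univ.image φ)) (fun e _ he => h2 e he),
    Finset.prod_image (fun a _ b _ h => hφ h)]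
  exact Finset.prod_congr rfl fun j _ => by rw [h1]

/-- Functions of disjoint blocks of coordinates are uncorrelated under a product measure. -/
lemma integral_pi_mul_of_disjoint {E J K : Type*} [Fintype E]
    {X : Type*} [MeasurableSpace X] (Q : E → Measure X) [∀ e, IsProbabilityMeasure (Q e)]
    {φ : J → E} {ψ : K → E} (hd : ∀ j k, φ j ≠ ψ k) {f : (J → X) → ℝ} {g : (K → X) → ℝ}
    (hf : Measurable f) (hg : Measurable g) :
    ∫ y, f (fun j => y (φ j)) * g (fun k => y (ψ k)) ∂Measure.pi Q =
      (∫ y, f (fun j => y (φ j)) ∂Measure.pi Q) * ∫ y, g (fun k => y (ψ k)) ∂Measure.pi Q := by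
  classical
  have h0 : iIndepFun (fun e (y : E → X) => y e) (Measure.pi Q) :=
    iIndepFun_pi (X := fun _ x => x) (fun _ => aemeasurable_id)
  let S : Finset E := Finset.univ.filter fun e => ∃ j, φ j = e
  let T : Finset E := Finset.univ.filter fun e => ∃ k, ψ k = e
  have hST : Disjoint S T := by
    rw [Finset.disjoint_left]
    rintro e he he'
    obtain ⟨j, rfl⟩ := (Finset.mem_filter.1 he).2
    obtain ⟨k, hk⟩ := (Finset.mem_filter.1 he').2
    exact hd j k hk.symm
  have h1 := h0.indepFun_finset S T hST (fun e => measurable_pi_apply e)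
  have mS : ∀ j, φ j ∈ S := fun j => Finset.mem_filter.2 ⟨Finset.mem_univ _, j, rfl⟩
  have mT : ∀ k, ψ k ∈ T := fun k => Finset.mem_filter.2 ⟨Finset.mem_univ _, k, rfl⟩
  have h2 := h1.comp (φ := fun z : S → X => f fun j => z ⟨φ j, mS j⟩)
    (ψ := fun z : T → X => g fun k => z ⟨ψ k, mT k⟩)
    (hf.comp (measurable_pi_lambda _ fun j => measurable_pi_apply _))
    (hg.comp (measurable_pi_lambda _ fun k => measurable_pi_apply _))
  exact h2.integral_fun_mul_eq_mul_integral
    (Measurable.aestronglyMeasurable (hf.comp (measurable_pi_lambda _ fun j => measurable_pi_apply _)))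
    (Measurable.aestronglyMeasurable (hg.comp (measurable_pi_lambda _ fun j => measurable_pi_apply _)))

/-! ### Chernoff's lower bound on testing errors -/

/-- First-order optimality of a minimiser over `[0, 1]`. -/
lemma IsMinOn.deriv_Icc {φ : ℝ → ℝ} {s φ' : ℝ} (hs : s ∈ Set.Icc (0 : ℝ) 1)
    (h : IsMinOn φ (Set.Icc 0 1) s) (hd : HasDerivAt φ φ' s) :
    φ' * s ≤ 0 ∧ 0 ≤ φ' * (1 - s) := by
  have hl : IsLocalMinOn φ (Set.Icc 0 1) s := h.localize
  have key : ∀ t ∈ Set.Icc (0 : ℝ) 1, 0 ≤ φ' * (t - s) := fun t ht => by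
    have := hl.hasFDerivWithinAt_nonneg hd.hasFDerivAt.hasFDerivWithinAt
      (sub_mem_posTangentConeAt_of_segment_subset ((convex_Icc 0 1).segment_subset hs ht))
    simpa [mul_comm] using this
  have h0 := key 0 ⟨le_rfl, zero_le_one⟩
  have h1 := key 1 ⟨zero_le_one, le_rfl⟩
  exact ⟨by linarith, h1⟩

/-- Exponential tilting of a product measure. -/
lemma integral_pi_eq_tilted {X : Type*} [MeasurableSpace X] {η : Measure X} [IsFiniteMeasure η]
    [NeZero η] {Y : X → ℝ} (s : ℝ) (hi : Integrable (fun x => Real.exp (s * Y x)) η)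
    {T : Type*} [Fintype T] (F : (T → X) → ℝ) :
    ∫ z, F z ∂(Measure.pi fun _ : T => η) =
      ∫ z, mgf Y η s ^ Fintype.card T * Real.exp (-(s * ∑ l, Y (z l))) * F z
        ∂(Measure.pi fun _ : T => η.tilted fun x => s * Y x) := by
  have hpos : 0 < mgf Y η s := mgf_pos' (NeZero.ne η) hi
  have h1 := Measure.pi_withDensity_ofReal (fun _ : T => η)
    (fun _ x => Real.exp (s * Y x) / mgf Y η s) (fun _ => hi.div_const _)
    (fun _ x => by positivity)
  have h2 : (Measure.pi fun _ : T => η.tilted fun x => s * Y x) =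
      (Measure.pi fun _ : T => η).withDensity
        fun z => ENNReal.ofReal (∏ l, (Real.exp (s * Y (z l)) / mgf Y η s)) := h1.symm
  have hm : AEMeasurable (fun z : T → X => ∏ l, (Real.exp (s * Y (z l)) / mgf Y η s))
      (Measure.pi fun _ : T => η) :=
    (Integrable.fintype_prod fun _ => hi.div_const (mgf Y η s)).aestronglyMeasurable.aemeasurable
  rw [h2, integral_withDensity_eq_integral_toReal_smul₀ hm.ennreal_ofReal
    (ae_of_all _ fun _ => ENNReal.ofReal_lt_top)]
  refine integral_congr_ae (ae_of_all _ fun z => ?_)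
  have h3 : 0 ≤ ∏ l, (Real.exp (s * Y (z l)) / mgf Y η s) :=
    Finset.prod_nonneg fun _ _ => by positivity
  simp only [ENNReal.toReal_ofReal h3, smul_eq_mul]
  rw [Finset.prod_div_distrib, ← Real.exp_sum, ← Finset.mul_sum, Finset.prod_const,
    Finset.card_univ, Real.exp_neg]
  field_simp

/-- Cramér–Chernoff lower bound for sums of bounded variables: the testing error decays no
faster than the minimum of the moment generating function over `[0, 1]`. -/
lemma exists_le_integral_min_exp_sum {X : Type*} [MeasurableSpace X] {η : Measure X}
    [IsFiniteMeasure η] {Y : X → ℝ} (hY : Measurable Y) {M : ℝ} (hM : ∀ x, |Y x| ≤ M)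
    {σ : ℝ} (hσ : 0 ≤ σ) (h : ∀ t ∈ Set.Icc (0 : ℝ) 1, σ < mgf Y η t) :
    ∃ c > 0, ∀ (T : Type) [Fintype T],
      c * σ ^ Fintype.card T ≤ ∫ z, min 1 (Real.exp (∑ l, Y (z l))) ∂Measure.pi fun _ : T => η := by
  have hη : NeZero η := ⟨by
    rintro rfl
    have := h 0 ⟨le_rfl, zero_le_one⟩
    simp at this
    linarith⟩
  have hb : ∀ x, Y x ∈ Set.Icc (-M) M := fun x => abs_le.1 (hM x)
  have hi : ∀ t, Integrable (fun x => Real.exp (t * Y x)) η := fun t =>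
    integrable_exp_mul_of_mem_Icc hY.aemeasurable (ae_of_all _ hb)
  have hset : integrableExpSet Y η = Set.univ := Set.eq_univ_of_forall hi
  have hint : ∀ t, t ∈ interior (integrableExpSet Y η) := fun t => by simp [hset]
  obtain ⟨s, hs, hmin⟩ := isCompact_Icc.exists_isMinOn (Set.nonempty_Icc.2 zero_le_one)
    (continuous_mgf hi).continuousOn (s := Set.Icc (0 : ℝ) 1)
  set ρ := mgf Y η s with hρ
  have hσρ : σ < ρ := h s hs
  have hρ0 : 0 < ρ := hσ.trans_lt hσρ
  set τ := η.tilted fun x => s * Y x with hτ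
  have : IsProbabilityMeasure τ := isProbabilityMeasure_tilted (hi s)
  have hYm : MemLp Y 2 τ := MemLp.of_bound hY.aestronglyMeasurable M
    (ae_of_all _ fun x => by simpa using hM x)
  set m := ∫ x, Y x ∂τ with hm
  have hderiv : HasDerivAt (mgf Y η) (ρ * m) s := by
    have h1 := hasDerivAt_mgf (hint s)
    have h2 : ρ * m = ∫ x, Y x * Real.exp (s * Y x) ∂η := by
      rw [hm, hτ, integral_tilted_mul_eq_mgf, ← hρ, ← integral_const_mul]
      refine integral_congr_ae (ae_of_all _ fun x => ?_)
      simp only [smul_eq_mul]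
      field_simp
    rw [h2]; exact h1
  obtain ⟨ho1, ho2⟩ := IsMinOn.deriv_Icc hs hmin hderiv
  -- The two inequalities cover all positions of the minimiser: the tilted mean vanishes in the
  -- interior, is nonnegative at `s = 0` and nonpositive at `s = 1`.
  have ho1 : s * m ≤ 0 := by
    by_contra hc
    push Not at hc
    nlinarith [mul_pos hρ0 hc]
  have ho2 : 0 ≤ (1 - s) * m := by
    by_contra hc
    push Not at hc
    nlinarith [mul_pos hρ0 (neg_pos.2 hc)]
  have hM0 : 0 ≤ M := by
    obtain ⟨x⟩ : Nonempty X := nonempty_of_isProbabilityMeasure τ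
    exact (abs_nonneg _).trans (hM x)
  -- choice of the slack
  obtain ⟨δ, hδ, hσδ⟩ : ∃ δ > 0, σ ≤ ρ * Real.exp (-δ) := by
    have h1 : Tendsto (fun δ : ℝ => ρ * Real.exp (-δ)) (𝓝[>] 0) (𝓝 (ρ * Real.exp (-0))) :=
      (Continuous.tendsto (by fun_prop) 0).mono_left nhdsWithin_le_nhds
    rw [neg_zero, Real.exp_zero, mul_one] at h1
    obtain ⟨δ, h2, h3⟩ := ((h1.eventually (lt_mem_nhds hσρ)).and self_mem_nhdsWithin).exists
    exact ⟨δ, h3, h2.le⟩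
  -- For `k ≥ k₀` Chebyshev's inequality, with variance at most `k * M ^ 2`, puts half of the tilted
  -- mass within `δ * k` of the mean. Smaller `k` are absorbed into the constant `exp (-(M * k₀))`.
  obtain ⟨k₀, hk₀⟩ := exists_nat_gt (2 * M ^ 2 / δ ^ 2)
  refine ⟨min (1 / 2) (Real.exp (-(M * k₀))), by positivity, fun T _ => ?_⟩
  set k := Fintype.card T with hk
  rw [integral_pi_eq_tilted s (hi s), ← hτ, ← hρ, ← hk]
  set τT := Measure.pi fun _ : T => τ with hτT
  set S : (T → X) → ℝ := fun z => ∑ l, Y (z l) with hS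
  have hSm : Measurable S := by
    simp only [hS]
    fun_prop
  have hSb : ∀ z, |S z| ≤ M * k := fun z => by
    refine (Finset.abs_sum_le_sum_abs _ _).trans ((Finset.sum_le_sum fun l _ => hM (z l)).trans ?_)
    simp [hk, mul_comm]
  set F : (T → X) → ℝ := fun z => ρ ^ k * Real.exp (-(s * S z)) * min 1 (Real.exp (S z)) with hF
  have hFeq : ∀ z, F z = ρ ^ k * min (Real.exp (-(s * S z))) (Real.exp ((1 - s) * S z)) := by
    intro z
    rw [hF]
    simp only
    rw [mul_assoc, mul_min_of_nonneg _ _ (Real.exp_pos _).le, mul_one, ← Real.exp_add]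
    ring_nf
  have hFlow : ∀ z (a : ℝ), -a ≤ -(s * S z) → -a ≤ (1 - s) * S z →
      ρ ^ k * Real.exp (-a) ≤ F z := fun z a h1 h2 => by
    rw [hFeq]
    exact mul_le_mul_of_nonneg_left (le_min (Real.exp_le_exp.2 h1) (Real.exp_le_exp.2 h2))
      (by positivity)
  have hFall : ∀ z, ρ ^ k * Real.exp (-(M * k)) ≤ F z := fun z => by
    obtain ⟨h1, h2⟩ := abs_le.1 (hSb z)
    refine hFlow z _ ?_ ?_
    · nlinarith [hs.1, hs.2, mul_nonneg hM0 (Nat.cast_nonneg (α := ℝ) k)]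
    · nlinarith [hs.1, hs.2, mul_nonneg hM0 (Nat.cast_nonneg (α := ℝ) k)]
  have hF0 : ∀ z, 0 ≤ F z := fun z => le_trans (by positivity) (hFall z)
  have hFi : Integrable F τT := by
    refine Integrable.of_bound (C := ρ ^ k * Real.exp (M * k)) ?_ (ae_of_all _ fun z => ?_)
    · exact Measurable.aestronglyMeasurable (by simp only [hF]; fun_prop)
    · rw [Real.norm_eq_abs, abs_of_nonneg (hF0 z), hFeq]
      refine mul_le_mul_of_nonneg_left ((min_le_left _ _).trans (Real.exp_le_exp.2 ?_))
        (by positivity)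
      obtain ⟨h1, h2⟩ := abs_le.1 (hSb z)
      nlinarith [hs.1, hs.2, mul_nonneg hM0 (Nat.cast_nonneg (α := ℝ) k)]
  change _ ≤ ∫ z, F z ∂τT
  have hσk : σ ^ k ≤ ρ ^ k * Real.exp (-(δ * k)) := by
    have : Real.exp (-(δ * k)) = Real.exp (-δ) ^ k := by
      rw [← Real.exp_nat_mul]; ring_nf
    rw [this, ← mul_pow]
    exact pow_le_pow_left₀ hσ hσδ k
  rcases lt_or_ge k k₀ with hkk | hkk
  · calc min (1 / 2) (Real.exp (-(M * k₀))) * σ ^ k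
        ≤ Real.exp (-(M * k₀)) * ρ ^ k :=
          mul_le_mul (min_le_right _ _) (pow_le_pow_left₀ hσ hσρ.le k) (by positivity)
            (by positivity)
      _ ≤ ρ ^ k * Real.exp (-(M * k)) := by
          rw [mul_comm]
          have : (k : ℝ) ≤ k₀ := by exact_mod_cast hkk.le
          gcongr
      _ = ∫ _, ρ ^ k * Real.exp (-(M * k)) ∂τT := by simp
      _ ≤ ∫ z, F z ∂τT := integral_mono (integrable_const _) hFi hFall
  · have hk0 : 0 < (k : ℝ) := by
      have h1 : 0 ≤ 2 * M ^ 2 / δ ^ 2 := by positivity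
      have h2 : (k₀ : ℝ) ≤ k := by exact_mod_cast hkk
      linarith
    let E : Set (T → X) := {z | |S z - k * m| < δ * k}
    have hE : MeasurableSet E := measurableSet_lt (by fun_prop) (by fun_prop)
    have hSmean : ∫ z, S z ∂τT = k * m := by
      simp only [hS]
      rw [integral_finsetSum _ fun l _ => integrable_comp_eval (μ := fun _ => τ)
        (hYm.integrable one_le_two)]
      have : ∀ l : T, ∫ z, Y (z l) ∂τT = m := fun l =>
        integral_comp_eval (μ := fun _ : T => τ) hY.aestronglyMeasurable
      rw [Finset.sum_congr rfl fun l _ => this l, Finset.sum_const, Finset.card_univ, ← hk,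
        nsmul_eq_mul]
    have hvar : variance S τT ≤ k * M ^ 2 := by
      have h1 := variance_sum_pi (μ := fun _ : T => τ) (X := fun _ => Y) fun _ => hYm
      have h2 : (∑ l : T, fun z : T → X => Y (z l)) = S := by
        ext z; simp [hS]
      rw [h2] at h1
      rw [h1, Finset.sum_const, Finset.card_univ, ← hk, nsmul_eq_mul]
      refine mul_le_mul_of_nonneg_left ?_ hk0.le
      refine (variance_le_expectation_sq hY.aestronglyMeasurable).trans ?_
      have h3 : ∀ x, (Y ^ 2) x ≤ M ^ 2 := fun x => by
        simpa using sq_le_sq' (hb x).1 (hb x).2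
      refine (integral_mono (hYm.integrable_sq) (integrable_const (M ^ 2)) h3).trans ?_
      simp
    have hPE : 1 / 2 ≤ τT.real E := by
      have hSL : MemLp S 2 τT := MemLp.of_bound hSm.aestronglyMeasurable (M * k)
        (ae_of_all _ fun z => by simpa using hSb z)
      have h1 := meas_ge_le_variance_div_sq hSL (mul_pos hδ hk0)
      rw [hSmean] at h1
      have h2 : Eᶜ = {z | δ * k ≤ |S z - k * m|} := by
        ext z; simp [E]
      have h3 : τT.real Eᶜ ≤ 1 / 2 := by
        rw [h2, Measure.real]
        refine ENNReal.toReal_le_of_le_ofReal (by norm_num) (h1.trans (ENNReal.ofReal_le_ofReal ?_))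
        rw [div_le_iff₀ (by positivity)]
        refine hvar.trans ?_
        have h4 : 2 * M ^ 2 / δ ^ 2 ≤ k := hk₀.le.trans (by exact_mod_cast hkk)
        rw [div_le_iff₀ (by positivity)] at h4
        nlinarith
      rw [probReal_compl_eq_one_sub hE] at h3
      linarith
    calc min (1 / 2) (Real.exp (-(M * k₀))) * σ ^ k
        ≤ (1 / 2) * (ρ ^ k * Real.exp (-(δ * k))) :=
          mul_le_mul (min_le_left _ _) hσk (by positivity) (by norm_num)
      _ ≤ τT.real E * (ρ ^ k * Real.exp (-(δ * k))) :=
          mul_le_mul_of_nonneg_right hPE (by positivity)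
      _ = ∫ z in E, ρ ^ k * Real.exp (-(δ * k)) ∂τT := by simp
      _ ≤ ∫ z in E, F z ∂τT := by
          refine setIntegral_mono_on (integrable_const _).integrableOn hFi.integrableOn hE ?_
          intro z hz
          obtain ⟨h1, h2⟩ := abs_lt.1 (show |S z - k * m| < δ * k from hz)
          have hδk := mul_pos hδ hk0
          -- Both exponents `-(s * S)` and `(1 - s) * S` are nonnegative at `S = k * m` by
          -- first-order optimality, and a deviation of at most `δ * k` costs at most `δ * k`.
          refine hFlow z _ ?_ ?_
          · nlinarith [hs.1, hs.2, mul_nonneg hs.1 (sub_nonneg.2 h2.le),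
              mul_nonneg (sub_nonneg.2 hs.2) hδk.le, mul_nonpos_of_nonneg_of_nonpos hk0.le ho1]
          · nlinarith [hs.1, hs.2, mul_nonneg (sub_nonneg.2 hs.2) (sub_nonneg.2 h1.le),
              mul_nonneg hs.1 hδk.le, mul_nonneg hk0.le ho2]
      _ ≤ ∫ z, F z ∂τT := setIntegral_le_integral hFi (ae_of_all _ hF0)

/-- Chernoff's lower bound on the testing error between the laws `μ` and `L • μ` from i.i.d.
samples. -/
lemma exists_le_integral_min_prod {X : Type*} [MeasurableSpace X] {μ : Measure X}
    [IsProbabilityMeasure μ] {L : X → ℝ} (hL : Measurable L) (hL0 : ∀ x, 0 ≤ L x)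
    (hLi : Integrable L μ) {σ σ' : ℝ} (hσ : 0 ≤ σ)
    (h : σ = 0 ∨ (σ < σ' ∧ ∀ t ∈ Set.Ioo (0 : ℝ) 1, σ' ≤ ∫ x, L x ^ t ∂μ)) :
    ∃ c > 0, ∀ (T : Type) [Fintype T],
      c * σ ^ Fintype.card T ≤ ∫ z, min 1 (∏ l, L (z l)) ∂Measure.pi fun _ : T => μ := by
  rcases h with rfl | ⟨hσσ', h⟩
  · refine ⟨1, one_pos, fun T _ => ?_⟩
    rcases isEmpty_or_nonempty T with hT | hT
    · simp
    · rw [zero_pow Fintype.card_ne_zero, mul_zero]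
      exact integral_nonneg fun z => le_min zero_le_one (Finset.prod_nonneg fun l _ => hL0 _)
  -- truncation of the likelihood ratio
  let A : ℕ → Set X := fun n => {x | 0 < L x ∧ |Real.log (L x)| ≤ n}
  have hA : ∀ n, MeasurableSet (A n) := fun n =>
    (measurableSet_lt measurable_const hL).inter
      (measurableSet_le (f := fun x => |Real.log (L x)|) (by fun_prop) measurable_const)
  have hAmono : Monotone A := fun a b hab x hx =>
    ⟨hx.1, hx.2.trans (by exact_mod_cast hab)⟩
  let Y : ℕ → X → ℝ := fun n x => max (-n) (min n (Real.log (L x)))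
  have hYm : ∀ n, Measurable (Y n) := fun n => by simp only [Y]; fun_prop
  have hYb : ∀ n x, |Y n x| ≤ n := fun n x =>
    abs_le.2 ⟨le_max_left _ _, max_le (by linarith [Nat.cast_nonneg (α := ℝ) n]) (min_le_left _ _)⟩
  have hYA : ∀ n, ∀ x ∈ A n, Y n x = Real.log (L x) := fun n x hx => by
    obtain ⟨h1, h2⟩ := abs_le.1 hx.2
    simp only [Y]
    rw [min_eq_right h2, max_eq_right h1]
  have hpow : ∀ x, 0 < L x → ∀ t, Real.exp (t * Real.log (L x)) = L x ^ t := fun x hx t => by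
    rw [Real.rpow_def_of_pos hx, mul_comm]
  have hmgf : ∀ n t, mgf (Y n) (μ.restrict (A n)) t = ∫ x in A n, L x ^ t ∂μ := fun n t => by
    rw [mgf]
    refine setIntegral_congr_fun (hA n) fun x hx => ?_
    rw [hYA n x hx, hpow x hx.1]
  have hdom : ∀ t ∈ Set.Icc (0 : ℝ) 1, ∀ x, L x ^ t ≤ 1 + L x := fun t ht x => by
    rcases le_total (L x) 1 with hx | hx
    · exact (Real.rpow_le_one (hL0 x) hx ht.1).trans (by linarith [hL0 x])
    · calc L x ^ t ≤ L x ^ (1 : ℝ) := Real.rpow_le_rpow_of_exponent_le hx ht.2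
        _ ≤ 1 + L x := by rw [Real.rpow_one]; linarith
  have hpi : ∀ t ∈ Set.Icc (0 : ℝ) 1, Integrable (fun x => L x ^ t) μ := fun t ht => by
    refine Integrable.mono' ((integrable_const 1).add hLi)
      (hL.pow_const t).aestronglyMeasurable (ae_of_all _ fun x => ?_)
    rw [Real.norm_eq_abs, abs_of_nonneg (Real.rpow_nonneg (hL0 x) t)]
    exact hdom t ht x
  obtain ⟨n, hn⟩ : ∃ n, ∀ t ∈ Set.Icc (0 : ℝ) 1, σ < mgf (Y n) (μ.restrict (A n)) t := by
    by_contra hcon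
    push Not at hcon
    -- A Dini-type argument: if every truncation level had a bad exponent, these nested compact sets
    -- would share a point `s`, which is bad for the untruncated integral as well.
    let C : ℕ → Set ℝ := fun n => Set.Icc 0 1 ∩ {t | mgf (Y n) (μ.restrict (A n)) t ≤ σ}
    have hcont : ∀ n, Continuous (mgf (Y n) (μ.restrict (A n))) := fun n =>
      continuous_mgf fun t => integrable_exp_mul_of_mem_Icc (hYm n).aemeasurable
        (ae_of_all _ fun x => abs_le.1 (hYb n x))
    have hCc : ∀ n, IsClosed (C n) := fun n =>
      isClosed_Icc.inter (isClosed_le (hcont n) continuous_const)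
    have hCanti : ∀ n, C (n + 1) ⊆ C n := by
      rintro n t ⟨ht, ht'⟩
      refine ⟨ht, (le_trans ?_ ht' : mgf (Y n) (μ.restrict (A n)) t ≤ σ)⟩
      rw [hmgf, hmgf]
      exact setIntegral_mono_set (hpi t ht).integrableOn
        (ae_of_all _ fun x => Real.rpow_nonneg (hL0 x) t) (hAmono n.le_succ).eventuallyLE
    obtain ⟨s, hs⟩ := IsCompact.nonempty_iInter_of_sequence_nonempty_isCompact_isClosed C hCanti
      (fun n => by obtain ⟨t, ht, ht'⟩ := hcon n; exact ⟨t, ht, ht'⟩)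
      (isCompact_Icc.of_isClosed_subset (hCc 0) Set.inter_subset_left) hCc
    rw [Set.mem_iInter] at hs
    have hs01 : s ∈ Set.Icc (0 : ℝ) 1 := (hs 0).1
    have hU : (⋃ n, A n) = {x | 0 < L x} := by
      ext x
      simp only [Set.mem_iUnion, A, Set.mem_ofPred_eq]
      exact ⟨fun ⟨n, hn⟩ => hn.1, fun hx => (exists_nat_ge |Real.log (L x)|).imp fun n hn => ⟨hx, hn⟩⟩
    have hpos : MeasurableSet {x | 0 < L x} := measurableSet_lt measurable_const hL
    -- The integral is restricted to `L > 0` because `L ^ t` jumps at `t = 0` where `L = 0`. The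
    -- restriction agrees with the full integral on the open interval and is continuous up to the
    -- endpoints, so the lower bound `σ'` extends to `s`.
    let Φ : ℝ → ℝ := fun t => ∫ x in {x | 0 < L x}, L x ^ t ∂μ
    have hΦs : Φ s ≤ σ := by
      have h1 := tendsto_setIntegral_of_monotone (μ := μ) (f := fun x => L x ^ s) hA hAmono
        (hpi s hs01).integrableOn
      rw [hU] at h1
      exact le_of_tendsto' h1 fun n => by rw [← hmgf]; exact (hs n).2
    have hΦ : ∀ t ∈ Set.Ioo (0 : ℝ) 1, σ' ≤ Φ t := fun t ht => by
      refine (h t ht).trans (le_of_eq ?_)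
      symm
      refine setIntegral_eq_integral_of_forall_compl_eq_zero fun x hx => ?_
      have : L x = 0 := le_antisymm (not_lt.1 hx) (hL0 x)
      rw [this, Real.zero_rpow ht.1.ne']
    have hΦc : ContinuousOn Φ (Set.Icc 0 1) := by
      intro t ht
      refine continuousWithinAt_of_dominated (bound := fun x => 1 + L x) ?_ ?_ ?_ ?_
      · exact Eventually.of_forall fun t => (hL.pow_const t).aestronglyMeasurable
      · filter_upwards [self_mem_nhdsWithin] with t ht
        refine ae_of_all _ fun x => ?_
        rw [Real.norm_eq_abs, abs_of_nonneg (Real.rpow_nonneg (hL0 x) t)]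
        exact hdom t ht x
      · exact ((integrable_const 1).add hLi).integrableOn
      · refine (ae_restrict_iff' hpos).2 (ae_of_all _ fun x hx => ?_)
        exact (Real.continuous_const_rpow (ne_of_gt hx)).continuousWithinAt
    have h3 : s ∈ closure (Set.Ioo (0 : ℝ) 1) := by
      rw [closure_Ioo zero_ne_one]; exact hs01
    have h4 : σ' ≤ Φ s := by
      have hne : (𝓝[Set.Ioo (0 : ℝ) 1] s).NeBot := mem_closure_iff_nhdsWithin_neBot.1 h3
      have h5 : Tendsto Φ (𝓝[Set.Ioo (0 : ℝ) 1] s) (𝓝 (Φ s)) :=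
        (hΦc s hs01).mono_left (nhdsWithin_mono _ Set.Ioo_subset_Icc_self)
      exact ge_of_tendsto h5 (by filter_upwards [self_mem_nhdsWithin] with t ht using hΦ t ht)
    linarith
  obtain ⟨c, hc, hcT⟩ := exists_le_integral_min_exp_sum (hYm n) (hYb n) hσ hn
  refine ⟨c, hc, fun T _ => (hcT T).trans ?_⟩
  rw [← Measure.restrict_pi_pi]
  have hF0 : ∀ z : T → X, 0 ≤ min 1 (∏ l, L (z l)) := fun z =>
    le_min zero_le_one (Finset.prod_nonneg fun l _ => hL0 _)
  have hFi : Integrable (fun z : T → X => min 1 (∏ l, L (z l))) (Measure.pi fun _ => μ) := by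
    refine Integrable.of_bound (C := 1) (Measurable.aestronglyMeasurable ?_)
      (ae_of_all _ fun z => ?_)
    · exact measurable_const.min (Finset.measurable_prod _ fun l _ =>
        hL.comp (measurable_pi_apply l))
    · rw [Real.norm_eq_abs, abs_of_nonneg (hF0 z)]
      exact min_le_left _ _
  refine le_trans (le_of_eq ?_) (setIntegral_le_integral hFi (ae_of_all _ hF0)
    (s := Set.univ.pi fun _ => A n))
  refine setIntegral_congr_fun (MeasurableSet.univ_pi fun _ => hA n) fun z hz => ?_
  rw [Real.exp_sum]
  congr 1
  refine Finset.prod_congr rfl fun l _ => ?_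
  have := hz l (Set.mem_univ _)
  rw [hYA n _ this, Real.exp_log this.1]

/-! ### Second moment of the number of isolated points -/

section Isolated

variable {X ι : Type*} {N : ℕ}

open Classical in
/-- Weight of a point relative to a cell with core `b` and surrounding region `B`. -/
noncomputable def cellWeight (b B : Set X) (σ : ℝ) (x : X) : ℝ :=
  if x ∈ b then 0 else if x ∈ B then σ else 1

/-- Factor of the point `l` in the weight of the configurations in which `u` is the only point in
the core `b`. -/
noncomputable def soleFactor (b B : Set X) (σ : ℝ) (u l : Fin N) (x : X) : ℝ :=
  if l = u then b.indicator 1 x else cellWeight b B σ x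

/-- If the core `b` contains exactly one point, this is `σ ^ k` with `k` the number of further
points in `B`; otherwise it is zero. -/
noncomputable def soleWeight (b B : Set X) (σ : ℝ) (v : Fin N → X) : ℝ :=
  ∑ u, ∏ l, soleFactor b B σ u l (v l)

variable {b B b' B' : Set X} {σ : ℝ}

lemma cellWeight_mem_Icc (hσ : σ ∈ Set.Icc (0 : ℝ) 1) (x : X) :
    cellWeight b B σ x ∈ Set.Icc (0 : ℝ) 1 := by
  unfold cellWeight
  split_ifs
  exacts [⟨le_rfl, zero_le_one⟩, hσ, ⟨zero_le_one, le_rfl⟩]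

lemma soleFactor_mem_Icc (hσ : σ ∈ Set.Icc (0 : ℝ) 1) (u l : Fin N) (x : X) :
    soleFactor b B σ u l x ∈ Set.Icc (0 : ℝ) 1 := by
  unfold soleFactor
  split_ifs
  · by_cases hx : x ∈ b <;> simp [hx]
  · exact cellWeight_mem_Icc hσ x

lemma prod_soleFactor_mem_Icc (hσ : σ ∈ Set.Icc (0 : ℝ) 1) (u : Fin N) (v : Fin N → X) :
    ∏ l, soleFactor b B σ u l (v l) ∈ Set.Icc (0 : ℝ) 1 :=
  ⟨Finset.prod_nonneg fun l _ => (soleFactor_mem_Icc hσ u l _).1,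
    Finset.prod_le_one (fun l _ => (soleFactor_mem_Icc hσ u l _).1)
      fun l _ => (soleFactor_mem_Icc hσ u l _).2⟩

lemma soleWeight_nonneg (hσ : σ ∈ Set.Icc (0 : ℝ) 1) (v : Fin N → X) :
    0 ≤ soleWeight b B σ v :=
  Finset.sum_nonneg fun u _ => (prod_soleFactor_mem_Icc hσ u v).1

/-- The clause for `σ = 0` provides the empty gaps in dimension one: the whole surrounding region is
then free of other points. -/
lemma mem_of_prod_soleFactor_ne_zero {u : Fin N} {v : Fin N → X}
    (h : ∏ l, soleFactor b B σ u l (v l) ≠ 0) :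
    v u ∈ b ∧ ∀ l ≠ u, v l ∉ b ∧ (σ = 0 → v l ∉ B) := by
  rw [Finset.prod_ne_zero_iff] at h
  refine ⟨?_, fun l hl => ?_⟩
  · have := h u (Finset.mem_univ _)
    simp only [soleFactor, if_true] at this
    exact Set.mem_of_indicator_ne_zero this
  · have := h l (Finset.mem_univ _)
    simp only [soleFactor, if_neg hl, cellWeight] at this
    refine ⟨fun hb => by simp [hb] at this, fun h0 hB => this ?_⟩
    simp [hB, h0]

/-- Two different points cannot both be the only occupant of the core. Hence at most one summand of
`soleWeight` is nonzero. -/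
lemma prod_soleFactor_mul_eq_zero {u u' : Fin N} (hu : u ≠ u') (v : Fin N → X) :
    (∏ l, soleFactor b B σ u l (v l)) * ∏ l, soleFactor b B σ u' l (v l) = 0 := by
  by_contra h
  obtain ⟨h1, h2⟩ := mul_ne_zero_iff.1 h
  exact ((mem_of_prod_soleFactor_ne_zero h1).2 u' hu.symm).1 (mem_of_prod_soleFactor_ne_zero h2).1

lemma soleWeight_eq_of_ne_zero {v : Fin N → X} (h : soleWeight b B σ v ≠ 0) :
    ∃ u, soleWeight b B σ v = ∏ l, soleFactor b B σ u l (v l) ∧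
      ∏ l, soleFactor b B σ u l (v l) ≠ 0 := by
  obtain ⟨u, -, hu⟩ := Finset.exists_ne_zero_of_sum_ne_zero h
  refine ⟨u, Finset.sum_eq_single_of_mem u (Finset.mem_univ u) fun u' _ hu' => ?_, hu⟩
  have := prod_soleFactor_mul_eq_zero (b := b) (B := B) (σ := σ) hu' v
  exact (mul_eq_zero.1 this).resolve_right hu

lemma soleWeight_le_one (hσ : σ ∈ Set.Icc (0 : ℝ) 1) (v : Fin N → X) :
    soleWeight b B σ v ≤ 1 := by
  by_cases h : soleWeight b B σ v = 0
  · rw [h]; exact zero_le_one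
  · obtain ⟨u, hu, -⟩ := soleWeight_eq_of_ne_zero h
    rw [hu]; exact (prod_soleFactor_mem_Icc hσ u v).2

variable [MeasurableSpace X] {τ : Measure X}

lemma integral_soleFactor (hb : MeasurableSet b) (u l : Fin N) :
    ∫ x, soleFactor b B σ u l x ∂τ = if l = u then τ.real b else ∫ x, cellWeight b B σ x ∂τ := by
  unfold soleFactor
  split_ifs
  · exact integral_indicator_one hb
  · rfl

variable [IsProbabilityMeasure τ]

lemma measurable_cellWeight (hb : MeasurableSet b) (hB : MeasurableSet B) :
    Measurable (cellWeight b B σ) :=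
  Measurable.ite hb measurable_const (Measurable.ite hB measurable_const measurable_const)

lemma measurable_soleFactor (hb : MeasurableSet b) (hB : MeasurableSet B) (u l : Fin N) :
    Measurable (soleFactor b B σ u l) := by
  unfold soleFactor
  split_ifs
  · exact measurable_one.indicator hb
  · exact measurable_cellWeight hb hB

lemma measurable_prod_soleFactor (hb : MeasurableSet b) (hB : MeasurableSet B) (u : Fin N) :
    Measurable fun v : Fin N → X => ∏ l, soleFactor b B σ u l (v l) :=
  Finset.measurable_prod _ fun l _ =>
    (measurable_soleFactor hb hB u l).comp (measurable_pi_apply l)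

lemma measurable_soleWeight (hb : MeasurableSet b) (hB : MeasurableSet B) :
    Measurable (soleWeight b B σ : (Fin N → X) → ℝ) :=
  Finset.measurable_sum _ fun u _ => measurable_prod_soleFactor hb hB u

lemma integrable_soleFactor (hσ : σ ∈ Set.Icc (0 : ℝ) 1) (hb : MeasurableSet b)
    (hB : MeasurableSet B) (u l : Fin N) : Integrable (soleFactor b B σ u l) τ :=
  Integrable.of_mem_Icc 0 1 (measurable_soleFactor hb hB u l).aemeasurable
    (ae_of_all _ fun x => soleFactor_mem_Icc hσ u l x)

lemma integrable_cellWeight (hσ : σ ∈ Set.Icc (0 : ℝ) 1) (hb : MeasurableSet b)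
    (hB : MeasurableSet B) : Integrable (cellWeight b B σ) τ :=
  Integrable.of_mem_Icc 0 1 (measurable_cellWeight hb hB).aemeasurable
    (ae_of_all _ fun x => cellWeight_mem_Icc hσ x)

lemma integrable_prod_soleFactor (hσ : σ ∈ Set.Icc (0 : ℝ) 1) (hb : MeasurableSet b)
    (hB : MeasurableSet B) (u : Fin N) :
    Integrable (fun v : Fin N → X => ∏ l, soleFactor b B σ u l (v l)) (Measure.pi fun _ => τ) :=
  Integrable.of_mem_Icc 0 1 (measurable_prod_soleFactor hb hB u).aemeasurable
    (ae_of_all _ fun v => prod_soleFactor_mem_Icc hσ u v)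

lemma integral_soleWeight (hσ : σ ∈ Set.Icc (0 : ℝ) 1) (hb : MeasurableSet b)
    (hB : MeasurableSet B) :
    ∫ v : Fin N → X, soleWeight b B σ v ∂(Measure.pi fun _ => τ) =
      N * (τ.real b * (∫ x, cellWeight b B σ x ∂τ) ^ (N - 1)) := by
  unfold soleWeight
  rw [integral_finsetSum _ fun u _ => integrable_prod_soleFactor hσ hb hB u]
  have : ∀ u : Fin N, ∫ v : Fin N → X, ∏ l, soleFactor b B σ u l (v l) ∂(Measure.pi fun _ => τ) =
      τ.real b * (∫ x, cellWeight b B σ x ∂τ) ^ (N - 1) := fun u => by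
    rw [integral_fintype_prod_eq_prod (μ := fun _ => τ)]
    simp_rw [integral_soleFactor hb]
    rw [← Finset.mul_prod_erase _ _ (Finset.mem_univ u), if_pos rfl]
    congr 1
    rw [Finset.prod_congr rfl fun l hl => if_neg (Finset.ne_of_mem_erase hl), Finset.prod_const,
      Finset.card_erase_of_mem (Finset.mem_univ u), Finset.card_univ, Fintype.card_fin]
  rw [Finset.sum_congr rfl fun u _ => this u, Finset.sum_const, Finset.card_univ,
    Fintype.card_fin, nsmul_eq_mul]

/-- The weights of disjoint cells are negatively correlated, up to the two coordinates `u` and `u'`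
that must lie in the cores. Each of these lacks one factor `Q` or `Q'` compared with the product of
the means, which costs at most `1 / q`. For `u = u'` the product vanishes, since one point cannot
lie in two disjoint cores. -/
lemma integral_soleFactor_mul_le (hσ : σ ∈ Set.Icc (0 : ℝ) 1) (hb : MeasurableSet b)
    (hB : MeasurableSet B) (hb' : MeasurableSet b') (hB' : MeasurableSet B') (hbB : b ⊆ B)
    (hbB' : b' ⊆ B') (hd : Disjoint B B') {q : ℝ} (hq : 0 < q)
    (h1 : q ≤ ∫ x, cellWeight b B σ x ∂τ) (h2 : q ≤ ∫ x, cellWeight b' B' σ x ∂τ)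
    (u u' : Fin N) :
    ∫ v : Fin N → X, (∏ l, soleFactor b B σ u l (v l)) * (∏ l, soleFactor b' B' σ u' l (v l))
        ∂(Measure.pi fun _ => τ) ≤
      (1 / q ^ 2) * ((τ.real b * (∫ x, cellWeight b B σ x ∂τ) ^ (N - 1)) *
        (τ.real b' * (∫ x, cellWeight b' B' σ x ∂τ) ^ (N - 1))) := by
  set Q := ∫ x, cellWeight b B σ x ∂τ with hQ
  set Q' := ∫ x, cellWeight b' B' σ x ∂τ with hQ'
  have hQ1 : Q ≤ 1 := by
    refine (integral_mono (integrable_cellWeight hσ hb hB) (integrable_const 1)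
      fun x => (cellWeight_mem_Icc hσ x).2).trans (by simp)
  have hQ1' : Q' ≤ 1 := by
    refine (integral_mono (integrable_cellWeight hσ hb' hB') (integrable_const 1)
      fun x => (cellWeight_mem_Icc hσ x).2).trans (by simp)
  have hQ0 : 0 < Q := hq.trans_le h1
  have hQ0' : 0 < Q' := hq.trans_le h2
  have hβ : 0 ≤ τ.real b := measureReal_nonneg
  have hβ' : 0 ≤ τ.real b' := measureReal_nonneg
  have hrhs : 0 ≤ (1 / q ^ 2) * ((τ.real b * Q ^ (N - 1)) * (τ.real b' * Q' ^ (N - 1))) := by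
    positivity
  rcases eq_or_ne u u' with rfl | hu
  · refine le_trans (le_of_eq ?_) hrhs
    rw [integral_eq_zero_of_ae]
    refine ae_of_all _ fun v => ?_
    by_contra h
    obtain ⟨h3, h4⟩ := mul_ne_zero_iff.1 h
    exact Set.disjoint_left.1 hd (hbB (mem_of_prod_soleFactor_ne_zero h3).1)
      (hbB' (mem_of_prod_soleFactor_ne_zero h4).1)
  simp_rw [← Finset.prod_mul_distrib]
  rw [integral_fintype_prod_eq_prod (μ := fun _ => τ)
    (f := fun l x => soleFactor b B σ u l x * soleFactor b' B' σ u' l x)]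
  have hI : ∀ l, Integrable (fun x => soleFactor b B σ u l x * soleFactor b' B' σ u' l x) τ :=
    fun l => Integrable.of_mem_Icc 0 1
      ((measurable_soleFactor hb hB u l).mul (measurable_soleFactor hb' hB' u' l)).aemeasurable
      (ae_of_all _ fun x => ⟨mul_nonneg (soleFactor_mem_Icc hσ u l x).1
        (soleFactor_mem_Icc hσ u' l x).1, mul_le_one₀ (soleFactor_mem_Icc hσ u l x).2
        (soleFactor_mem_Icc hσ u' l x).1 (soleFactor_mem_Icc hσ u' l x).2⟩)
  have hg0 : ∀ l, 0 ≤ ∫ x, soleFactor b B σ u l x * soleFactor b' B' σ u' l x ∂τ := fun l =>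
    integral_nonneg fun x => mul_nonneg (soleFactor_mem_Icc hσ u l x).1
      (soleFactor_mem_Icc hσ u' l x).1
  have hgl : ∀ l, ∫ x, soleFactor b B σ u l x * soleFactor b' B' σ u' l x ∂τ ≤
      ((if l = u then τ.real b else Q) * (if l = u' then τ.real b' else Q')) *
        (if l ∈ ({u, u'} : Finset (Fin N)) then 1 / q else 1) := by
    intro l
    have e1 : ∫ x, soleFactor b B σ u l x * soleFactor b' B' σ u' l x ∂τ ≤
        ∫ x, soleFactor b B σ u l x ∂τ := integral_mono (hI l) (integrable_soleFactor hσ hb hB u l)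
      fun x => mul_le_of_le_one_right (soleFactor_mem_Icc hσ u l x).1
        (soleFactor_mem_Icc hσ u' l x).2
    have e2 : ∫ x, soleFactor b B σ u l x * soleFactor b' B' σ u' l x ∂τ ≤
        ∫ x, soleFactor b' B' σ u' l x ∂τ := integral_mono (hI l)
      (integrable_soleFactor hσ hb' hB' u' l)
      fun x => mul_le_of_le_one_left (soleFactor_mem_Icc hσ u' l x).1
        (soleFactor_mem_Icc hσ u l x).2
    rw [integral_soleFactor hb] at e1
    rw [integral_soleFactor hb'] at e2
    by_cases hlu : l = u
    · have hlu' : l ≠ u' := fun h => hu (hlu.symm.trans h)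
      rw [if_pos hlu] at e1
      rw [if_pos hlu, if_neg hlu', if_pos (by simp [hlu])]
      refine e1.trans ?_
      rw [mul_assoc]
      refine le_mul_of_one_le_right hβ ?_
      rw [mul_one_div, one_le_div hq]
      exact h2
    · by_cases hlu' : l = u'
      · rw [if_pos hlu'] at e2
        rw [if_neg hlu, if_pos hlu', if_pos (by simp [hlu'])]
        refine e2.trans ?_
        rw [mul_comm Q, mul_assoc]
        refine le_mul_of_one_le_right hβ' ?_
        rw [mul_one_div, one_le_div hq]
        exact h1
      · rw [if_neg hlu, if_neg hlu', if_neg (by simp [hlu, hlu']), mul_one]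
        -- By disjointness at most one of the two weights differs from `1` at any point. The
        -- integral is therefore `Q + Q' - 1`, which is at most `Q * Q'` because `(1 - Q) * (1 - Q')
        -- ≥ 0`.
        have e3 : ∀ x, soleFactor b B σ u l x * soleFactor b' B' σ u' l x =
            cellWeight b B σ x + cellWeight b' B' σ x - 1 := fun x => by
          simp only [soleFactor, if_neg hlu, if_neg hlu']
          by_cases hx : x ∈ B
          · have hx' : x ∉ B' := Set.disjoint_left.1 hd hx
            have hx'' : x ∉ b' := fun h => hx' (hbB' h)
            simp [cellWeight, hx', hx'']
          · have hx' : x ∉ b := fun h => hx (hbB h)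
            simp [cellWeight, hx, hx']
        simp_rw [e3]
        rw [integral_sub (f := fun x => cellWeight b B σ x + cellWeight b' B' σ x)
          ((integrable_cellWeight hσ hb hB).add (integrable_cellWeight hσ hb' hB'))
          (integrable_const 1), integral_add (integrable_cellWeight hσ hb hB)
          (integrable_cellWeight hσ hb' hB'), ← hQ, ← hQ']
        simp only [integral_const, probReal_univ, smul_eq_mul, mul_one]
        nlinarith
  refine (Finset.prod_le_prod (fun l _ => hg0 l) fun l _ => hgl l).trans (le_of_eq ?_)
  rw [Finset.prod_mul_distrib, Finset.prod_mul_distrib, Finset.prod_ite_mem, Finset.univ_inter,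
    Finset.prod_const, Finset.card_pair hu, mul_comm, one_div_pow]
  congr 1
  have : ∀ (w : Fin N) (x y : ℝ), ∏ l, (if l = w then x else y) = x * y ^ (N - 1) := by
    intro w x y
    rw [← Finset.mul_prod_erase _ _ (Finset.mem_univ w), if_pos rfl]
    congr 1
    rw [Finset.prod_congr rfl fun l hl => if_neg (Finset.ne_of_mem_erase hl), Finset.prod_const,
      Finset.card_erase_of_mem (Finset.mem_univ w), Finset.card_univ, Fintype.card_fin]
  rw [this, this]

/-- The total weight of the isolated points of an i.i.d. sample concentrates. -/
lemma measure_sum_soleWeight_lt_le [Fintype ι] {b B : ι → Set X} (hσ : σ ∈ Set.Icc (0 : ℝ) 1)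
    (hb : ∀ c, MeasurableSet (b c)) (hB : ∀ c, MeasurableSet (B c)) (hbB : ∀ c, b c ⊆ B c)
    (hd : Pairwise fun c c' => Disjoint (B c) (B c')) {q : ℝ} (hq : 0 < q)
    (hqc : ∀ c, q ≤ ∫ x, cellWeight (b c) (B c) σ x ∂τ) {E : ℝ}
    (hE : E = ∑ c, N * (τ.real (b c) * (∫ x, cellWeight (b c) (B c) σ x ∂τ) ^ (N - 1)))
    (hE0 : 0 < E) :
    (Measure.pi fun _ : Fin N => τ).real {v | ∑ c, soleWeight (b c) (B c) σ v < E / 2} ≤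
      4 / E + 4 * (1 / q ^ 2 - 1) := by
  set P := Measure.pi fun _ : Fin N => τ with hP
  have hWi : ∀ c, Integrable (soleWeight (b c) (B c) σ : (Fin N → X) → ℝ) P := fun c =>
    Integrable.of_mem_Icc 0 1 (measurable_soleWeight (hb c) (hB c)).aemeasurable
      (ae_of_all _ fun v => ⟨soleWeight_nonneg hσ v, soleWeight_le_one hσ v⟩)
  have hEW : ∫ v, ∑ c, soleWeight (b c) (B c) σ v ∂P = E := by
    rw [integral_finsetSum _ fun c _ => hWi c, hE]
    exact Finset.sum_congr rfl fun c _ => integral_soleWeight hσ (hb c) (hB c)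
  have hmem : MemLp (fun v : Fin N → X => ∑ c, soleWeight (b c) (B c) σ v) 2 P := by
    refine memLp_finsetSum _ fun c _ => ?_
    refine MemLp.of_bound (measurable_soleWeight (hb c) (hB c)).aestronglyMeasurable 1
      (ae_of_all _ fun v => ?_)
    rw [Real.norm_eq_abs, abs_of_nonneg (soleWeight_nonneg hσ v)]
    exact soleWeight_le_one hσ v
  have hpair : ∀ c c', Integrable (fun v : Fin N → X => soleWeight (b c) (B c) σ v *
      soleWeight (b c') (B c') σ v) P := fun c c' =>
    Integrable.of_mem_Icc 0 1 ((measurable_soleWeight (hb c) (hB c)).mul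
      (measurable_soleWeight (hb c') (hB c'))).aemeasurable
      (ae_of_all _ fun v => ⟨mul_nonneg (soleWeight_nonneg hσ v) (soleWeight_nonneg hσ v),
        mul_le_one₀ (soleWeight_le_one hσ v) (soleWeight_nonneg hσ v) (soleWeight_le_one hσ v)⟩)
  set m : ι → ℝ := fun c => N * (τ.real (b c) * (∫ x, cellWeight (b c) (B c) σ x ∂τ) ^ (N - 1))
    with hm
  have hm0 : ∀ c, 0 ≤ m c := fun c => by
    have := hq.trans_le (hqc c)
    have : 0 ≤ τ.real (b c) := measureReal_nonneg
    positivity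
  classical
  -- On the diagonal the square of a weight in `[0, 1]` is at most the weight itself.
  have hcov : ∀ c c', ∫ v, soleWeight (b c) (B c) σ v * soleWeight (b c') (B c') σ v ∂P ≤
      (if c = c' then m c else 0) + 1 / q ^ 2 * (m c * m c') := by
    intro c c'
    rcases eq_or_ne c c' with rfl | hc
    · rw [if_pos rfl]
      have h1 : ∫ v, soleWeight (b c) (B c) σ v * soleWeight (b c) (B c) σ v ∂P ≤
          ∫ v, soleWeight (b c) (B c) σ v ∂P := integral_mono (hpair c c) (hWi c) fun v =>
        mul_le_of_le_one_left (soleWeight_nonneg hσ v) (soleWeight_le_one hσ v)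
      rw [integral_soleWeight hσ (hb c) (hB c)] at h1
      exact h1.trans
        (le_add_of_nonneg_right (mul_nonneg (by positivity) (mul_nonneg (hm0 c) (hm0 c))))
    · rw [if_neg hc, zero_add]
      unfold soleWeight
      simp_rw [Finset.sum_mul_sum]
      have hint : ∀ u u' : Fin N, Integrable (fun v : Fin N → X =>
          (∏ l, soleFactor (b c) (B c) σ u l (v l)) *
            ∏ l, soleFactor (b c') (B c') σ u' l (v l)) P := fun u u' =>
        Integrable.of_mem_Icc 0 1 ((measurable_prod_soleFactor (hb c) (hB c) u).mul
          (measurable_prod_soleFactor (hb c') (hB c') u')).aemeasurable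
          (ae_of_all _ fun v => ⟨mul_nonneg (prod_soleFactor_mem_Icc hσ u v).1
            (prod_soleFactor_mem_Icc hσ u' v).1, mul_le_one₀ (prod_soleFactor_mem_Icc hσ u v).2
            (prod_soleFactor_mem_Icc hσ u' v).1 (prod_soleFactor_mem_Icc hσ u' v).2⟩)
      rw [integral_finsetSum _ fun u _ => integrable_finsetSum _ fun u' _ => hint u u']
      simp_rw [integral_finsetSum _ fun u' _ => hint _ u']
      refine (Finset.sum_le_sum fun u _ => Finset.sum_le_sum fun u' _ =>
        integral_soleFactor_mul_le hσ (hb c) (hB c) (hb c') (hB c') (hbB c) (hbB c') (hd hc) hq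
          (hqc c) (hqc c') u u').trans (le_of_eq ?_)
      simp only [Finset.sum_const, Finset.card_univ, Fintype.card_fin, nsmul_eq_mul, hm]
      ring
  have h2 : ∫ v, (∑ c, soleWeight (b c) (B c) σ v) ^ 2 ∂P ≤ E + 1 / q ^ 2 * E ^ 2 := by
    simp_rw [sq, Finset.sum_mul_sum]
    rw [integral_finsetSum _ fun c _ => integrable_finsetSum _ fun c' _ => hpair c c']
    simp_rw [integral_finsetSum _ fun c' _ => hpair _ c']
    refine (Finset.sum_le_sum fun c _ => Finset.sum_le_sum fun c' _ => hcov c c').trans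
      (le_of_eq ?_)
    simp_rw [Finset.sum_add_distrib, Finset.sum_ite_eq, Finset.mem_univ, if_true, hE,
      ← Finset.mul_sum, Finset.sum_mul_sum, sq, Finset.mul_sum]
  have := measure_lt_half_integral_le hmem (κ := 1 / q ^ 2) (by rw [hEW]; exact hE0)
    (by rw [hEW]; exact h2)
  rwa [hEW] at this

end Isolated

/-! ### Asymptotics of the expected weight of isolated points -/

lemma tendsto_log_div_natCast : Tendsto (fun n : ℕ => Real.log n / n) atTop (𝓝 0) :=
  Real.isLittleO_log_id_atTop.tendsto_div_nhds_zero.comp tendsto_natCast_atTop_atTop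

/-- `n` times the probability that up to `μ n` uniform points in a volume `n` all avoid a set of
volume `κ log n` diverges if `μ κ < 1`. -/
lemma eventually_le_mul_one_sub_pow {κ μ : ℝ} (hκ : 0 ≤ κ) (hμ : 0 < μ) (h : μ * κ < 1) {c : ℝ}
    (hc : 0 < c) (T : ℝ) :
    ∀ᶠ n : ℕ in atTop, ∀ N : ℕ, (N : ℝ) ≤ μ * n → T ≤ c * n * (1 - κ * (Real.log n / n)) ^ N := by
  -- Any exponent strictly between `μ * κ` and `1` works: `log (1 - x) ≥ -x / (1 - x)` gives `(1 -
  -- x) ^ N ≥ n ^ (-γ)`, and `n ^ (1 - γ)` still diverges.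
  set γ := (1 + μ * κ) / 2 with hγ
  have hγ1 : γ < 1 := by rw [hγ]; linarith
  have hq : Tendsto (fun n : ℕ => 1 - κ * (Real.log n / n)) atTop (𝓝 1) := by
    simpa using (tendsto_log_div_natCast.const_mul κ).const_sub 1
  have h1 : Tendsto (fun n : ℕ => μ * κ / (1 - κ * (Real.log n / n))) atTop (𝓝 (μ * κ)) := by
    simpa [Pi.div_def] using (tendsto_const_nhds (x := μ * κ)).div hq one_ne_zero
  have h2 : Tendsto (fun n : ℕ => c * (n : ℝ) ^ (1 - γ)) atTop atTop :=
    ((tendsto_rpow_atTop (by linarith)).comp tendsto_natCast_atTop_atTop).const_mul_atTop hc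
  filter_upwards [h1.eventually (gt_mem_nhds (show μ * κ < γ by rw [hγ]; linarith)),
    hq.eventually (lt_mem_nhds (show (1 / 2 : ℝ) < 1 by norm_num)), h2.eventually_ge_atTop T,
    eventually_ge_atTop 1] with n e1 e2 e3 e4 N hN
  have hn : (0 : ℝ) < n := by exact_mod_cast e4
  have hl : 0 ≤ Real.log n := Real.log_natCast_nonneg n
  set x := κ * (Real.log n / n) with hx
  have hx0 : 0 ≤ x := by positivity
  have hq0 : 0 < 1 - x := by linarith
  refine e3.trans ?_
  have h3 : (n : ℝ) ^ (-γ) ≤ (1 - x) ^ N := by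
    rw [Real.rpow_def_of_pos hn, ← Real.exp_log hq0, ← Real.exp_nat_mul]
    refine Real.exp_le_exp.2 ?_
    have h4 := Real.one_sub_inv_le_log_of_pos hq0
    have h5 : 1 - (1 - x)⁻¹ = -(x / (1 - x)) := by field_simp; ring
    rw [h5] at h4
    have h6 : (N : ℝ) * (x / (1 - x)) ≤ γ * Real.log n := by
      calc (N : ℝ) * (x / (1 - x)) ≤ (μ * n) * (x / (1 - x)) :=
            mul_le_mul_of_nonneg_right hN (by positivity)
        _ = (μ * κ / (1 - x)) * Real.log n := by
            rw [hx]; field_simp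
        _ ≤ γ * Real.log n := mul_le_mul_of_nonneg_right e1.le hl
    nlinarith [mul_le_mul_of_nonneg_left h4 (Nat.cast_nonneg (α := ℝ) N)]
  calc c * (n : ℝ) ^ (1 - γ) = c * n * (n : ℝ) ^ (-γ) := by
        rw [sub_eq_add_neg, Real.rpow_add hn, Real.rpow_one, mul_assoc]
    _ ≤ c * n * (1 - x) ^ N := mul_le_mul_of_nonneg_left h3 (by positivity)

/-- Among order `n / log n` cells whose core has probability of order `log n / n`, many contain an
isolated point. -/
lemma eventually_half_le_measure_sum_soleWeight {lam μ κ : ℝ} (hlam : 0 < lam) (hμ : 0 < μ)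
    (hκ : 0 ≤ κ) (h : μ * κ < 1) {c₁ c₂ : ℝ} (hc₁ : 0 < c₁) (hc₂ : 0 < c₂) (T : ℝ) :
    ∀ᶠ n : ℕ in atTop, ∀ N : ℕ, lam * n ≤ N → (N : ℝ) ≤ μ * n →
      ∀ (X ι : Type) [MeasurableSpace X] [Fintype ι] (τ : Measure X) [IsProbabilityMeasure τ]
        (b B : ι → Set X) (σ : ℝ), σ ∈ Set.Icc (0 : ℝ) 1 →
        (∀ c, MeasurableSet (b c)) → (∀ c, MeasurableSet (B c)) → (∀ c, b c ⊆ B c) →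
        (Pairwise fun c c' => Disjoint (B c) (B c')) →
        c₁ * (n / Real.log n) ≤ Fintype.card ι →
        (∀ c, c₂ * (Real.log n / n) ≤ τ.real (b c)) →
        (∀ c, 1 - κ * (Real.log n / n) ≤ ∫ x, cellWeight (b c) (B c) σ x ∂τ) →
        1 / 2 ≤ (Measure.pi fun _ : Fin N => τ).real
          {v | T ≤ ∑ c, soleWeight (b c) (B c) σ v} := by
  have hq : Tendsto (fun n : ℕ => 1 - κ * (Real.log n / n)) atTop (𝓝 1) := by
    simpa using (tendsto_log_div_natCast.const_mul κ).const_sub 1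
  have hq2 : Tendsto (fun n : ℕ => 4 * (1 / (1 - κ * (Real.log n / n)) ^ 2 - 1)) atTop (𝓝 0) := by
    have := (((hq.pow 2).inv₀ (by norm_num)).sub_const 1).const_mul 4
    simpa using this
  -- The threshold `2 * T` makes half of the mean exceed `T`; the threshold `16` makes the variance
  -- term `4 / E` at most `1/4`. The other `1/4` is left for the correlation term, which vanishes as
  -- `q` tends to `1`.
  filter_upwards [eventually_le_mul_one_sub_pow hκ hμ h
      (show 0 < c₁ * c₂ * lam by positivity) (max (2 * T) 16),
    hq2.eventually (ge_mem_nhds (show (0 : ℝ) < 1 / 4 by norm_num)),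
    hq.eventually (lt_mem_nhds (show (1 / 2 : ℝ) < 1 by norm_num)), eventually_ge_atTop 2]
    with n e1 e2 e3 e4 N hN1 hN2 X ι _ _ τ _ b B σ hσ hb hB hbB hd hK hβ hw
  set q := 1 - κ * (Real.log n / n) with hqdef
  have hq0 : 0 < q := by linarith
  have hn : (0 : ℝ) < n := by positivity
  have hl : 0 < Real.log n := Real.log_pos (by exact_mod_cast e4)
  have hq1 : q ≤ 1 := by
    rw [hqdef]
    have : 0 ≤ κ * (Real.log n / n) := by positivity
    linarith
  set E := ∑ c, N * (τ.real (b c) * (∫ x, cellWeight (b c) (B c) σ x ∂τ) ^ (N - 1)) with hE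
  have hE1 : max (2 * T) 16 ≤ E := by
    refine (e1 N hN2).trans ?_
    have h1 : ∀ c ∈ Finset.univ, lam * n * (c₂ * (Real.log n / n) * q ^ N) ≤
        N * (τ.real (b c) * (∫ x, cellWeight (b c) (B c) σ x ∂τ) ^ (N - 1)) := fun c _ => by
      refine mul_le_mul hN1 (mul_le_mul (hβ c) ?_ (by positivity) measureReal_nonneg)
        (by positivity) (Nat.cast_nonneg _)
      exact (pow_le_pow_of_le_one hq0.le hq1 (Nat.sub_le N 1)).trans
        (pow_le_pow_left₀ hq0.le (hw c) _)
    refine le_trans ?_ (Finset.card_nsmul_le_sum _ _ _ h1)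
    rw [nsmul_eq_mul, Finset.card_univ]
    refine le_trans (le_of_eq ?_) (mul_le_mul_of_nonneg_right hK (by positivity))
    field_simp
  have hE16 : 16 ≤ E := (le_max_right _ _).trans hE1
  have hE0 : 0 < E := by linarith
  have hmain := measure_sum_soleWeight_lt_le hσ hb hB hbB hd hq0 hw hE hE0
  have h4 : 4 / E ≤ 1 / 4 := by rw [div_le_div_iff₀ hE0 (by norm_num)]; linarith
  have hms : MeasurableSet {v : Fin N → X | ∑ c, soleWeight (b c) (B c) σ v < E / 2} :=
    measurableSet_lt (Finset.measurable_sum _ fun c _ => measurable_soleWeight (hb c) (hB c))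
      measurable_const
  have h5 : {v : Fin N → X | ∑ c, soleWeight (b c) (B c) σ v < E / 2}ᶜ ⊆
      {v | T ≤ ∑ c, soleWeight (b c) (B c) σ v} := fun v hv => by
    have h6 : E / 2 ≤ ∑ c, soleWeight (b c) (B c) σ v := not_lt.1 hv
    have h7 : 2 * T ≤ E := (le_max_left _ _).trans hE1
    show T ≤ _
    linarith
  refine le_trans ?_ (measureReal_mono h5)
  rw [probReal_compl_eq_one_sub hms]
  linarith

/-! ### Concentration of the Poisson number of vertices -/

/-- The variance of a Poisson variable. -/
lemma integral_sub_sq_poissonMeasure (r : NNReal) :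
    Integrable (fun n : ℕ => ((n : ℝ) - r) ^ 2) (poissonMeasure r) ∧
      ∫ n : ℕ, ((n : ℝ) - r) ^ 2 ∂poissonMeasure r = r := by
  set f : ℕ → ℝ := fun n => Real.exp (-r) * r ^ n / n.factorial with hf
  have h0 : HasSum f 1 := hasSum_one_poissonMeasure r
  have h1 : HasSum (fun n => n * f n) r := by
    rw [← hasSum_nat_add_iff' 1]
    have : (fun n : ℕ => ((n + 1 : ℕ) : ℝ) * f (n + 1)) = fun n => (r : ℝ) * f n := by
      ext n
      simp only [hf, Nat.factorial_succ]
      push_cast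
      field_simp
      ring
    rw [this]
    simpa using h0.mul_left (r : ℝ)
  have h2 : HasSum (fun n => n * (n - 1) * f n) (r ^ 2 : ℝ) := by
    rw [← hasSum_nat_add_iff' 2]
    have : (fun n : ℕ => ((n + 2 : ℕ) : ℝ) * ((n + 2 : ℕ) - 1) * f (n + 2)) =
        fun n => (r : ℝ) ^ 2 * f n := by
      ext n
      simp only [hf, Nat.factorial_succ]
      push_cast
      have : (n : ℝ) + 2 - 1 = n + 1 := by ring
      rw [this]
      field_simp
      ring
    rw [this]
    simpa [Finset.sum_range_succ] using h0.mul_left ((r : ℝ) ^ 2)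
  have h3 : HasSum (fun n => f n * ((n : ℝ) - r) ^ 2) r := by
    convert! (h2.add (h1.mul_left (1 - 2 * (r : ℝ)))).add (h0.mul_left ((r : ℝ) ^ 2)) using 1
    · ext n; ring
    · ring
  refine ⟨integrable_poissonMeasure_iff.2 ?_, ?_⟩
  · refine h3.summable.congr fun n => ?_
    rw [Real.norm_eq_abs, abs_of_nonneg (sq_nonneg _)]
  · rw [integral_poissonMeasure]
    exact h3.tsum_eq

/-- A Poisson variable of large mean is of the order of its mean. -/
lemma eventually_half_le_poissonMeasure {lam ε : ℝ} (hlam : 0 < lam) (hε : 0 < ε) :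
    ∀ᶠ n : ℕ in atTop, 1 / 2 ≤ (poissonMeasure (Real.toNNReal (lam * n))).real
      {N : ℕ | (lam - ε) * n ≤ N ∧ (N : ℝ) ≤ (lam + ε) * n} := by
  filter_upwards [tendsto_natCast_atTop_atTop.eventually_ge_atTop (2 * lam / ε ^ 2),
    eventually_ge_atTop 1] with n hn hn1
  have hn0 : (0 : ℝ) < n := by exact_mod_cast hn1
  set r := Real.toNNReal (lam * n) with hr
  have hr' : (r : ℝ) = lam * n := Real.coe_toNNReal _ (by positivity)
  obtain ⟨hi, hv⟩ := integral_sub_sq_poissonMeasure r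
  have h1 := mul_meas_ge_le_integral_of_nonneg (ae_of_all _ fun n : ℕ => sq_nonneg ((n : ℝ) - r))
    hi ((ε * n) ^ 2)
  rw [hv, hr'] at h1
  set G : Set ℕ := {N : ℕ | (lam - ε) * n ≤ N ∧ (N : ℝ) ≤ (lam + ε) * n} with hG
  have h2 : Gᶜ ⊆ {N : ℕ | (ε * n) ^ 2 ≤ ((N : ℝ) - lam * n) ^ 2} := fun N hN => by
    show (ε * n) ^ 2 ≤ ((N : ℝ) - lam * n) ^ 2
    rw [sq_le_sq, abs_of_pos (by positivity : 0 < ε * (n : ℝ))]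
    by_contra hc
    obtain ⟨h3, h4⟩ := abs_lt.1 (not_le.1 hc)
    exact hN ⟨by linarith, by linarith⟩
  have h3 : (poissonMeasure r).real Gᶜ ≤ 1 / 2 := by
    refine (measureReal_mono h2).trans ?_
    have h4 : 2 * lam ≤ n * ε ^ 2 := by rwa [div_le_iff₀ (by positivity)] at hn
    have h5 : lam * n ≤ (ε * n) ^ 2 * (1 / 2) := by nlinarith
    have := h1.trans h5
    exact le_of_mul_le_mul_left this (by positivity)
  rw [probReal_compl_eq_one_sub (by measurability)] at h3
  linarith

/-! ### Failure probability in the presence of likely competitors -/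

section Flip

variable {𝓛 ι Y : Type*} [Fintype 𝓛] [MeasurableSpace Y] {w : 𝓛 → ENNReal} {R : 𝓛 → Measure Y}
  {A : 𝓛 → Set Y} {G : Finset 𝓛} {act : 𝓛 → Finset ι} {mv : ι → 𝓛 → 𝓛}
  {ψ : ι → 𝓛 → Y → ENNReal} {C q : ENNReal}

/-- If the hypothesis `x` has competitors `mv k x` whose laws dominate `ψ k x • R x` and which are
never accepted together with `x`, then acceptance of `x` is costly. -/
lemma sum_setLIntegral_le_failure (hA : ∀ x, MeasurableSet (A x))
    (hq : ∀ y, ∑ x, (A x).indicator 1 y ≤ q)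
    (hψ : ∀ x ∈ G, ∀ k ∈ act x,
      w x * ∫⁻ y in A x, ψ k x y ∂(R x) ≤ C * (w (mv k x) * R (mv k x) (A x)))
    (hinj : ∀ x ∈ G, Set.InjOn (fun k => mv k x) (act x))
    (hdisj : ∀ x ∈ G, ∀ k ∈ act x, Disjoint (A x) (A (mv k x))) :
    ∑ x ∈ G, ∑ k ∈ act x, w x * ∫⁻ y in A x, ψ k x y ∂(R x) ≤
      C * q * ∑ x, w x * R x (A x)ᶜ := by
  classical
  have h1 : ∀ x ∈ G, ∑ k ∈ act x, w x * ∫⁻ y in A x, ψ k x y ∂(R x) ≤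
      ∑ x', C * (w x' * R x' (A x ∩ (A x')ᶜ)) := fun x hx => by
    calc ∑ k ∈ act x, w x * ∫⁻ y in A x, ψ k x y ∂(R x)
        ≤ ∑ k ∈ act x, C * (w (mv k x) * R (mv k x) (A x ∩ (A (mv k x))ᶜ)) :=
          Finset.sum_le_sum fun k hk => by
            -- Acceptance of `x` excludes acceptance of its competitor, so intersecting with the
            -- rejection set of the competitor loses nothing.
            rw [Set.inter_eq_left.2 (hdisj x hx k hk).subset_compl_right]
            exact hψ x hx k hk
      _ = ∑ x' ∈ (act x).image fun k => mv k x, C * (w x' * R x' (A x ∩ (A x')ᶜ)) :=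
          (Finset.sum_image (f := fun x' => C * (w x' * R x' (A x ∩ (A x')ᶜ))) (hinj x hx)).symm
      _ ≤ _ := Finset.sum_le_sum_of_subset (Finset.subset_univ _)
  -- An outcome that is an error for `x'` lies in the acceptance sets of at most `q` labelings,
  -- hence is charged at most `q` times.
  have h2 : ∀ x', ∑ x, R x' (A x ∩ (A x')ᶜ) ≤ q * R x' (A x')ᶜ := fun x' => by
    calc ∑ x, R x' (A x ∩ (A x')ᶜ) = ∑ x, ∫⁻ y in (A x')ᶜ, (A x).indicator 1 y ∂(R x') :=
          Finset.sum_congr rfl fun x _ => by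
            rw [lintegral_indicator_one (hA x), Measure.restrict_apply (hA x)]
      _ = ∫⁻ y in (A x')ᶜ, ∑ x, (A x).indicator 1 y ∂(R x') :=
          (lintegral_finsetSum _ fun x _ => measurable_one.indicator (hA x)).symm
      _ ≤ ∫⁻ _ in (A x')ᶜ, q ∂(R x') := lintegral_mono fun y => hq y
      _ = q * R x' (A x')ᶜ := by simp
  calc ∑ x ∈ G, ∑ k ∈ act x, w x * ∫⁻ y in A x, ψ k x y ∂(R x)
      ≤ ∑ x, ∑ x', C * (w x' * R x' (A x ∩ (A x')ᶜ)) :=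
        (Finset.sum_le_sum h1).trans (Finset.sum_le_sum_of_subset (Finset.subset_univ _))
    _ = ∑ x', C * (w x' * ∑ x, R x' (A x ∩ (A x')ᶜ)) := by
        rw [Finset.sum_comm]
        simp_rw [Finset.mul_sum]
    _ ≤ ∑ x', C * (w x' * (q * R x' (A x')ᶜ)) :=
        Finset.sum_le_sum fun x' _ => by gcongr; exact h2 x'
    _ = C * q * ∑ x, w x * R x (A x)ᶜ := by
        rw [Finset.mul_sum]
        exact Finset.sum_congr rfl fun x _ => by ring

/-- Lower bound on the failure probability in the presence of likely competitors. -/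
lemma half_le_mul_failure [DecidableEq 𝓛] [∀ x, IsProbabilityMeasure (R x)] (hw : ∑ x, w x = 1)
    (hA : ∀ x, MeasurableSet (A x)) (hq : ∀ y, ∑ x, (A x).indicator 1 y ≤ q)
    (hψm : ∀ x k, Measurable (ψ k x))
    (hψ : ∀ x ∈ G, ∀ k ∈ act x,
      w x * ∫⁻ y in A x, ψ k x y ∂(R x) ≤ C * (w (mv k x) * R (mv k x) (A x)))
    (hinj : ∀ x ∈ G, Set.InjOn (fun k => mv k x) (act x))
    (hdisj : ∀ x ∈ G, ∀ k ∈ act x, Disjoint (A x) (A (mv k x)))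
    (hG : ∑ x ∈ Gᶜ, w x ≤ 4⁻¹)
    (hΨ : ∑ x, w x * R x {y | ∑ k ∈ act x, ψ k x y < 1} ≤ 4⁻¹) :
    2⁻¹ ≤ (C * q + 1) * ∑ x, w x * R x (A x)ᶜ := by
  have h1 : ∀ x ∈ G, w x ≤ w x * R x (A x)ᶜ + w x * R x {y | ∑ k ∈ act x, ψ k x y < 1} +
      ∑ k ∈ act x, w x * ∫⁻ y in A x, ψ k x y ∂(R x) := fun x _ => by
    have hm : Measurable fun y => ∑ k ∈ act x, ψ k x y :=
      Finset.measurable_sum _ fun k _ => hψm x k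
    have h2 : R x (A x ∩ {y | 1 ≤ ∑ k ∈ act x, ψ k x y}) ≤
        ∑ k ∈ act x, ∫⁻ y in A x, ψ k x y ∂(R x) := by
      rw [← lintegral_finsetSum _ fun k _ => hψm x k]
      have := mul_meas_ge_le_lintegral (μ := (R x).restrict (A x)) hm 1
      rwa [one_mul, Measure.restrict_apply (measurableSet_le measurable_const hm),
        Set.inter_comm] at this
    have h3 : (Set.univ : Set Y) ⊆ ((A x)ᶜ ∪ {y | ∑ k ∈ act x, ψ k x y < 1}) ∪
        (A x ∩ {y | 1 ≤ ∑ k ∈ act x, ψ k x y}) := fun y _ => by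
      by_cases hy : y ∈ A x
      · rcases lt_or_ge (∑ k ∈ act x, ψ k x y) 1 with h | h
        · exact Or.inl (Or.inr h)
        · exact Or.inr ⟨hy, h⟩
      · exact Or.inl (Or.inl hy)
    have h4 : 1 ≤ R x (A x)ᶜ + R x {y | ∑ k ∈ act x, ψ k x y < 1} +
        ∑ k ∈ act x, ∫⁻ y in A x, ψ k x y ∂(R x) := by
      refine (measure_univ (μ := R x)).symm.le.trans ?_
      refine (measure_mono h3).trans ((measure_union_le _ _).trans ?_)
      exact add_le_add (measure_union_le _ _) h2
    calc w x = w x * 1 := (mul_one _).symm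
      _ ≤ _ := mul_le_mul_right h4 _
      _ = _ := by rw [mul_add, mul_add, Finset.mul_sum]
  -- The total mass splits into rejection of the truth, too little competition (`1/4`), acceptance
  -- despite competition (at most `C * q` times the failure probability), and atypical labelings
  -- (`1/4`).
  have h5 : (1 : ENNReal) ≤ 2⁻¹ + (C * q + 1) * ∑ x, w x * R x (A x)ᶜ := by
    calc (1 : ENNReal) = ∑ x ∈ G, w x + ∑ x ∈ Gᶜ, w x := by
          rw [← hw, Finset.sum_add_sum_compl]
      _ ≤ (∑ x, w x * R x (A x)ᶜ + 4⁻¹ + C * q * ∑ x, w x * R x (A x)ᶜ) + 4⁻¹ := by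
          refine add_le_add ((Finset.sum_le_sum h1).trans ?_) hG
          rw [Finset.sum_add_distrib, Finset.sum_add_distrib]
          refine add_le_add (add_le_add (Finset.sum_le_sum_of_subset (Finset.subset_univ _))
            ((Finset.sum_le_sum_of_subset (Finset.subset_univ _)).trans hΨ)) ?_
          exact sum_setLIntegral_le_failure hA hq hψ hinj hdisj
      _ = (4⁻¹ + 4⁻¹) + (C * q + 1) * ∑ x, w x * R x (A x)ᶜ := by ring
      _ = _ := by
          congr 1
          rw [show (4 : ENNReal) = 2 * 2 by norm_num, ENNReal.mul_inv (by simp) (by simp),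
            ← mul_add, ENNReal.inv_two_add_inv_two, mul_one]
  refine (ENNReal.add_le_add_iff_left (a := 2⁻¹) (by simp)).1 ?_
  rwa [ENNReal.inv_two_add_inv_two]

end Flip

/-! ### Stars of vertices and their likelihood ratios -/

/-- A product of mixtures is the mixture of the products over all choices of the components. -/
lemma pi_sum_smul_map_mk {Z X T : Type*} [Fintype Z] [Fintype T] [DecidableEq T]
    [MeasurableSpace Z] [DiscreteMeasurableSpace Z] [MeasurableSpace X] (a : Z → ENNReal)
    (ha : ∀ r, a r ≠ ⊤) (κ : Z → Measure X) [∀ r, IsProbabilityMeasure (κ r)] :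
    Measure.pi (fun _ : T => ∑ r, a r • (κ r).map (Prod.mk r)) =
      ∑ x : T → Z, (∏ l, a (x l)) • (Measure.pi fun l => κ (x l)).map fun y l => (x l, y l) := by
  have hf (r : Z) : IsFiniteMeasure (a r • (κ r).map (Prod.mk r)) :=
    Measure.smul_finite _ (ha r)
  have : IsFiniteMeasure (∑ r, a r • (κ r).map (Prod.mk r)) := inferInstance
  refine Measure.pi_eq fun s hs => ?_
  simp only [Measure.finsetSum_apply, Measure.smul_apply, smul_eq_mul]
  rw [Finset.prod_univ_sum, Fintype.piFinset_univ]
  refine Finset.sum_congr rfl fun x _ => ?_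
  have hm : Measurable fun (y : T → X) l => (x l, y l) := by fun_prop
  rw [Measure.map_apply hm (MeasurableSet.univ_pi hs), Finset.prod_mul_distrib]
  congr 1
  have : (fun (y : T → X) l => (x l, y l)) ⁻¹' Set.univ.pi s =
      Set.univ.pi fun l => Prod.mk (x l) ⁻¹' s l := by
    ext y; simp
  rw [this, Measure.pi_pi]
  exact Finset.prod_congr rfl fun l _ => (Measure.map_apply (by fun_prop) (hs l)).symm

namespace GHCMParams

/-- The pair formed by two distinct vertices. -/
def edge {N : ℕ} (u l : Fin N) (h : l ≠ u) : VertexPair N :=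
  if h' : u < l then ⟨(u, l), h'⟩ else ⟨(l, u), lt_of_le_of_ne (not_lt.1 h') h⟩

lemma edge_eq_edge {N : ℕ} {u l u' l' : Fin N} {h : l ≠ u} {h' : l' ≠ u'}
    (he : edge u l h = edge u' l' h') : (u = u' ∧ l = l') ∨ (u = l' ∧ l = u') := by
  unfold edge at he
  split_ifs at he <;> simp only [Subtype.mk.injEq, Prod.mk.injEq] at he <;> tauto

lemma exists_eq_edge {N : ℕ} (e : VertexPair N) (u : Fin N) (h : e.1.1 = u ∨ e.1.2 = u) :
    ∃ l, ∃ h : l ≠ u, e = edge u l h := by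
  obtain ⟨⟨a, b⟩, hab⟩ := e
  rcases h with rfl | rfl
  · exact ⟨b, (ne_of_lt hab).symm, by unfold edge; rw [dif_pos hab]⟩
  · exact ⟨a, ne_of_lt hab, by unfold edge; rw [dif_neg (not_lt.2 (le_of_lt hab))]⟩

variable {Z : Type*} [Fintype Z] (M : GHCMParams Z)

lemma P_symm (i j : Z) : M.P i j = M.P j i := M.p_symm i j

lemma visible_symm {n : ℕ} {u v : Fin M.d → ℝ} : M.Visible n u v ↔ M.Visible n v u := by
  unfold Visible torusDist
  simp_rw [abs_sub_comm]

lemma obsLaw_symm (n : ℕ) (u v : Fin M.d → ℝ) (a b : Z) :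
    M.obsLaw n u v a b = M.obsLaw n v u b a := by
  unfold obsLaw
  by_cases h : M.Visible n u v
  · rw [if_pos h, if_pos (M.visible_symm.1 h), M.P_symm]
  · rw [if_neg h, if_neg fun h' => h (M.visible_symm.1 h')]

variable {n N : ℕ} (v : Locations M.d N)

/-- Law of the observation on the pair `e` given locations and labels. -/
noncomputable def obsAt (n : ℕ) (v : Locations M.d N) (x : Labeling Z N) (e : VertexPair N) :
    Measure ℝ :=
  M.obsLaw n (v e.1.1) (v e.1.2) (x e.1.1) (x e.1.2)

instance (x : Labeling Z N) (e : VertexPair N) : IsProbabilityMeasure (M.obsAt n v x e) := by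
  unfold obsAt; infer_instance

lemma obsAt_edge (x : Labeling Z N) {u l : Fin N} (h : l ≠ u) :
    M.obsAt n v x (edge u l h) = M.obsLaw n (v u) (v l) (x u) (x l) := by
  unfold obsAt edge
  split_ifs
  · rfl
  · exact M.obsLaw_symm _ _ _ _ _

/-- The vertices visible from `u`. -/
abbrev Nbr (n : ℕ) (v : Locations M.d N) (u : Fin N) : Type :=
  {l : Fin N // l ≠ u ∧ M.Visible n (v u) (v l)}

noncomputable instance (u : Fin N) : Fintype (M.Nbr n v u) := Fintype.ofFinite _

lemma obsAt_edge_nbr (x : Labeling Z N) {u : Fin N} (l : M.Nbr n v u) :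
    M.obsAt n v x (edge u l.1 l.2.1) = M.P (x u) (x l) := by
  rw [obsAt_edge, obsLaw, if_pos l.2.2]

lemma edge_nbr_injective (u : Fin N) :
    Function.Injective fun l : M.Nbr n v u => edge u l.1 l.2.1 := by
  intro l l' h
  rcases edge_eq_edge h with h' | h'
  · exact Subtype.ext h'.2
  · exact absurd h'.2 l.2.1

/-- Likelihood ratio of one labeled observation for the vertex labels `j` and `i`. -/
noncomputable def ratio (i j : Z) (z : Z × ℝ) : ℝ := M.p j z.1 z.2 / M.p i z.1 z.2

lemma ratio_nonneg (i j : Z) (z : Z × ℝ) : 0 ≤ M.ratio i j z :=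
  div_nonneg (M.p_nonneg _ _ _) (M.p_nonneg _ _ _)

lemma measurable_ratio_mk (i j r : Z) : Measurable fun t => M.ratio i j (r, t) :=
  (M.p_measurable j r).div (M.p_measurable i r)

/-- Division by zero makes the ratio vanish where `p i r` does, so the part of `P j r` living there
is lost. This is why changes of label give a domination rather than an equality. -/
lemma withDensity_ratio (i j r : Z) :
    (M.P i r).withDensity (fun t => ENNReal.ofReal (M.ratio i j (r, t))) =
      (M.P j r).restrict {t | M.p i r t ≠ 0} := by
  have hs : MeasurableSet {t | M.p i r t ≠ 0} :=
    (measurableSet_singleton (0 : ℝ)).compl.preimage (M.p_measurable i r)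
  unfold P
  rw [← withDensity_mul _ (M.p_measurable i r).ennreal_ofReal
    (M.measurable_ratio_mk i j r).ennreal_ofReal, restrict_withDensity hs,
    ← withDensity_indicator hs]
  congr 1
  ext t
  simp only [Pi.mul_apply, ratio]
  rw [← ENNReal.ofReal_mul (M.p_nonneg _ _ _)]
  by_cases h : M.p i r t = 0
  · simp [h]
  · rw [Set.indicator_of_mem (show t ∈ {t | M.p i r t ≠ 0} from h), mul_div_cancel₀ _ h]

/-- The integral is the mass that `P j r` gives to the support of `p i r`, which is finite. -/
lemma integrable_ratio_mk (i j r : Z) : Integrable (fun t => M.ratio i j (r, t)) (M.P i r) := by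
  refine ⟨(M.measurable_ratio_mk i j r).aestronglyMeasurable, ?_⟩
  rw [hasFiniteIntegral_iff_ofReal (ae_of_all _ fun t => M.ratio_nonneg i j (r, t)),
    ← setLIntegral_univ, ← withDensity_apply _ MeasurableSet.univ, withDensity_ratio]
  exact measure_lt_top _ _

/-- Likelihood ratio of the observations at the vertex `u` for its labels `j` and `i`. -/
noncomputable def starRatio (n : ℕ) (v : Locations M.d N) (i j : Z) (u : Fin N)
    (x : Labeling Z N) (y : Observations N) : ℝ :=
  ∏ l : M.Nbr n v u, M.ratio i j (x l, y (edge u l.1 l.2.1))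

lemma starRatio_nonneg (i j : Z) (u : Fin N) (x : Labeling Z N) (y : Observations N) :
    0 ≤ M.starRatio n v i j u x y :=
  Finset.prod_nonneg fun _ _ => M.ratio_nonneg _ _ _

lemma measurable_starRatio (i j : Z) (u : Fin N) (x : Labeling Z N) :
    Measurable (M.starRatio n v i j u x) :=
  Finset.measurable_prod _ fun l _ =>
    (M.measurable_ratio_mk i j (x l)).comp (measurable_pi_apply _)

/-- The likelihood ratio transports the law of the observations to (part of) their law after
changing the label of `u` from `i` to `j`. -/
lemma withDensity_starRatio_le (i j : Z) {u : Fin N} {x : Labeling Z N} (hx : x u = i) :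
    (Measure.pi (M.obsAt n v x)).withDensity
        (fun y => ENNReal.ofReal (M.starRatio n v i j u x y)) ≤
      Measure.pi (M.obsAt n v (Function.update x u j)) := by
  classical
  set x' := Function.update x u j with hx'
  -- Only visible pairs at `u` feel the change of label: an invisible pair at `u` always carries the
  -- observation `0`, and a pair avoiding `u` keeps both labels.
  have hcase : ∀ e : VertexPair N, (∃ l : M.Nbr n v u, edge u l.1 l.2.1 = e) ∨
      ((¬∃ l : M.Nbr n v u, edge u l.1 l.2.1 = e) ∧ M.obsAt n v x e = M.obsAt n v x' e) := by
    intro e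
    by_cases h : ∃ l : M.Nbr n v u, edge u l.1 l.2.1 = e
    · exact Or.inl h
    refine Or.inr ⟨h, ?_⟩
    by_cases hu : e.1.1 = u ∨ e.1.2 = u
    · obtain ⟨l, hl, rfl⟩ := exists_eq_edge e u hu
      rw [obsAt_edge, obsAt_edge, obsLaw, obsLaw]
      have : ¬M.Visible n (v u) (v l) := fun hv => h ⟨⟨l, hl, hv⟩, rfl⟩
      rw [if_neg this, if_neg this]
    · push Not at hu
      unfold obsAt
      rw [hx', Function.update_of_ne hu.1, Function.update_of_ne hu.2]
  -- The star ratio is extended to a product over all pairs by the factor `1`, so that the density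
  -- of the whole product measure factorizes. The chosen neighbor is unique since distinct neighbors
  -- give distinct pairs.
  let d : VertexPair N → ℝ → ℝ := fun e t =>
    if h : ∃ l : M.Nbr n v u, edge u l.1 l.2.1 = e then M.ratio i j (x h.choose, t) else 1
  let s : VertexPair N → Set ℝ := fun e =>
    {t | ∀ l : M.Nbr n v u, edge u l.1 l.2.1 = e → M.p i (x l) t ≠ 0}
  have hd : ∀ l : M.Nbr n v u, ∀ t, d (edge u l.1 l.2.1) t = M.ratio i j (x l, t) := fun l t => by
    have h : ∃ l' : M.Nbr n v u, edge u l'.1 l'.2.1 = edge u l.1 l.2.1 := ⟨l, rfl⟩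
    have := M.edge_nbr_injective v u h.choose_spec
    simp only [d, dif_pos h]
    rw [this]
  have hprod : ∀ y, M.starRatio n v i j u x y = ∏ e, d e (y e) := fun y => by
    refine Finset.prod_of_injOn (fun l : M.Nbr n v u => edge u l.1 l.2.1)
      (M.edge_nbr_injective v u).injOn (fun _ _ => Finset.mem_coe.2 (Finset.mem_univ _)) ?_
      fun l _ => (hd l _).symm
    intro e _ he
    have : ¬∃ l : M.Nbr n v u, edge u l.1 l.2.1 = e := fun ⟨l, hl⟩ => he ⟨l, by simp, hl⟩
    simp only [d, dif_neg this]
  have hd0 : ∀ e t, 0 ≤ d e t := fun e t => by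
    simp only [d]
    split_ifs
    exacts [M.ratio_nonneg _ _ _, zero_le_one]
  have hdi : ∀ e, Integrable (d e) (M.obsAt n v x e) := fun e => by
    rcases hcase e with ⟨l, rfl⟩ | ⟨h, -⟩
    · rw [obsAt_edge_nbr, hx]
      exact (M.integrable_ratio_mk i j (x l)).congr (ae_of_all _ fun t => (hd l t).symm)
    · have : d e = fun _ => 1 := by ext t; simp only [d, dif_neg h]
      rw [this]
      exact integrable_const 1
  have hedge : ∀ e, (M.obsAt n v x e).withDensity (fun t => ENNReal.ofReal (d e t)) =
      (M.obsAt n v x' e).restrict (s e) := fun e => by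
    rcases hcase e with ⟨l, rfl⟩ | ⟨h, h'⟩
    · rw [obsAt_edge_nbr, obsAt_edge_nbr, hx]
      simp_rw [hd l]
      rw [withDensity_ratio, hx', Function.update_self, Function.update_of_ne l.2.1]
      congr 1
      ext t
      refine ⟨fun ht l' hl' => ?_, fun ht => ht l rfl⟩
      rw [M.edge_nbr_injective v u hl']
      exact ht
    · have h1 : (fun t => ENNReal.ofReal (d e t)) = 1 := by
        ext t; simp only [d, dif_neg h, ENNReal.ofReal_one, Pi.one_apply]
      have h2 : s e = Set.univ := by
        ext t
        simp only [s, Set.mem_univ, iff_true]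
        exact fun l hl => absurd ⟨l, hl⟩ h
      rw [h1, h2, withDensity_one, Measure.restrict_univ, h']
  simp_rw [hprod]
  rw [Measure.pi_withDensity_ofReal _ d hdi hd0]
  simp_rw [hedge]
  rw [← Measure.restrict_pi_pi]
  exact Measure.restrict_le_self

/-- Domination in the form used for the flipping argument, with an auxiliary seed. -/
lemma setLIntegral_starRatio_le {S : Type*} [MeasurableSpace S] (ν : Measure S) [SFinite ν]
    (i j : Z) {u : Fin N} {x : Labeling Z N} (hx : x u = i) {A : Set (Observations N × S)}
    (hA : MeasurableSet A) :
    ∫⁻ y in A, ENNReal.ofReal (min 1 (M.starRatio n v i j u x y.1))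
        ∂((Measure.pi (M.obsAt n v x)).prod ν) ≤
      ((Measure.pi (M.obsAt n v (Function.update x u j))).prod ν) A := by
  have hm : Measurable fun y => ENNReal.ofReal (M.starRatio n v i j u x y) :=
    (M.measurable_starRatio v i j u x).ennreal_ofReal
  calc ∫⁻ y in A, ENNReal.ofReal (min 1 (M.starRatio n v i j u x y.1))
        ∂((Measure.pi (M.obsAt n v x)).prod ν)
      ≤ ∫⁻ y in A, ENNReal.ofReal (M.starRatio n v i j u x y.1)
        ∂((Measure.pi (M.obsAt n v x)).prod ν) :=
        lintegral_mono fun y => ENNReal.ofReal_le_ofReal (min_le_right _ _)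
    _ = (((Measure.pi (M.obsAt n v x)).withDensity
          fun y => ENNReal.ofReal (M.starRatio n v i j u x y)).prod ν) A := by
        rw [prod_withDensity_left hm, withDensity_apply _ hA]
    _ ≤ _ := Measure.prod_mono (M.withDensity_starRatio_le v i j hx) le_rfl A
end GHCMParams

/-! ### Averages over neighbor labels and observations -/

namespace GHCMParams

variable {Z : Type*} [Fintype Z] (M : GHCMParams Z) {n N : ℕ} (v : Locations M.d N)

/-- Prior probability of a labeling. -/
noncomputable def labelProb {T : Type*} [Fintype T] (x : T → Z) : ℝ := ∏ u, M.prior (x u)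

lemma labelProb_nonneg {T : Type*} [Fintype T] (x : T → Z) : 0 ≤ M.labelProb x :=
  Finset.prod_nonneg fun _ _ => (M.prior_pos _).le

lemma sum_labelProb {T : Type*} [Fintype T] [DecidableEq T] :
    ∑ x : T → Z, M.labelProb x = 1 := by
  unfold labelProb
  rw [← Fintype.piFinset_univ, ← Finset.prod_univ_sum]
  simp [M.prior_sum]

/-- Truncated likelihood ratio for the labels `j` and `i`, from marks. -/
noncomputable def minRatio {T : Type*} [Fintype T] (i j : Z) (z : T → Z × ℝ) : ℝ :=
  min 1 (∏ l, M.ratio i j (z l))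

lemma minRatio_mem_Icc {T : Type*} [Fintype T] (i j : Z) (z : T → Z × ℝ) :
    M.minRatio i j z ∈ Set.Icc (0 : ℝ) 1 :=
  ⟨le_min zero_le_one (Finset.prod_nonneg fun _ _ => M.ratio_nonneg _ _ _), min_le_left _ _⟩

lemma minRatio_star (i j : Z) (u : Fin N) (x : Labeling Z N) (y : Observations N) :
    min 1 (M.starRatio n v i j u x y) =
      M.minRatio i j fun l : M.Nbr n v u => (x l, y (edge u l.1 l.2.1)) := rfl

variable [MeasurableSpace Z] [DiscreteMeasurableSpace Z]

lemma labelLaw_real_singleton (r : Z) : M.labelLaw.real {r} = M.prior r := by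
  classical
  rw [Measure.real, labelLaw, Measure.finsetSum_apply]
  simp only [Measure.smul_apply, Measure.dirac_apply, smul_eq_mul, Set.indicator_apply,
    Set.mem_singleton_iff, Pi.one_apply, mul_ite, mul_one, mul_zero, Finset.sum_ite_eq',
    Finset.mem_univ, if_true]
  exact ENNReal.toReal_ofReal (M.prior_pos r).le

lemma pi_labelLaw_singleton {T : Type*} [Fintype T] (x : T → Z) :
    Measure.pi (fun _ : T => M.labelLaw) {x} = ENNReal.ofReal (M.labelProb x) := by
  rw [Measure.pi_singleton, labelProb, ENNReal.ofReal_prod_of_nonneg fun _ _ => (M.prior_pos _).le]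
  refine Finset.prod_congr rfl fun u _ => ?_
  rw [← M.labelLaw_real_singleton, ofReal_measureReal]

lemma integral_pi_labelLaw {T : Type*} [Fintype T] [DecidableEq T] (g : (T → Z) → ℝ) :
    ∫ x, g x ∂(Measure.pi fun _ : T => M.labelLaw) = ∑ x, M.labelProb x * g x := by
  rw [integral_fintype (Integrable.of_finite)]
  refine Finset.sum_congr rfl fun x _ => ?_
  rw [Measure.real, pi_labelLaw_singleton, ENNReal.toReal_ofReal (M.labelProb_nonneg x),
    smul_eq_mul]

/-- Joint law of the label of a neighbor and the observation on the edge to it, for a vertex with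
label `i`. -/
noncomputable def markLaw (i : Z) : Measure (Z × ℝ) :=
  ∑ r, ENNReal.ofReal (M.prior r) • (M.P i r).map (Prod.mk r)

instance (i : Z) : IsProbabilityMeasure (M.markLaw i) := by
  constructor
  simp only [markLaw, Measure.finsetSum_apply, Measure.smul_apply, smul_eq_mul]
  have : ∀ r, ((M.P i r).map (Prod.mk r)) Set.univ = 1 := fun r => by
    rw [Measure.map_apply (by fun_prop) MeasurableSet.univ, Set.preimage_univ, measure_univ]
  simp_rw [this, mul_one]
  rw [← ENNReal.ofReal_sum_of_nonneg (fun i _ => (M.prior_pos i).le), M.prior_sum,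
    ENNReal.ofReal_one]

lemma integral_pi_markLaw {T : Type*} [Fintype T] [DecidableEq T] (i : Z)
    {g : (T → Z × ℝ) → ℝ} (hg : Measurable g) (hg1 : ∀ z, g z ∈ Set.Icc (0 : ℝ) 1) :
    ∫ z, g z ∂(Measure.pi fun _ : T => M.markLaw i) =
      ∑ x : T → Z, M.labelProb x *
        ∫ y, g (fun l => (x l, y l)) ∂(Measure.pi fun l => M.P i (x l)) := by
  unfold markLaw
  rw [pi_sum_smul_map_mk _ (fun r => ENNReal.ofReal_ne_top), integral_finsetSum_measure]
  · refine Finset.sum_congr rfl fun x _ => ?_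
    have hm : Measurable fun (y : T → ℝ) l => (x l, y l) := by fun_prop
    rw [integral_smul_measure, integral_map hm.aemeasurable hg.aestronglyMeasurable, smul_eq_mul,
      ← ENNReal.ofReal_prod_of_nonneg fun _ _ => (M.prior_pos _).le,
      ENNReal.toReal_ofReal (Finset.prod_nonneg fun _ _ => (M.prior_pos _).le)]
    rfl
  · intro x _
    refine Integrable.smul_measure ?_ (ENNReal.prod_ne_top fun _ _ => ENNReal.ofReal_ne_top)
    have hm : Measurable fun (y : T → ℝ) l => (x l, y l) := by fun_prop
    have := Measure.isProbabilityMeasure_map (μ := Measure.pi fun l => M.P i (x l)) hm.aemeasurable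
    exact Integrable.of_mem_Icc 0 1 hg.aemeasurable (ae_of_all _ hg1)

lemma measurable_ratio (i j : Z) : Measurable (M.ratio i j) :=
  measurable_from_prod_countable_right fun r => M.measurable_ratio_mk i j r

lemma measurable_minRatio {T : Type*} [Fintype T] (i j : Z) :
    Measurable (M.minRatio i j : (T → Z × ℝ) → ℝ) :=
  measurable_const.min (Finset.measurable_prod _ fun l _ =>
    (M.measurable_ratio i j).comp (measurable_pi_apply l))

/-- Conditional mean of the truncated likelihood ratio given the labels of the neighbors. -/
noncomputable def condMinRatio {T : Type*} [Fintype T] (i j : Z) (x : T → Z) : ℝ :=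
  ∫ y, M.minRatio i j (fun l => (x l, y l)) ∂(Measure.pi fun l => M.P i (x l))

/-- Only the marginal on the pairs of the star matters, and there the observations are independent
with laws `P i (x l)`. -/
lemma integral_minRatio_star (i j : Z) {u : Fin N} {x : Labeling Z N} (hx : x u = i) :
    ∫ y, min 1 (M.starRatio n v i j u x y) ∂(Measure.pi (M.obsAt n v x)) =
      M.condMinRatio i j fun l : M.Nbr n v u => x l := by
  unfold condMinRatio
  simp_rw [minRatio_star]
  have h1 := Measure.pi_map_comp_injective (M.obsAt n v x) (M.edge_nbr_injective (n := n) v u)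
  simp_rw [obsAt_edge_nbr, hx] at h1
  have hm : Measurable fun y : M.Nbr n v u → ℝ => M.minRatio i j fun l => (x l.1, y l) :=
    (M.measurable_minRatio i j).comp (by fun_prop)
  have he : Measurable fun (y : Observations N) (l : M.Nbr n v u) => y (edge u l.1 l.2.1) := by
    fun_prop
  rw [← h1, integral_map he.aemeasurable hm.aestronglyMeasurable]

/-- No vertex of `{u} ∪ Nbr u` belongs to `{u'} ∪ Nbr u'`. -/
def SeparatedStars (n : ℕ) (v : Locations M.d N) (u u' : Fin N) : Prop :=
  ∀ l l', (l = u ∨ M.Visible n (v u) (v l)) → (l' = u' ∨ M.Visible n (v u') (v l')) → l ≠ l'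

variable {v}

/-- Given the labels, the two ratios depend on disjoint sets of pairs: a common pair would contain
`u`, forcing `u = u'` or making `u` a neighbor of `u'`. -/
lemma integral_minRatio_star_mul (i j : Z) {u u' : Fin N} (h : M.SeparatedStars n v u u')
    {x : Labeling Z N} (hx : x u = i) (hx' : x u' = i) :
    ∫ y, min 1 (M.starRatio n v i j u x y) * min 1 (M.starRatio n v i j u' x y)
        ∂(Measure.pi (M.obsAt n v x)) =
      M.condMinRatio i j (fun l : M.Nbr n v u => x l) *
        M.condMinRatio i j fun l : M.Nbr n v u' => x l := by
  rw [← integral_minRatio_star M v i j hx, ← integral_minRatio_star M v i j hx']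
  simp_rw [minRatio_star]
  refine integral_pi_mul_of_disjoint (M.obsAt n v x)
    (φ := fun l : M.Nbr n v u => edge u l.1 l.2.1)
    (ψ := fun l : M.Nbr n v u' => edge u' l.1 l.2.1) (fun l l' hl => ?_)
    (f := fun y => M.minRatio i j fun l : M.Nbr n v u => (x l, y l))
    (g := fun y => M.minRatio i j fun l : M.Nbr n v u' => (x l, y l))
    ((M.measurable_minRatio i j).comp (by fun_prop))
    ((M.measurable_minRatio i j).comp (by fun_prop))
  rcases edge_eq_edge hl with h' | h'
  · exact h u u' (Or.inl rfl) (Or.inl rfl) h'.1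
  · exact h u l' (Or.inl rfl) (Or.inr l'.2.2) h'.1

open Classical in
-- Averaging over labels turns the star into i.i.d. marks with law `markLaw i`, the setting of the
-- Chernoff bound. The factor `M.prior i` splits off because `u` is not its own neighbor.
lemma sum_labelProb_condMinRatio (i j : Z) (u : Fin N) :
    ∑ x : Labeling Z N, M.labelProb x *
        ((if x u = i then 1 else 0) * M.condMinRatio i j fun l : M.Nbr n v u => x l) =
      M.prior i * ∫ z, M.minRatio i j z ∂(Measure.pi fun _ : M.Nbr n v u => M.markLaw i) := by
  rw [integral_pi_markLaw M i (M.measurable_minRatio i j) (M.minRatio_mem_Icc i j),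
    ← integral_pi_labelLaw, ← integral_pi_labelLaw]
  have h1 := integral_pi_mul_of_disjoint (fun _ : Fin N => M.labelLaw)
    (φ := fun _ : Unit => u) (ψ := fun l : M.Nbr n v u => l.1) (fun _ l => l.2.1.symm)
    (f := fun w => if w () = i then 1 else 0) (g := fun w => M.condMinRatio i j w)
    .of_discrete .of_discrete
  refine h1.trans ?_
  congr 1
  · have h2 := integral_comp_eval (μ := fun _ : Fin N => M.labelLaw) (i := u)
      (f := fun r : Z => if r = i then (1 : ℝ) else 0)
      (Measurable.of_discrete.aestronglyMeasurable)
    rw [h2, integral_fintype Integrable.of_finite]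
    simp [labelLaw_real_singleton]
  · rw [← Measure.pi_map_comp_injective (fun _ : Fin N => M.labelLaw)
      (φ := fun l : M.Nbr n v u => l.1) Subtype.val_injective,
      integral_map (measurable_pi_lambda _ fun _ => measurable_pi_apply _).aemeasurable
        Measurable.of_discrete.aestronglyMeasurable]
    rfl

open Classical in
-- The factors depend on labels in disjoint vertex sets. `Option` adjoins the center, as `none`, to
-- its neighbors.
lemma sum_labelProb_condMinRatio_mul (i j : Z) {u u' : Fin N} (h : M.SeparatedStars n v u u') :
    ∑ x : Labeling Z N, M.labelProb x *
        (((if x u = i then 1 else 0) * M.condMinRatio i j fun l : M.Nbr n v u => x l) *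
          ((if x u' = i then 1 else 0) * M.condMinRatio i j fun l : M.Nbr n v u' => x l)) =
      (∑ x : Labeling Z N, M.labelProb x *
        ((if x u = i then 1 else 0) * M.condMinRatio i j fun l : M.Nbr n v u => x l)) *
      ∑ x : Labeling Z N, M.labelProb x *
        ((if x u' = i then 1 else 0) * M.condMinRatio i j fun l : M.Nbr n v u' => x l) := by
  rw [← integral_pi_labelLaw, ← integral_pi_labelLaw, ← integral_pi_labelLaw]
  exact integral_pi_mul_of_disjoint (fun _ : Fin N => M.labelLaw)
    (φ := fun o : Option (M.Nbr n v u) => o.elim u fun l => l.1)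
    (ψ := fun o : Option (M.Nbr n v u') => o.elim u' fun l => l.1)
    (fun o o' => h _ _ (by cases o with | none => exact Or.inl rfl | some l => exact Or.inr l.2.2)
      (by cases o' with | none => exact Or.inl rfl | some l => exact Or.inr l.2.2))
    (f := fun w => (if w none = i then 1 else 0) * M.condMinRatio i j fun l => w (some l))
    (g := fun w => (if w none = i then 1 else 0) * M.condMinRatio i j fun l => w (some l))
    .of_discrete .of_discrete

end GHCMParams

/-! ### Second moment over labels and observations -/

namespace GHCMParams

variable {Z : Type*} [Fintype Z] (M : GHCMParams Z) {n N : ℕ} (v : Locations M.d N)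

section Chebyshev

variable [MeasurableSpace Z]

/-- Joint law of labels and observations given the locations. -/
noncomputable def jointLaw (n : ℕ) (v : Locations M.d N) :
    Measure (Labeling Z N × Observations N) :=
  letI : DecidableEq (Fin N) := inferInstance
  ∑ x : Labeling Z N, ENNReal.ofReal (M.labelProb x) •
    (Measure.pi (M.obsAt n v x)).map (Prod.mk x)

lemma jointLaw_apply {S : Set (Labeling Z N × Observations N)} (hS : MeasurableSet S) :
    M.jointLaw n v S = ∑ x : Labeling Z N, ENNReal.ofReal (M.labelProb x) *
      Measure.pi (M.obsAt n v x) {y | (x, y) ∈ S} := by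
  simp only [jointLaw, Measure.finsetSum_apply, Measure.smul_apply, smul_eq_mul]
  refine Finset.sum_congr rfl fun x _ => ?_
  rw [Measure.map_apply (by fun_prop) hS]
  rfl

lemma integral_jointLaw {f : Labeling Z N × Observations N → ℝ} (hf : Measurable f)
    {K : ℝ} (hK : ∀ z, f z ∈ Set.Icc 0 K) :
    ∫ z, f z ∂M.jointLaw n v =
      ∑ x : Labeling Z N, M.labelProb x * ∫ y, f (x, y) ∂Measure.pi (M.obsAt n v x) := by
  unfold jointLaw
  rw [integral_finsetSum_measure]
  · refine Finset.sum_congr rfl fun x _ => ?_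
    rw [integral_smul_measure, integral_map (by fun_prop) hf.aestronglyMeasurable, smul_eq_mul,
      ENNReal.toReal_ofReal (M.labelProb_nonneg x)]
  · intro x _
    refine Integrable.smul_measure ?_ ENNReal.ofReal_ne_top
    have hm : Measurable (Prod.mk x : Observations N → _) := by fun_prop
    have := Measure.isProbabilityMeasure_map (μ := Measure.pi (M.obsAt n v x)) hm.aemeasurable
    exact Integrable.of_mem_Icc 0 K hf.aemeasurable (ae_of_all _ hK)

variable [DiscreteMeasurableSpace Z]

instance : IsProbabilityMeasure (M.jointLaw n v) := by
  constructor
  rw [jointLaw_apply _ _ MeasurableSet.univ]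
  simp only [Set.mem_univ, Set.ofPred_true, measure_univ, mul_one]
  rw [← ENNReal.ofReal_sum_of_nonneg fun x _ => M.labelProb_nonneg x, sum_labelProb,
    ENNReal.ofReal_one]

variable {v}

open Classical in
/-- If the stars of the vertices in `I` are separated and small enough in total, some of them is
likely to be atypical. -/
lemma sum_measure_starRatio_lt_le {i j : Z} {I : Finset (Fin N)} {c σ : ℝ}
    (hsep : ∀ u ∈ I, ∀ u' ∈ I, u ≠ u' → M.SeparatedStars n v u u')
    (hcσ : ∀ (T : Type) [Fintype T],
      c * σ ^ Fintype.card T ≤ ∫ z, M.minRatio i j z ∂(Measure.pi fun _ : T => M.markLaw i))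
    (hI : 16 ≤ M.prior i * c * ∑ u ∈ I, σ ^ Fintype.card (M.Nbr n v u)) :
    ∑ x : Labeling Z N, ENNReal.ofReal (M.labelProb x) * Measure.pi (M.obsAt n v x)
      {y | ∑ u ∈ I with x u = i, min 1 (M.starRatio n v i j u x y) < 1} ≤ 4⁻¹ := by
  -- Putting the condition `x u = i` into the summand makes the index set `I` independent of the
  -- labeling, so that the variance can be computed under the joint law.
  let ψ : Fin N → Labeling Z N × Observations N → ℝ := fun u z =>
    if z.1 u = i then min 1 (M.starRatio n v i j u z.1 z.2) else 0
  have hψm : ∀ u, Measurable (ψ u) := fun u =>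
    measurable_from_prod_countable_right fun x => by
      simp only [ψ]
      split_ifs
      · exact measurable_const.min (M.measurable_starRatio v i j u x)
      · exact measurable_const
  have hψ1 : ∀ u z, ψ u z ∈ Set.Icc (0 : ℝ) 1 := fun u z => by
    simp only [ψ]
    split_ifs
    · exact ⟨le_min zero_le_one (M.starRatio_nonneg _ _ _ _ _ _), min_le_left _ _⟩
    · exact ⟨le_rfl, zero_le_one⟩
  have hψi : ∀ u, Integrable (ψ u) (M.jointLaw n v) := fun u =>
    Integrable.of_mem_Icc 0 1 (hψm u).aemeasurable (ae_of_all _ (hψ1 u))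
  have hψψ : ∀ u u' z, ψ u z * ψ u' z ∈ Set.Icc (0 : ℝ) 1 := fun u u' z =>
    ⟨mul_nonneg (hψ1 u z).1 (hψ1 u' z).1, mul_le_one₀ (hψ1 u z).2 (hψ1 u' z).1 (hψ1 u' z).2⟩
  have hψψi : ∀ u u', Integrable (fun z => ψ u z * ψ u' z) (M.jointLaw n v) := fun u u' =>
    Integrable.of_mem_Icc 0 1 ((hψm u).mul (hψm u')).aemeasurable (ae_of_all _ (hψψ u u'))
  let m : Fin N → ℝ := fun u => ∑ x : Labeling Z N, M.labelProb x *
    ((if x u = i then 1 else 0) * M.condMinRatio i j fun l : M.Nbr n v u => x l)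
  have hm : ∀ u, ∫ z, ψ u z ∂M.jointLaw n v = m u := fun u => by
    rw [integral_jointLaw M v (hψm u) (hψ1 u)]
    refine Finset.sum_congr rfl fun x _ => ?_
    simp only [ψ]
    split_ifs with h
    · rw [integral_minRatio_star M v i j h, one_mul]
    · simp
  have hmlow : ∀ u, M.prior i * c * σ ^ Fintype.card (M.Nbr n v u) ≤ m u := fun u => by
    simp only [m]
    rw [sum_labelProb_condMinRatio, mul_assoc]
    exact mul_le_mul_of_nonneg_left (hcσ _) (M.prior_pos i).le
  have hcov : ∀ u ∈ I, ∀ u' ∈ I, ∫ z, ψ u z * ψ u' z ∂M.jointLaw n v ≤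
      (if u = u' then m u else 0) + m u * m u' := by
    intro u hu u' hu'
    have hm0 : ∀ u, 0 ≤ m u := fun u => by
      rw [← hm]; exact integral_nonneg fun z => (hψ1 u z).1
    by_cases huu : u = u'
    · subst huu
      rw [if_pos rfl, ← hm]
      refine (integral_mono (hψψi u u) (hψi u) fun z =>
        mul_le_of_le_one_left (hψ1 u z).1 (hψ1 u z).2).trans ?_
      rw [hm]
      exact le_add_of_nonneg_right (mul_nonneg (hm0 u) (hm0 u))
    · rw [if_neg huu, zero_add, integral_jointLaw M v (f := fun z => ψ u z * ψ u' z)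
        ((hψm u).mul (hψm u')) (hψψ u u')]
      simp only [m]
      rw [← sum_labelProb_condMinRatio_mul M i j (hsep u hu u' hu' huu)]
      refine le_of_eq (Finset.sum_congr rfl fun x _ => ?_)
      simp only [ψ]
      by_cases h : x u = i
      · by_cases h' : x u' = i
        · simp only [if_pos h, if_pos h', one_mul]
          rw [integral_minRatio_star_mul M i j (hsep u hu u' hu' huu) h h']
        · simp [if_neg h']
      · simp [if_neg h]
  set E := ∑ u ∈ I, m u with hE
  have hE16 : 16 ≤ E := by
    refine hI.trans ?_
    rw [Finset.mul_sum]
    exact Finset.sum_le_sum fun u _ => hmlow u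
  have hmean : ∫ z, ∑ u ∈ I, ψ u z ∂M.jointLaw n v = E := by
    rw [integral_finsetSum _ fun u _ => hψi u]
    exact Finset.sum_congr rfl fun u _ => hm u
  have hΨm : Measurable fun z => ∑ u ∈ I, ψ u z := Finset.measurable_sum _ fun u _ => hψm u
  have hmem : MemLp (fun z => ∑ u ∈ I, ψ u z) 2 (M.jointLaw n v) := by
    refine memLp_finsetSum _ fun u _ => ?_
    refine MemLp.of_bound (hψm u).aestronglyMeasurable 1 (ae_of_all _ fun z => ?_)
    rw [Real.norm_eq_abs, abs_of_nonneg (hψ1 u z).1]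
    exact (hψ1 u z).2
  have h2 : ∫ z, (∑ u ∈ I, ψ u z) ^ 2 ∂M.jointLaw n v ≤ E + 1 * E ^ 2 := by
    simp_rw [sq, Finset.sum_mul_sum]
    rw [integral_finsetSum _ fun u _ => integrable_finsetSum _ fun u' _ => hψψi u u']
    simp_rw [integral_finsetSum _ fun u' _ => hψψi _ u']
    refine (Finset.sum_le_sum fun u hu => Finset.sum_le_sum fun u' hu' => hcov u hu u' hu').trans
      (le_of_eq ?_)
    simp_rw [Finset.sum_add_distrib, Finset.sum_ite_eq]
    rw [Finset.sum_congr rfl fun u hu => if_pos hu, hE, one_mul, Finset.sum_mul_sum]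
  -- Separated stars are uncorrelated, hence `κ = 1` and only the diagonal remains. With `E ≥ 16`
  -- the error `4 / E` is at most `1/4`, and `E / 2` exceeds `1`.
  have hch := measure_lt_half_integral_le hmem (κ := 1) (by rw [hmean]; linarith)
    (by rw [hmean]; exact h2)
  rw [hmean] at hch
  have h4 : 4 / E + 4 * (1 - 1) ≤ (4 : ℝ)⁻¹ := by
    rw [sub_self, mul_zero, add_zero, inv_eq_one_div,
      div_le_div_iff₀ (by linarith) (by norm_num)]
    linarith
  have h5 : (M.jointLaw n v).real {z | ∑ u ∈ I, ψ u z < 1} ≤ (4 : ℝ)⁻¹ := by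
    refine (measureReal_mono fun z hz => ?_).trans (hch.trans h4)
    have : ∑ u ∈ I, ψ u z < 1 := hz
    show _ < E / 2
    linarith
  have h6 : M.jointLaw n v {z | ∑ u ∈ I, ψ u z < 1} ≤ 4⁻¹ := by
    rw [← ofReal_measureReal]
    refine (ENNReal.ofReal_le_ofReal h5).trans (le_of_eq ?_)
    rw [ENNReal.ofReal_inv_of_pos (by norm_num)]
    norm_num
  rw [jointLaw_apply _ _ (measurableSet_lt hΨm measurable_const)] at h6
  refine le_trans (le_of_eq ?_) h6
  refine Finset.sum_congr rfl fun x _ => ?_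
  congr 2
  ext y
  simp only [Set.mem_ofPred_eq, ψ, Finset.sum_filter]

end Chebyshev

/-! ### Occurrence of all labels -/

section Labels

variable [MeasurableSpace Z] [DiscreteMeasurableSpace Z]

lemma pi_labelLaw_apply (S : Finset (Labeling Z N)) :
    Measure.pi (fun _ : Fin N => M.labelLaw) S = ∑ x ∈ S, ENNReal.ofReal (M.labelProb x) := by
  rw [← sum_measure_singleton]
  exact Finset.sum_congr rfl fun x _ => M.pi_labelLaw_singleton x

lemma measure_forall_ne_le (r : Z) (A : Finset (Fin N)) {m : ℕ} (hm : m ≤ A.card) :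
    Measure.pi (fun _ : Fin N => M.labelLaw) {x | ∀ u ∈ A, x u ≠ r} ≤
      ENNReal.ofReal ((1 - M.prior r) ^ m) := by
  have h1 : {x : Labeling Z N | ∀ u ∈ A, x u ≠ r} = Set.pi A fun _ => {r}ᶜ := by
    ext x; simp [Set.mem_pi]
  have h2 : M.labelLaw.real {r}ᶜ = 1 - M.prior r := by
    rw [probReal_compl_eq_one_sub (measurableSet_singleton r), labelLaw_real_singleton]
  have h3 : M.prior r ≤ 1 := by
    rw [← labelLaw_real_singleton]; exact measureReal_le_one
  rw [h1, Measure.pi_pi_finset, Finset.prod_const, ← ofReal_measureReal, h2,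
    ← ENNReal.ofReal_pow (by linarith)]
  exact ENNReal.ofReal_le_ofReal
    (pow_le_pow_of_le_one (by linarith) (by linarith [M.prior_pos r]) hm)

/-- Every label occurs both inside and outside of `A`. -/
def AllLabels (A : Finset (Fin N)) (x : Labeling Z N) : Prop :=
  ∀ r, (∃ u ∈ A, x u = r) ∧ ∃ u ∉ A, x u = r

open Classical in
-- A union bound over labels: a label is missing from `m` given vertices with probability at most
-- `(1 - π_r) ^ m`. The number `m` depends neither on `N` nor on the set `A`.
lemma exists_sum_not_allLabels_le :
    ∃ m : ℕ, ∀ (N : ℕ) (A : Finset (Fin N)), m ≤ A.card → m ≤ Aᶜ.card →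
      ∑ x : Labeling Z N with ¬AllLabels A x, ENNReal.ofReal (M.labelProb x) ≤ 4⁻¹ := by
  have h1 : Tendsto (fun m : ℕ => ∑ r, (ENNReal.ofReal ((1 - M.prior r) ^ m) +
      ENNReal.ofReal ((1 - M.prior r) ^ m))) atTop (𝓝 (∑ _r : Z, (ENNReal.ofReal 0 +
      ENNReal.ofReal 0))) := by
    refine tendsto_finsetSum _ fun r _ => ?_
    have h3 : M.prior r ≤ 1 := by
      rw [← labelLaw_real_singleton]; exact measureReal_le_one
    have := ENNReal.tendsto_ofReal (tendsto_pow_atTop_nhds_zero_of_lt_one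
      (show 0 ≤ 1 - M.prior r by linarith) (by linarith [M.prior_pos r]))
    exact this.add this
  simp only [ENNReal.ofReal_zero, add_zero, Finset.sum_const_zero] at h1
  obtain ⟨m, hm⟩ := (h1.eventually (ge_mem_nhds (show (0 : ENNReal) < 4⁻¹ by simp))).exists
  refine ⟨m, fun N A hA hA' => ?_⟩
  rw [← pi_labelLaw_apply]
  refine le_trans ?_ hm
  have hsub : ((Finset.univ.filter fun x : Labeling Z N => ¬AllLabels A x : Finset (Labeling Z N)) :
      Set (Labeling Z N)) ⊆
      ⋃ r ∈ (Finset.univ : Finset Z),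
        ({x | ∀ u ∈ A, x u ≠ r} ∪ {x | ∀ u ∈ Aᶜ, x u ≠ r}) := by
    intro x hx
    simp only [Finset.coe_filter, Finset.mem_univ, true_and, Set.mem_ofPred_eq, AllLabels,
      not_forall, not_and_or] at hx
    obtain ⟨r, hr⟩ := hx
    simp only [Set.mem_iUnion]
    refine ⟨r, Finset.mem_univ r, ?_⟩
    rcases hr with hr | hr <;> push Not at hr
    · exact Or.inl hr
    · exact Or.inr fun u hu => hr u (Finset.mem_compl.1 hu)
  refine (measure_mono hsub).trans ((measure_biUnion_finset_le _ _).trans ?_)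
  refine Finset.sum_le_sum fun r _ => (measure_union_le _ _).trans ?_
  exact add_le_add (M.measure_forall_ne_le r A hA) (M.measure_forall_ne_le r Aᶜ hA')

end Labels

end GHCMParams

/-! ### Failure probability given the locations -/

namespace GHCMParams

variable {Z : Type*} [Fintype Z] (M : GHCMParams Z) {n N : ℕ} (v : Locations M.d N)

lemma sum_ofReal_labelProb : ∑ x : Labeling Z N, ENNReal.ofReal (M.labelProb x) = 1 := by
  rw [← ENNReal.ofReal_sum_of_nonneg fun x _ => M.labelProb_nonneg x, sum_labelProb,
    ENNReal.ofReal_one]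

lemma one_mem_permissible : (1 : Equiv.Perm Z) ∈ M.permissible :=
  ⟨fun _ => rfl, fun _ _ => rfl⟩

/-- The supremum is over a finite nonempty set, hence attained, and a sum of `N` indicators equals
`N` only if all of them are `1`. -/
lemma exists_of_agreement_eq_one {x' x : Labeling Z N} (h : M.agreement x' x = 1) :
    ∃ ω ∈ M.permissible, ∀ u, x' u = ω (x u) := by
  classical
  have hne : Nonempty M.permissible := ⟨⟨1, M.one_mem_permissible⟩⟩
  obtain ⟨ω, hω⟩ := exists_eq_ciSup_of_finite
    (f := fun ω : M.permissible => ∑ u, if x' u = (ω : Equiv.Perm Z) (x u) then (1 : ℝ) else 0)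
  refine ⟨ω, ω.2, ?_⟩
  have h1 : (1 / (N : ℝ)) *
      (∑ u, if x' u = (ω : Equiv.Perm Z) (x u) then (1 : ℝ) else 0) = 1 := by
    rw [hω, ← h, agreement]
    congr!
  -- Without vertices the agreement is `0` by the convention `1 / 0 = 0`, so this case cannot count
  -- as a success.
  have hN : (N : ℝ) ≠ 0 := fun h0 => by simp [h0] at h1
  have h2 : (∑ u, if x' u = (ω : Equiv.Perm Z) (x u) then (1 : ℝ) else 0) = N := by
    field_simp at h1
    exact h1
  by_contra hcon
  push Not at hcon
  obtain ⟨u, hu⟩ := hcon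
  rw [Finset.sum_boole] at h2
  have h3 : (Finset.univ.filter fun u => x' u = (ω : Equiv.Perm Z) (x u)).card < N := by
    conv_rhs => rw [← Fintype.card_fin N]
    exact Finset.card_lt_univ_of_notMem (x := u) (by simpa using hu)
  exact absurd h2 (by exact_mod_cast h3.ne)

lemma side_pos (hn : 1 ≤ n) : 0 < M.side n :=
  Real.rpow_pos_of_pos (by exact_mod_cast hn) _

lemma side_pow (n : ℕ) : M.side n ^ M.d = n := by
  unfold side
  rw [← Real.rpow_natCast, ← Real.rpow_mul (Nat.cast_nonneg n),
    one_div_mul_cancel (by have := M.d_pos; positivity), Real.rpow_one]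

lemma volume_cube (n : ℕ) : volume (M.cube n) = n := by
  unfold cube
  rw [Real.volume_Icc_pi]
  have h1 : M.side n / 2 - -(M.side n) / 2 = M.side n := by ring
  simp only [h1, Finset.prod_const, Finset.card_univ, Fintype.card_fin]
  rw [← ENNReal.ofReal_pow (show 0 ≤ M.side n from Real.rpow_nonneg (Nat.cast_nonneg n) _), side_pow,
    ENNReal.ofReal_natCast]

/-- Law of the location of one vertex. -/
noncomputable def locLaw (n : ℕ) : Measure (Fin M.d → ℝ) := cond volume (M.cube n)

lemma isProbabilityMeasure_locLaw (hn : 1 ≤ n) : IsProbabilityMeasure (M.locLaw n) :=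
  cond_isProbabilityMeasure_of_finite (by rw [volume_cube]; exact_mod_cast (by omega : n ≠ 0))
    (by rw [volume_cube]; exact ENNReal.natCast_ne_top n)

variable [MeasurableSpace Z] (est : M.Estimator)

/-- The observations and seeds for which the estimate agrees with `x` up to a permissible
relabeling. -/
def accept (n : ℕ) (v : Locations M.d N) (x : Labeling Z N) :
    Set (Observations N × unitInterval) :=
  {y | ∃ ω ∈ M.permissible, ∀ u, est.toFun n N ((v, y.1), y.2) u = ω (x u)}

open Classical in
-- An accepted labeling is recovered from the estimate by inverting the relabeling.
lemma sum_indicator_accept_le (y : Observations N × unitInterval) :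
    ∑ x, (M.accept est n v x).indicator 1 y ≤ (Fintype.card (Equiv.Perm Z) : ENNReal) := by
  simp only [Set.indicator_apply, Pi.one_apply, Finset.sum_boole]
  norm_cast
  refine (Finset.card_le_card (t := Finset.univ.image fun (ω : Equiv.Perm Z) u =>
    ω.symm (est.toFun n N ((v, y.1), y.2) u)) fun x hx => ?_).trans Finset.card_image_le
  obtain ⟨ω, -, hω⟩ := (Finset.mem_filter.1 hx).2
  refine Finset.mem_image.2 ⟨ω, Finset.mem_univ _, ?_⟩
  ext u
  rw [hω u, Equiv.symm_apply_apply]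

/-- Probability that the estimate is wrong, given the locations. -/
noncomputable def failGiven (n : ℕ) (v : Locations M.d N) : ENNReal :=
  ∑ x : Labeling Z N, ENNReal.ofReal (M.labelProb x) *
    ((Measure.pi (M.obsAt n v x)).prod (volume : Measure unitInterval)) (M.accept est n v x)ᶜ

variable [DiscreteMeasurableSpace Z]

lemma measurableSet_accept (x : Labeling Z N) : MeasurableSet (M.accept est n v x) := by
  have h1 : Measurable fun y : Observations N × unitInterval => est.toFun n N ((v, y.1), y.2) :=
    (est.measurable n N).comp (by fun_prop)
  exact h1 (MeasurableSet.of_discrete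
    (s := {x' : Labeling Z N | ∃ ω ∈ M.permissible, ∀ u, x' u = ω (x u)}))

variable {v}

open Classical in
/-- Failure given locations in which a vertex is likely to have an atypical star. -/
lemma half_le_failGiven_of_stars {i j : Z} (hij : i ≠ j) {I A : Finset (Fin N)} {c σ : ℝ}
    (hsep : ∀ u ∈ I, ∀ u' ∈ I, u ≠ u' → M.SeparatedStars n v u u')
    (hcσ : ∀ (T : Type) [Fintype T],
      c * σ ^ Fintype.card T ≤ ∫ z, M.minRatio i j z ∂(Measure.pi fun _ : T => M.markLaw i))
    (hI : 16 ≤ M.prior i * c * ∑ u ∈ I, σ ^ Fintype.card (M.Nbr n v u))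
    (hA : ∑ x : Labeling Z N with ¬AllLabels A x, ENNReal.ofReal (M.labelProb x) ≤ 4⁻¹) :
    2⁻¹ ≤ (ENNReal.ofReal (M.prior i / M.prior j) * Fintype.card (Equiv.Perm Z) + 1) *
      M.failGiven est n v := by
  refine half_le_mul_failure (G := Finset.univ.filter fun x => AllLabels A x)
    (act := fun x => I.filter fun u => x u = i) (mv := fun u x => Function.update x u j)
    (ψ := fun u x y => ENNReal.ofReal (min 1 (M.starRatio n v i j u x y.1)))
    M.sum_ofReal_labelProb (M.measurableSet_accept v est) (M.sum_indicator_accept_le v est)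
    ?_ ?_ ?_ ?_ ?_ ?_
  · intro x u
    exact ((measurable_const.min (M.measurable_starRatio v i j u x)).comp
      measurable_fst).ennreal_ofReal
  · intro x _ u hu
    have hx : x u = i := (Finset.mem_filter.1 hu).2
    have h1 : M.labelProb x = M.prior i / M.prior j * M.labelProb (Function.update x u j) := by
      unfold labelProb
      rw [← Finset.mul_prod_erase _ _ (Finset.mem_univ u),
        ← Finset.mul_prod_erase Finset.univ (fun w => M.prior (Function.update x u j w))
          (Finset.mem_univ u), hx, Function.update_self, ← mul_assoc,
        div_mul_cancel₀ _ (M.prior_pos j).ne']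
      congr 1
      refine Finset.prod_congr rfl fun w hw => ?_
      rw [Function.update_of_ne (Finset.ne_of_mem_erase hw)]
    rw [← mul_assoc, ← ENNReal.ofReal_mul (div_pos (M.prior_pos i) (M.prior_pos j)).le, ← h1]
    exact mul_le_mul_right (M.setLIntegral_starRatio_le v volume i j hx
      (M.measurableSet_accept v est x)) _
  · intro x _ u hu u' hu' huu
    have hx : x u = i := (Finset.mem_filter.1 hu).2
    by_contra hne
    have := congrFun huu u
    simp only [Function.update_self, Function.update_of_ne hne, hx] at this
    exact hij this.symm
  · intro x hx u hu
    have hxu : x u = i := (Finset.mem_filter.1 hu).2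
    have hall : AllLabels A x := (Finset.mem_filter.1 hx).2
    rw [Set.disjoint_left]
    rintro y ⟨ω, -, hω⟩ ⟨ω', -, hω'⟩
    have h1 : ∀ w ≠ u, ω (x w) = ω' (x w) := fun w hw => by
      rw [← hω, hω', Function.update_of_ne hw]
    -- Each label has a representative inside `A` and one outside, at least one of which is not `u`.
    -- The two relabelings therefore coincide, although they would have to send `i` and `j` to the
    -- same label at `u`.
    have h2 : ∀ r, ω r = ω' r := fun r => by
      obtain ⟨⟨a, ha, hr⟩, ⟨b, hb, hr'⟩⟩ := hall r
      by_cases hau : a = u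
      · rw [← hr']
        exact h1 b fun hbu => hb (by rw [hbu, ← hau]; exact ha)
      · rw [← hr]
        exact h1 a hau
    have h3 := (hω u).symm.trans (hω' u)
    rw [Function.update_self, hxu, ← h2 j] at h3
    exact hij (ω.injective h3)
  · convert hA using 2
    ext x
    simp
  · refine le_trans (le_of_eq (Finset.sum_congr rfl fun x _ => ?_))
      (M.sum_measure_starRatio_lt_le hsep hcσ hI)
    congr 1
    have h1 : {y : Observations N × unitInterval | ∑ u ∈ I with x u = i,
        ENNReal.ofReal (min 1 (M.starRatio n v i j u x y.1)) < 1} =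
        {y | ∑ u ∈ I with x u = i, min 1 (M.starRatio n v i j u x y) < 1} ×ˢ Set.univ := by
      ext y
      simp only [Set.mem_ofPred_eq, Set.mem_prod, Set.mem_univ, and_true]
      rw [← ENNReal.ofReal_sum_of_nonneg fun u _ => le_min zero_le_one
        (M.starRatio_nonneg v i j u x y.1), ENNReal.ofReal_lt_one]
    rw [h1, Measure.prod_prod, measure_univ, mul_one]

open Classical in
/-- Failure given locations whose visibility graph has no edge between `A` and its complement. -/
lemma half_le_failGiven_of_disconnected {τ : Equiv.Perm Z} (hτ : τ ∈ M.permissible) (hτ1 : τ ≠ 1)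
    {A : Finset (Fin N)} (hvis : ∀ u ∈ A, ∀ w ∉ A, ¬M.Visible n (v u) (v w))
    (hA : ∑ x : Labeling Z N with ¬AllLabels A x, ENNReal.ofReal (M.labelProb x) ≤ 4⁻¹) :
    2⁻¹ ≤ (1 * Fintype.card (Equiv.Perm Z) + 1) * M.failGiven est n v := by
  let x' : Labeling Z N → Labeling Z N := fun x u => if u ∈ A then τ (x u) else x u
  refine half_le_mul_failure (G := Finset.univ.filter fun x => AllLabels A x)
    (act := fun _ => ({()} : Finset Unit)) (mv := fun _ x => x' x)
    (ψ := fun _ _ _ => 1)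
    M.sum_ofReal_labelProb (M.measurableSet_accept v est) (M.sum_indicator_accept_le v est)
    ?_ ?_ ?_ ?_ ?_ ?_
  · exact fun _ _ => measurable_const
  · intro x _ _ _
    have h1 : M.labelProb (x' x) = M.labelProb x := by
      unfold labelProb
      refine Finset.prod_congr rfl fun u _ => ?_
      simp only [x']
      split_ifs
      · exact (hτ.1 (x u)).symm
      · rfl
    -- Pairs inside `A` are protected by permissibility of `τ`, pairs outside are untouched, and
    -- pairs across the cut are invisible.
    have h2 : M.obsAt n v (x' x) = M.obsAt n v x := by
      ext1 e
      unfold obsAt obsLaw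
      by_cases he1 : e.1.1 ∈ A
      · by_cases he2 : e.1.2 ∈ A
        · simp only [x', if_pos he1, if_pos he2]
          rw [hτ.2 (x e.1.1) (x e.1.2)]
        · rw [if_neg (hvis _ he1 _ he2), if_neg (hvis _ he1 _ he2)]
      · by_cases he2 : e.1.2 ∈ A
        · have : ¬M.Visible n (v e.1.1) (v e.1.2) := fun h =>
            hvis _ he2 _ he1 (M.visible_symm.1 h)
          rw [if_neg this, if_neg this]
        · simp only [x', if_neg he1, if_neg he2]
    rw [h1, h2]
    simp
  · intro x _ a _ b _ _
    rfl
  · intro x hx _ _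
    have hall : AllLabels A x := (Finset.mem_filter.1 hx).2
    rw [Set.disjoint_left]
    rintro y ⟨ω, -, hω⟩ ⟨ω', -, hω'⟩
    -- Vertices outside `A` show that the two relabelings coincide; vertices inside `A` then force
    -- `τ` to be the identity.
    have h1 : ∀ r, ω r = ω' r := fun r => by
      obtain ⟨-, b, hb, hr⟩ := hall r
      have := (hω b).symm.trans (hω' b)
      simp only [x', if_neg hb, hr] at this
      exact this
    refine hτ1 (Equiv.ext fun r => ?_)
    obtain ⟨⟨a, ha, hr⟩, -⟩ := hall r
    have := (hω a).symm.trans (hω' a)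
    simp only [x', if_pos ha, hr, ← h1] at this
    exact (ω.injective this).symm
  · convert hA using 2
    ext x
    simp
  · simp

/-- The event of exact agreement at a scale with `N` vertices. -/
def successSet (n N : ℕ) : Set (LabeledGraph Z M.d N × unitInterval) :=
  {s | ∃ ω ∈ M.permissible, ∀ u, est.toFun n N ((s.1.1.1, s.1.2), s.2) u = ω (s.1.1.2 u)}

lemma measurableSet_successSet : MeasurableSet (M.successSet est n N) := by
  have h1 : Measurable fun s : LabeledGraph Z M.d N × unitInterval =>
      (est.toFun n N ((s.1.1.1, s.1.2), s.2), s.1.1.2) :=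
    Measurable.prodMk ((est.measurable n N).comp (by fun_prop)) (by fun_prop)
  exact h1 (MeasurableSet.of_discrete
    (s := {q : Labeling Z N × Labeling Z N | ∃ ω ∈ M.permissible, ∀ u, q.1 u = ω (q.2 u)}))

/-- The failure probability is the average of the conditional failure probabilities. -/
lemma lawGiven_compl_successSet (hn : 1 ≤ n) :
    ((M.lawGiven n N).prod (volume : Measure unitInterval)) (M.successSet est n N)ᶜ =
      ∫⁻ v, M.failGiven est n v ∂(Measure.pi fun _ : Fin N => M.locLaw n) := by
  have := M.isProbabilityMeasure_locLaw hn
  have hS := (M.measurableSet_successSet (n := n) (N := N) est).compl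
  have hlaw : M.lawGiven n N = ((Measure.pi fun _ : Fin N => M.locLaw n).prod
    (Measure.pi fun _ : Fin N => M.labelLaw)) ⊗ₘ M.obsKernel n N := rfl
  have hm : Measurable fun a : LabeledGraph Z M.d N =>
      (volume : Measure unitInterval) (Prod.mk a ⁻¹' (M.successSet est n N)ᶜ) :=
    measurable_measure_prodMk_left hS
  rw [Measure.prod_apply hS, hlaw, Measure.lintegral_compProd hm,
    lintegral_prod _ hm.lintegral_kernel_prod_right'.aemeasurable]
  refine lintegral_congr fun v => ?_
  rw [lintegral_fintype, failGiven]
  refine Finset.sum_congr rfl fun x _ => ?_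
  rw [pi_labelLaw_singleton, mul_comm, Measure.prod_apply (M.measurableSet_accept v est x).compl]
  rfl

end GHCMParams

/-! ### From conditional failure to failure of exact recovery -/

lemma measurable_of_forall_comp_sigmaMk {α γ : Type*} {β : α → Type*}
    [∀ a, MeasurableSpace (β a)] [MeasurableSpace γ] {f : Sigma β → γ}
    (h : ∀ a, Measurable fun b => f ⟨a, b⟩) : Measurable f := fun _ hs =>
  MeasurableSpace.measurableSet_iInf.2 fun a => h a hs

namespace GHCMParams

variable {Z : Type*} [Fintype Z]

lemma nonempty_labels (M : GHCMParams Z) : Nonempty Z := by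
  by_contra h
  rw [not_nonempty_iff] at h
  have := M.prior_sum
  simp at this

variable [MeasurableSpace Z] [DiscreteMeasurableSpace Z] (M : GHCMParams Z) {n N : ℕ}
  (est : M.Estimator)

lemma isProbabilityMeasure_lawGiven (hn : 1 ≤ n) : IsProbabilityMeasure (M.lawGiven n N) := by
  have := M.isProbabilityMeasure_locLaw hn
  have hlaw : M.lawGiven n N = ((Measure.pi fun _ : Fin N => M.locLaw n).prod
    (Measure.pi fun _ : Fin N => M.labelLaw)) ⊗ₘ M.obsKernel n N := rfl
  rw [hlaw]
  infer_instance

/-- The success event on the disjoint union is enclosed in a measurable set with the right fiber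
over `N`, built from a measurable left inverse of `Sigma.mk N` that takes a constant value on the
other fibers. An upper bound suffices, so measurability of the event itself is not needed. -/
lemma map_sigmaMk_prod_le (hn : 1 ≤ n) :
    (((M.lawGiven n N).map (Sigma.mk N) : Measure (Σ N, LabeledGraph Z M.d N)).prod
      (volume : Measure unitInterval))
      {s | M.agreement (est.toFun n s.1.1 ((s.1.2.1.1, s.1.2.2), s.2)) s.1.2.1.2 = 1} ≤
    ((M.lawGiven n N).prod (volume : Measure unitInterval)) (M.successSet est n N) := by
  classical
  have := M.isProbabilityMeasure_lawGiven (N := N) hn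
  obtain ⟨r⟩ := M.nonempty_labels
  let g : (Σ N, LabeledGraph Z M.d N) → LabeledGraph Z M.d N := fun s =>
    if h : s.1 = N then h ▸ s.2 else ((fun _ _ => 0, fun _ => r), fun _ => 0)
  have hg : Measurable g := measurable_of_forall_comp_sigmaMk fun k => by
    by_cases h : k = N
    · subst h
      simp only [g, dif_pos]
      exact measurable_id
    · simp only [g, dif_neg h]
      exact measurable_const
  have hgN : ∀ a, g ⟨N, a⟩ = a := fun a => by simp [g]
  have hmk : Measurable (Sigma.mk N : LabeledGraph Z M.d N → Σ N, LabeledGraph Z M.d N) :=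
    fun s hs => MeasurableSpace.measurableSet_iInf.1 hs N
  have hfst : Measurable (Sigma.fst : (Σ N, LabeledGraph Z M.d N) → ℕ) :=
    measurable_of_forall_comp_sigmaMk fun _ => measurable_const
  let F : Set ((Σ N, LabeledGraph Z M.d N) × unitInterval) :=
    {s | s.1.1 ≠ N} ∪ (fun s => (g s.1, s.2)) ⁻¹' M.successSet est n N
  have hF : MeasurableSet F := by
    refine MeasurableSet.union ?_ ?_
    · exact (measurableSet_singleton N).compl.preimage (hfst.comp measurable_fst)
    · exact (M.measurableSet_successSet est).preimage
        ((hg.comp measurable_fst).prodMk measurable_snd)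
  have hsub : {s : (Σ N, LabeledGraph Z M.d N) × unitInterval |
      M.agreement (est.toFun n s.1.1 ((s.1.2.1.1, s.1.2.2), s.2)) s.1.2.1.2 = 1} ⊆ F := by
    rintro ⟨⟨k, a⟩, t⟩ hs
    by_cases h : k = N
    · subst h
      refine Or.inr ?_
      show (g ⟨k, a⟩, t) ∈ M.successSet est n k
      rw [hgN]
      exact M.exists_of_agreement_eq_one hs
    · exact Or.inl h
  refine (measure_mono hsub).trans (le_of_eq ?_)
  have hprod := Measure.map_prod_map (M.lawGiven n N) (volume : Measure unitInterval) hmk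
    measurable_id
  rw [Measure.map_id] at hprod
  rw [hprod, Measure.map_apply (hmk.prodMap measurable_id) hF]
  congr 1
  ext ⟨a, t⟩
  simp [F, hgN]

lemma successProb_le (hn : 1 ≤ n) :
    M.successProb est n ≤ ∑' N, poissonMeasure (Real.toNNReal (M.lam * n)) {N} *
      ((M.lawGiven n N).prod (volume : Measure unitInterval)) (M.successSet est n N) := by
  unfold successProb law
  rw [Measure.prod_sum_left, Measure.sum_apply_of_countable]
  refine ENNReal.tsum_le_tsum fun N => ?_
  rw [Measure.prod_smul_left, Measure.smul_apply, smul_eq_mul]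
  exact mul_le_mul_right (M.map_sigmaMk_prod_le est hn) _

/-- If, for typical numbers of vertices, the conditional failure probability is bounded below for
a nonvanishing set of locations, then exact recovery fails. -/
lemma not_exactRecovery_of_failGiven {K : ENNReal} (hK : K ≠ ⊤) {ε : ℝ} (hε : 0 < ε)
    (h : ∀ᶠ n : ℕ in atTop, ∀ N : ℕ, (M.lam - ε) * n ≤ N → (N : ℝ) ≤ (M.lam + ε) * n →
      ∃ Gd : Set (Locations M.d N), MeasurableSet Gd ∧
        1 / 2 ≤ (Measure.pi fun _ : Fin N => M.locLaw n).real Gd ∧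
        ∀ v ∈ Gd, 2⁻¹ ≤ K * M.failGiven est n v) :
    ¬M.ExactRecovery est := by
  intro hrec
  have h1 : Tendsto (fun n => K * (1 - M.successProb est n)) atTop (𝓝 0) := by
    have h2 := ENNReal.Tendsto.sub (tendsto_const_nhds (x := (1 : ENNReal)) (f := atTop)) hrec
      (Or.inl ENNReal.one_ne_top)
    have h3 := ENNReal.Tendsto.const_mul h2 (Or.inr hK)
    simpa using h3
  -- Typical numbers of vertices have probability at least `1/2`, and for each of them `K` times the
  -- failure probability is at least `1/2 * 1/2`. The product `1/8` contradicts a limit `0`.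
  obtain ⟨n, hn, hlt, hpois, hn1⟩ := (h.and ((h1.eventually (gt_mem_nhds
    (show (0 : ENNReal) < 2⁻¹ * 4⁻¹ by simp))).and
    ((eventually_half_le_poissonMeasure M.lam_pos hε).and (eventually_ge_atTop 1)))).exists
  have hp := M.isProbabilityMeasure_locLaw hn1
  set po := poissonMeasure (Real.toNNReal (M.lam * n)) with hpo
  let S : ℕ → ENNReal := fun N =>
    ((M.lawGiven n N).prod (volume : Measure unitInterval)) (M.successSet est n N)
  let F : ℕ → ENNReal := fun N =>
    ((M.lawGiven n N).prod (volume : Measure unitInterval)) (M.successSet est n N)ᶜ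
  have hSF : ∀ N, S N + F N = 1 := fun N => by
    have := M.isProbabilityMeasure_lawGiven (N := N) hn1
    exact prob_add_prob_compl (M.measurableSet_successSet est)
  set R : Set ℕ := {N : ℕ | (M.lam - ε) * n ≤ N ∧ (N : ℝ) ≤ (M.lam + ε) * n} with hR
  have hFR : ∀ N ∈ R, 4⁻¹ ≤ K * F N := fun N hN => by
    obtain ⟨Gd, hGm, hGd, hGf⟩ := hn N hN.1 hN.2
    have h4 : (2 : ENNReal)⁻¹ ≤ (Measure.pi fun _ : Fin N => M.locLaw n) Gd := by
      rw [← ofReal_measureReal]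
      refine le_trans (le_of_eq ?_) (ENNReal.ofReal_le_ofReal hGd)
      rw [one_div, ENNReal.ofReal_inv_of_pos (by norm_num)]
      norm_num
    calc (4 : ENNReal)⁻¹ = 2⁻¹ * 2⁻¹ := by
          rw [← ENNReal.mul_inv (by simp) (by simp)]; norm_num
      _ ≤ 2⁻¹ * (Measure.pi fun _ : Fin N => M.locLaw n) Gd := mul_le_mul_right h4 _
      _ = ∫⁻ _ in Gd, 2⁻¹ ∂(Measure.pi fun _ : Fin N => M.locLaw n) := by simp
      _ ≤ ∫⁻ v in Gd, K * M.failGiven est n v ∂(Measure.pi fun _ : Fin N => M.locLaw n) :=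
          setLIntegral_mono' hGm hGf
      _ ≤ ∫⁻ v, K * M.failGiven est n v ∂(Measure.pi fun _ : Fin N => M.locLaw n) :=
          setLIntegral_le_lintegral _ _
      _ = K * F N := by
          rw [lintegral_const_mul' _ _ hK, ← M.lawGiven_compl_successSet est hn1]
  have h5 : M.successProb est n + ∑' N, po {N} * F N ≤ 1 := by
    refine (add_le_add (M.successProb_le est hn1) le_rfl).trans ?_
    rw [← ENNReal.tsum_add]
    have : ∀ N, po {N} * S N + po {N} * F N = po {N} := fun N => by
      rw [← mul_add, hSF, mul_one]
    simp only [← hpo]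
    rw [tsum_congr this]
    refine le_of_eq ?_
    rw [← measure_univ (μ := po)]
    exact Measure.tsum_indicator_apply_singleton po Set.univ MeasurableSet.univ ▸ by simp
  have h6 : 2⁻¹ * 4⁻¹ ≤ K * ∑' N, po {N} * F N := by
    have h7 : (2 : ENNReal)⁻¹ ≤ po R := by
      rw [← ofReal_measureReal]
      refine le_trans (le_of_eq ?_) (ENNReal.ofReal_le_ofReal hpois)
      rw [one_div, ENNReal.ofReal_inv_of_pos (by norm_num)]
      norm_num
    calc (2 : ENNReal)⁻¹ * 4⁻¹ ≤ po R * 4⁻¹ := mul_le_mul_left h7 _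
      _ = ∑' N, R.indicator (fun N => po {N}) N * 4⁻¹ := by
          rw [ENNReal.tsum_mul_right, Measure.tsum_indicator_apply_singleton po R
            MeasurableSet.of_discrete]
      _ ≤ ∑' N, po {N} * (K * F N) := ENNReal.tsum_le_tsum fun N => by
          by_cases hN : N ∈ R
          · rw [Set.indicator_of_mem hN]
            exact mul_le_mul_right (hFR N hN) _
          · simp [Set.indicator_of_notMem hN]
      _ = K * ∑' N, po {N} * F N := by
          rw [← ENNReal.tsum_mul_left]
          exact tsum_congr fun N => by ring
  have h8 : ∑' N, po {N} * F N ≤ 1 - M.successProb est n := by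
    refine ENNReal.le_sub_of_add_le_left ?_ h5
    exact ne_top_of_le_ne_top ENNReal.one_ne_top (le_self_add.trans h5)
  exact absurd (h6.trans (mul_le_mul_right h8 K)) (not_le.2 hlt)

end GHCMParams

/-! ### Cell weights, Euclidean balls and toroidal distance -/

/-- The bound holds pointwise with indicators. Counting the core also as part of `B` is harmless,
since its volume is of smaller order in `ε`. -/
lemma one_sub_le_integral_cellWeight {X : Type*} [MeasurableSpace X] {τ : Measure X}
    [IsProbabilityMeasure τ] {b B : Set X} {σ : ℝ} (hσ : σ ∈ Set.Icc (0 : ℝ) 1)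
    (hb : MeasurableSet b) (hB : MeasurableSet B) :
    1 - (τ.real b + (1 - σ) * τ.real B) ≤ ∫ x, cellWeight b B σ x ∂τ := by
  classical
  have hib : Integrable (b.indicator (1 : X → ℝ)) τ := (integrable_const (1 : ℝ)).indicator hb
  have hiB : Integrable (fun x => (1 - σ) * B.indicator (1 : X → ℝ) x) τ :=
    ((integrable_const (1 : ℝ)).indicator hB).const_mul _
  have h2 : ∫ x, (1 - (b.indicator (1 : X → ℝ) x + (1 - σ) * B.indicator (1 : X → ℝ) x)) ∂τ =
      1 - (τ.real b + (1 - σ) * τ.real B) := by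
    have hsum : Integrable
        (fun x => b.indicator (1 : X → ℝ) x + (1 - σ) * B.indicator (1 : X → ℝ) x) τ := hib.add hiB
    rw [integral_sub (integrable_const 1) hsum, integral_add hib hiB, integral_const_mul,
      integral_indicator_one hb, integral_indicator_one hB]
    simp
  rw [← h2]
  refine integral_mono ((integrable_const 1).sub (hib.add hiB)) (integrable_cellWeight hσ hb hB)
    fun x => ?_
  obtain ⟨h0, h1⟩ := hσ
  simp only [cellWeight, Set.indicator_apply, Pi.one_apply]
  split_ifs <;> linarith

/-- Closed Euclidean ball among the coordinate vectors. -/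
def euclideanBall {d : ℕ} (z : Fin d → ℝ) (R : ℝ) : Set (Fin d → ℝ) :=
  WithLp.toLp 2 ⁻¹' Metric.closedBall (WithLp.toLp 2 z : EuclideanSpace ℝ (Fin d)) R

section euclideanBall

variable {d : ℕ} {z w : Fin d → ℝ} {R : ℝ}

lemma mem_euclideanBall :
    w ∈ euclideanBall z R ↔ dist (WithLp.toLp 2 w : EuclideanSpace ℝ (Fin d)) (WithLp.toLp 2 z) ≤ R :=
  Iff.rfl

lemma measurableSet_euclideanBall : MeasurableSet (euclideanBall z R) :=
  measurableSet_closedBall.preimage (PiLp.continuous_toLp 2 _).measurable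

lemma volume_real_euclideanBall (hR : 0 ≤ R) :
    volume.real (euclideanBall z R) = unitBallVolume d * R ^ d := by
  have h := (EuclideanSpace.volume_preserving_symm_measurableEquiv_toLp (Fin d)).symm
  have h2 : volume (euclideanBall z R) =
      volume (Metric.closedBall (WithLp.toLp 2 z : EuclideanSpace ℝ (Fin d)) R) :=
    h.measure_preimage measurableSet_closedBall.nullMeasurableSet
  rw [measureReal_def, h2, Measure.addHaar_closedBall _ _ hR, ENNReal.toReal_mul,
    ENNReal.toReal_ofReal (by positivity), finrank_euclideanSpace_fin, unitBallVolume, mul_comm]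

lemma abs_sub_le_of_mem_euclideanBall (h : w ∈ euclideanBall z R) (a : Fin d) :
    |w a - z a| ≤ R := by
  rw [mem_euclideanBall, dist_eq_norm] at h
  exact (PiLp.norm_apply_le (p := 2)
    (WithLp.toLp 2 w - WithLp.toLp 2 z : EuclideanSpace ℝ (Fin d)) a).trans h

lemma unitBallVolume_pos : 0 < unitBallVolume d :=
  ENNReal.toReal_pos (Metric.measure_ball_pos _ _ one_pos).ne' measure_ball_lt_top.ne

end euclideanBall

lemma abs_min_le_torusDist {d : ℕ} (L : ℝ) (u v : Fin d → ℝ) (a : Fin d) :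
    |min |u a - v a| (L - |u a - v a|)| ≤ torusDist L u v := by
  unfold torusDist
  rw [← Real.sqrt_sq_eq_abs]
  exact Real.sqrt_le_sqrt (Finset.single_le_sum
    (f := fun c => (min |u c - v c| (L - |u c - v c|)) ^ 2) (fun _ _ => sq_nonneg _)
    (Finset.mem_univ a))

/-- If `|u a - v a| < L - r`, the way around the torus is longer than `r`, so the distance must be
realized directly. -/
lemma abs_sub_le_of_torusDist_le {d : ℕ} {L r : ℝ} {u v : Fin d → ℝ} (h : torusDist L u v ≤ r)
    {a : Fin d} (ha : |u a - v a| < L - r) : |u a - v a| ≤ r := by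
  have h1 := (abs_min_le_torusDist L u v a).trans h
  rcases min_choice |u a - v a| (L - |u a - v a|) with h2 | h2
  · rw [h2] at h1
    exact (le_abs_self _).trans h1
  · rw [h2] at h1
    have := (le_abs_self _).trans h1
    linarith

lemma dist_toLp_le_of_torusDist_le {d : ℕ} {L r : ℝ} {u v : Fin d → ℝ} (h : torusDist L u v ≤ r)
    (ha : ∀ a, |u a - v a| < L - r) :
    dist (WithLp.toLp 2 v : EuclideanSpace ℝ (Fin d)) (WithLp.toLp 2 u) ≤ r := by
  refine le_trans (le_of_eq ?_) h
  rw [dist_comm, EuclideanSpace.dist_eq, torusDist]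
  congr 1
  refine Finset.sum_congr rfl fun a _ => ?_
  have h1 := abs_sub_le_of_torusDist_le h (ha a)
  rw [min_eq_left (by linarith [ha a, h1]), Real.dist_eq]

/-! ### Reduction of impossibility to a family of cells -/

namespace GHCMParams

variable {Z : Type*} [Fintype Z] (M : GHCMParams Z) {n N : ℕ}

/-- The visibility radius. -/
noncomputable def radius (n : ℕ) : ℝ := Real.log n ^ (1 / (M.d : ℝ))

lemma radius_pow (n : ℕ) : M.radius n ^ M.d = Real.log n := by
  unfold radius
  rw [← Real.rpow_natCast, ← Real.rpow_mul (Real.log_natCast_nonneg n),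
    one_div_mul_cancel (by have := M.d_pos; positivity), Real.rpow_one]

lemma radius_pos (hn : 2 ≤ n) : 0 < M.radius n :=
  Real.rpow_pos_of_pos (Real.log_pos (by exact_mod_cast hn)) _

lemma eventually_mul_radius_le_side (K : ℝ) :
    ∀ᶠ n : ℕ in atTop, K * M.radius n ≤ M.side n := by
  have h1 := (tendsto_log_div_natCast.const_mul (K ^ M.d)).eventually
    (ge_mem_nhds (show K ^ M.d * 0 < 1 by simp))
  filter_upwards [h1, eventually_ge_atTop 1] with n hn hn1
  have hn0 : (0 : ℝ) < n := by exact_mod_cast hn1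
  refine le_of_pow_le_pow_left₀ (by have := M.d_pos; omega : M.d ≠ 0) (M.side_pos hn1).le ?_
  rw [mul_pow, radius_pow, side_pow]
  rwa [← mul_div_assoc, div_le_one hn0] at hn

lemma locLaw_real_of_subset {S : Set (Fin M.d → ℝ)} (h : S ⊆ M.cube n) :
    (M.locLaw n).real S = volume.real S / n := by
  rw [measureReal_def, locLaw, cond_apply (show MeasurableSet (M.cube n) from measurableSet_Icc),
    Set.inter_eq_self_of_subset_right h,
    volume_cube, ENNReal.toReal_mul, ENNReal.toReal_inv, ENNReal.toReal_natCast, measureReal_def,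
    div_eq_inv_mul]

lemma ae_forall_mem_cube (hn : 1 ≤ n) :
    ∀ᵐ v ∂(Measure.pi fun _ : Fin N => M.locLaw n), ∀ l, v l ∈ M.cube n := by
  have := M.isProbabilityMeasure_locLaw hn
  refine ae_all_iff.2 fun l => ?_
  have h1 : ∀ᵐ x ∂(M.locLaw n), x ∈ M.cube n := ae_cond_mem measurableSet_Icc
  exact (measurePreserving_eval (fun _ : Fin N => M.locLaw n) l).quasiMeasurePreserving.ae h1

variable [MeasurableSpace Z] [DiscreteMeasurableSpace Z] (est : M.Estimator)

/-- Exact recovery fails if the conditional failure probability is bounded below for all locations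
with a large total weight of the cells. -/
lemma not_exactRecovery_of_cells {K : ENNReal} (hK : K ≠ ⊤) {ε κ c₁ c₂ T σ : ℝ} (hε : 0 < ε)
    (hεl : ε < M.lam) (hκ : 0 ≤ κ) (hκε : (M.lam + ε) * κ < 1) (hc₁ : 0 < c₁) (hc₂ : 0 < c₂)
    (hσ : σ ∈ Set.Icc (0 : ℝ) 1)
    (h : ∀ᶠ n : ℕ in atTop, ∃ (ι : Type) (_ : Fintype ι) (b B : ι → Set (Fin M.d → ℝ)),
      (∀ c, MeasurableSet (b c)) ∧ (∀ c, MeasurableSet (B c)) ∧ (∀ c, b c ⊆ B c) ∧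
      (Pairwise fun c c' => Disjoint (B c) (B c')) ∧ (∀ c, B c ⊆ M.cube n) ∧
      c₁ * (n / Real.log n) ≤ Fintype.card ι ∧ (∀ c, c₂ * Real.log n ≤ volume.real (b c)) ∧
      (∀ c, volume.real (b c) + (1 - σ) * volume.real (B c) ≤ κ * Real.log n) ∧
      ∀ (N : ℕ) (v : Locations M.d N), (M.lam - ε) * n ≤ N → (∀ l, v l ∈ M.cube n) →
        T ≤ ∑ c, soleWeight (b c) (B c) σ v → 2⁻¹ ≤ K * M.failGiven est n v) :
    ¬M.ExactRecovery est := by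
  refine M.not_exactRecovery_of_failGiven est hK hε ?_
  filter_upwards [h, eventually_half_le_measure_sum_soleWeight (sub_pos.2 hεl)
    (by linarith [M.lam_pos] : 0 < M.lam + ε) hκ hκε hc₁ hc₂ T, eventually_ge_atTop 1]
    with n ⟨ι, _, b, B, hb, hB, hbB, hd, hcube, hcard, hbv, hBv, hfail⟩ hT hn1 N hN hN'
  have := M.isProbabilityMeasure_locLaw hn1
  have hn0 : (0 : ℝ) < n := by exact_mod_cast hn1
  have hm1 : MeasurableSet {v : Locations M.d N | T ≤ ∑ c, soleWeight (b c) (B c) σ v} :=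
    measurableSet_le measurable_const
      (Finset.measurable_sum _ fun c _ => measurable_soleWeight (hb c) (hB c))
  have hm2 : MeasurableSet {v : Locations M.d N | ∀ l, v l ∈ M.cube n} := by
    simp only [Set.ofPred_forall]
    exact MeasurableSet.iInter fun l => measurableSet_Icc.preimage (measurable_pi_apply l)
  refine ⟨{v | T ≤ ∑ c, soleWeight (b c) (B c) σ v} ∩ {v | ∀ l, v l ∈ M.cube n}, hm1.inter hm2,
    ?_, fun v hv => hfail N v hN hv.2 hv.1⟩
  have h1 := hT N hN hN' (Fin M.d → ℝ) ι (M.locLaw n) b B σ hσ hb hB hbB hd hcard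
    (fun c => ?_) (fun c => ?_)
  · refine h1.trans (le_of_eq (measureReal_congr ?_))
    filter_upwards [M.ae_forall_mem_cube (N := N) hn1] with v hv
    exact propext ⟨fun h => ⟨h, hv⟩, fun h => h.1⟩
  · rw [M.locLaw_real_of_subset ((hbB c).trans (hcube c)), ← mul_div_assoc]
    exact div_le_div_of_nonneg_right (hbv c) hn0.le
  · refine le_trans ?_ (one_sub_le_integral_cellWeight hσ (hb c) (hB c))
    rw [M.locLaw_real_of_subset ((hbB c).trans (hcube c)), M.locLaw_real_of_subset (hcube c),
      ← mul_div_assoc, ← mul_div_assoc, ← add_div]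
    exact sub_le_sub_left (div_le_div_of_nonneg_right (hBv c) hn0.le) _

end GHCMParams

section soleWeight

variable {X : Type*} {N : ℕ} {b B : Set X} {σ : ℝ}

lemma prod_soleFactor_le_pow (hσ : σ ∈ Set.Icc (0 : ℝ) 1) {u : Fin N} {v : Fin N → X}
    (h : ∏ l, soleFactor b B σ u l (v l) ≠ 0) {p : Fin N → Prop} [Fintype {l // p l}]
    (hp : ∀ l, p l → l ≠ u ∧ v l ∈ B) :
    ∏ l, soleFactor b B σ u l (v l) ≤ σ ^ Fintype.card {l // p l} := by
  classical
  have h1 := (mem_of_prod_soleFactor_ne_zero h).2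
  calc ∏ l, soleFactor b B σ u l (v l)
      = (∏ l with p l, soleFactor b B σ u l (v l)) *
        ∏ l with ¬p l, soleFactor b B σ u l (v l) := (Finset.prod_filter_mul_prod_filter_not _ _ _).symm
    _ ≤ (∏ l with p l, soleFactor b B σ u l (v l)) * 1 :=
        mul_le_mul_of_nonneg_left (Finset.prod_le_one (fun l _ => (soleFactor_mem_Icc hσ u l _).1)
          fun l _ => (soleFactor_mem_Icc hσ u l _).2)
          (Finset.prod_nonneg fun l _ => (soleFactor_mem_Icc hσ u l _).1)
    _ = ∏ l with p l, σ := by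
        rw [mul_one]
        refine Finset.prod_congr rfl fun l hl => ?_
        obtain ⟨hlu, hlB⟩ := hp l (Finset.mem_filter.1 hl).2
        rw [soleFactor, if_neg hlu, cellWeight, if_neg (h1 l hlu).1, if_pos hlB]
    _ = σ ^ Fintype.card {l // p l} := by rw [Finset.prod_const, Fintype.card_subtype]

end soleWeight

lemma half_le_natFloor {x : ℝ} (hx : 1 ≤ x) : x / 2 ≤ ⌊x⌋₊ := by
  have h1 := Nat.lt_floor_add_one x
  have h2 : (1 : ℝ) ≤ ⌊x⌋₊ := by exact_mod_cast Nat.one_le_floor_iff x |>.2 hx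
  linarith

lemma sixteen_mul_le_of_lt_floor {L r : ℝ} (hr : 0 < r) (c : Fin ⌊L / (16 * r)⌋₊) :
    16 * r * ((c : ℕ) : ℝ) ≤ L := by
  have h1 : ((c : ℕ) : ℝ) ≤ L / (16 * r) := by
    have hL : 0 ≤ L / (16 * r) := by
      by_contra hL
      exact absurd (Nat.floor_of_nonpos (not_le.1 hL).le) (by have := c.2; omega)
    exact (Nat.le_floor_iff hL).1 c.2.le
  rw [le_div_iff₀ (by positivity)] at h1
  linarith

/-! ### Sparse grids of cells; confusion at isolated vertices -/

namespace GHCMParams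

variable {Z : Type*} [Fintype Z] (M : GHCMParams Z) {n N : ℕ}

/-- Points of a sparse grid in one quarter of the cube. -/
noncomputable def gridPoint (n : ℕ) (c : Fin M.d → Fin ⌊M.side n / (16 * M.radius n)⌋₊) :
    Fin M.d → ℝ :=
  fun a => 4 * M.radius n * ((c a : ℕ) : ℝ)

lemma gridPoint_mem_Icc (hn : 2 ≤ n) (c) (a : Fin M.d) :
    M.gridPoint n c a ∈ Set.Icc 0 (M.side n / 4) := by
  have hr := M.radius_pos hn
  refine ⟨by unfold gridPoint; positivity, ?_⟩
  have := sixteen_mul_le_of_lt_floor hr (c a)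
  unfold gridPoint
  linarith

lemma exists_radius_le_abs_gridPoint_sub (hn : 2 ≤ n) {c c'} (h : c ≠ c') :
    ∃ a, 4 * M.radius n ≤ |M.gridPoint n c a - M.gridPoint n c' a| := by
  obtain ⟨a, ha⟩ := Function.ne_iff.1 h
  refine ⟨a, ?_⟩
  have hr := M.radius_pos hn
  have h1 : (1 : ℝ) ≤ |((c a : ℕ) : ℝ) - ((c' a : ℕ) : ℝ)| := by
    have : ((c a : ℕ) : ℤ) - ((c' a : ℕ) : ℤ) ≠ 0 := by
      intro h0
      exact ha (Fin.ext (by omega))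
    exact_mod_cast Int.one_le_abs this
  unfold gridPoint
  rw [← mul_sub, abs_mul, abs_of_pos (by positivity : 0 < 4 * M.radius n)]
  nlinarith

/-- The floor is at least half of `side / (16 * radius)`, and the `d`-th powers of side and radius
are `n` and `log n`. -/
lemma grid_card_le (hn : 2 ≤ n) (h : 16 * M.radius n ≤ M.side n) :
    (1 / 32) ^ M.d * (n / Real.log n) ≤
      Fintype.card (Fin M.d → Fin ⌊M.side n / (16 * M.radius n)⌋₊) := by
  have hr := M.radius_pos hn
  rw [Fintype.card_fun, Fintype.card_fin, Fintype.card_fin, Nat.cast_pow, ← M.radius_pow,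
    ← M.side_pow, ← div_pow, ← mul_pow]
  have hL := M.side_pos (show 1 ≤ n by omega)
  refine pow_le_pow_left₀ (by positivity) (le_trans (le_of_eq ?_)
    (half_le_natFloor ((one_le_div (by positivity)).2 h))) _
  field_simp
  norm_num

lemma mem_cube_of_abs_sub_gridPoint_le (hn : 2 ≤ n) (h : 16 * M.radius n ≤ M.side n) {c}
    {w : Fin M.d → ℝ} (hw : ∀ a, |w a - M.gridPoint n c a| ≤ 2 * M.radius n) : w ∈ M.cube n := by
  have hr := M.radius_pos hn
  refine ⟨fun a => ?_, fun a => ?_⟩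
  all_goals
    obtain ⟨h1, h2⟩ := M.gridPoint_mem_Icc hn c a
    have h3 := abs_le.1 (hw a)
    simp only
    linarith [h3.1, h3.2]

/-- Grid coordinates stay in `[0, side / 4]`, so no point of the cube is further than `3 / 4 * side
+ 2 * radius` from a cell in any coordinate. Around cells the torus thus looks Euclidean. -/
lemma abs_sub_lt_of_mem_cube (hn : 2 ≤ n) (h : 32 * M.radius n ≤ M.side n) {c}
    {w x : Fin M.d → ℝ} {a : Fin M.d} (hw : |w a - M.gridPoint n c a| ≤ 2 * M.radius n)
    (hx : x ∈ M.cube n) : |w a - x a| < M.side n - M.radius n := by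
  have hr := M.radius_pos hn
  obtain ⟨h1, h2⟩ := M.gridPoint_mem_Icc hn c a
  have h3 := abs_le.1 hw
  have h4 := hx.1 a
  have h5 := hx.2 a
  simp only at h4 h5
  rw [abs_lt]
  constructor <;> linarith [h3.1, h3.2]

/-- Disjoint balls with slightly smaller concentric balls from which only the former are visible. -/
lemma eventually_exists_balls {ε : ℝ} (hε : 0 < ε) (hε1 : ε < 1) :
    ∀ᶠ n : ℕ in atTop, ∃ (ι : Type) (_ : Fintype ι) (b B : ι → Set (Fin M.d → ℝ)),
      (∀ c, MeasurableSet (b c)) ∧ (∀ c, MeasurableSet (B c)) ∧ (∀ c, b c ⊆ B c) ∧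
      (Pairwise fun c c' => Disjoint (B c) (B c')) ∧ (∀ c, B c ⊆ M.cube n) ∧
      (1 / 32) ^ M.d * (n / Real.log n) ≤ Fintype.card ι ∧
      (∀ c, volume.real (b c) = unitBallVolume M.d * ε ^ M.d * Real.log n) ∧
      (∀ c, volume.real (B c) = unitBallVolume M.d * (1 + ε) ^ M.d * Real.log n) ∧
      ∀ c, ∀ x ∈ b c, ∀ y ∈ M.cube n, M.Visible n x y → y ∈ B c := by
  filter_upwards [M.eventually_mul_radius_le_side 32, eventually_ge_atTop 2] with n h32 hn
  have hr := M.radius_pos hn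
  have h16 : 16 * M.radius n ≤ M.side n := by linarith
  have hbd : ∀ c, ∀ w ∈ euclideanBall (M.gridPoint n c) ((1 + ε) * M.radius n), ∀ a,
      |w a - M.gridPoint n c a| < 2 * M.radius n := fun c w hw a =>
    (abs_sub_le_of_mem_euclideanBall hw a).trans_lt (by nlinarith)
  have hsub : ∀ c, euclideanBall (M.gridPoint n c) (ε * M.radius n) ⊆
      euclideanBall (M.gridPoint n c) ((1 + ε) * M.radius n) := fun c w hw =>
    mem_euclideanBall.2 ((mem_euclideanBall.1 hw).trans (by nlinarith))
  refine ⟨Fin M.d → Fin ⌊M.side n / (16 * M.radius n)⌋₊, inferInstance,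
    fun c => euclideanBall (M.gridPoint n c) (ε * M.radius n),
    fun c => euclideanBall (M.gridPoint n c) ((1 + ε) * M.radius n),
    fun _ => measurableSet_euclideanBall, fun _ => measurableSet_euclideanBall,
    hsub, fun c c' hcc => ?_, fun c w hw => ?_, M.grid_card_le hn h16, fun c => ?_, fun c => ?_,
    fun c x hx y hy hxy => ?_⟩
  · obtain ⟨a, ha⟩ := M.exists_radius_le_abs_gridPoint_sub hn hcc
    refine Set.disjoint_left.2 fun w hw hw' => ?_
    have h1 := abs_lt.1 (hbd c w hw a)
    have h2 := abs_lt.1 (hbd c' w hw' a)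
    rcases le_abs.1 ha with h3 | h3 <;> linarith [h1.1, h1.2, h2.1, h2.2]
  · exact M.mem_cube_of_abs_sub_gridPoint_le hn h16 fun a => (hbd c w hw a).le
  · rw [volume_real_euclideanBall (by positivity), mul_pow, radius_pow, mul_assoc]
  · rw [volume_real_euclideanBall (by positivity), mul_pow, radius_pow, mul_assoc]
  · have h1 := dist_toLp_le_of_torusDist_le hxy fun a =>
      M.abs_sub_lt_of_mem_cube hn h32 (hbd c x (hsub c hx) a).le hy
    refine mem_euclideanBall.2 ((dist_triangle _ (WithLp.toLp 2 x) _).trans ?_)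
    exact (add_le_add h1 (mem_euclideanBall.1 hx)).trans (le_of_eq (by rw [radius]; ring))

variable [MeasurableSpace Z] [DiscreteMeasurableSpace Z] (est : M.Estimator)

open Classical in
-- The sole occupants of the cores serve as the flipped vertices. Their closed stars lie in disjoint
-- regions `B c`, hence are separated. The cell weight, which pays `σ` for every further point of `B
-- c`, is at most `σ` to the number of visible neighbors.
lemma half_le_failGiven_of_soleWeight {i j : Z} (hij : i ≠ j) {c₀ σ : ℝ} (hc₀ : 0 < c₀)
    (hσ : σ ∈ Set.Icc (0 : ℝ) 1)
    (hcσ : ∀ (T : Type) [Fintype T],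
      c₀ * σ ^ Fintype.card T ≤ ∫ z, M.minRatio i j z ∂(Measure.pi fun _ : T => M.markLaw i))
    {ι : Type} [Fintype ι] {b B : ι → Set (Fin M.d → ℝ)} (hbB : ∀ c, b c ⊆ B c)
    (hd : Pairwise fun c c' => Disjoint (B c) (B c')) {v : Locations M.d N}
    (hvis : ∀ c u l, v u ∈ b c → M.Visible n (v u) (v l) → v l ∈ B c)
    (hT : 16 / (M.prior i * c₀) ≤ ∑ c, soleWeight (b c) (B c) σ v) {A : Finset (Fin N)}
    (hA : ∑ x : Labeling Z N with ¬AllLabels A x, ENNReal.ofReal (M.labelProb x) ≤ 4⁻¹) :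
    2⁻¹ ≤ (ENNReal.ofReal (M.prior i / M.prior j) * Fintype.card (Equiv.Perm Z) + 1) *
      M.failGiven est n v := by
  have hex : ∀ c, ∃ u, soleWeight (b c) (B c) σ v ≠ 0 →
      soleWeight (b c) (B c) σ v = ∏ l, soleFactor (b c) (B c) σ u l (v l) ∧
        ∏ l, soleFactor (b c) (B c) σ u l (v l) ≠ 0 := fun c => by
    by_cases h : soleWeight (b c) (B c) σ v = 0
    · have hN : Nonempty (Fin N) := by
        by_contra hN
        rw [not_nonempty_iff] at hN
        have h0 : ∀ c, soleWeight (b c) (B c) σ v = 0 := fun c => by simp [soleWeight]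
        simp only [h0, Finset.sum_const_zero] at hT
        have := M.prior_pos i
        exact absurd hT (not_le.2 (by positivity))
      exact ⟨hN.some, fun h' => absurd h h'⟩
    · obtain ⟨u, hu⟩ := soleWeight_eq_of_ne_zero h
      exact ⟨u, fun _ => hu⟩
  choose f hf using hex
  set C : Finset ι := Finset.univ.filter fun c => soleWeight (b c) (B c) σ v ≠ 0 with hC
  have hfC : ∀ c ∈ C, v (f c) ∈ b c := fun c hc =>
    (mem_of_prod_soleFactor_ne_zero (hf c (Finset.mem_filter.1 hc).2).2).1
  have hinj : Set.InjOn f C := fun c hc c' hc' h => by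
    by_contra hne
    exact Set.disjoint_left.1 (hd hne) (hbB c (hfC c hc)) (hbB c' (h ▸ hfC c' hc'))
  have hvisB : ∀ c ∈ C, ∀ l, (l = f c ∨ M.Visible n (v (f c)) (v l)) → v l ∈ B c := by
    rintro c hc l (rfl | hl)
    exacts [hbB c (hfC c hc), hvis c _ l (hfC c hc) hl]
  refine M.half_le_failGiven_of_stars est hij (I := C.image f) ?_ hcσ ?_ hA
  · intro u hu u' hu' huu
    obtain ⟨c, hc, rfl⟩ := Finset.mem_image.1 hu
    obtain ⟨c', hc', rfl⟩ := Finset.mem_image.1 hu'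
    have hne : c ≠ c' := fun h => huu (by rw [h])
    rintro l l' hl hl' rfl
    exact Set.disjoint_left.1 (hd hne) (hvisB c hc l hl) (hvisB c' hc' l hl')
  · have hpos : 0 < M.prior i * c₀ := mul_pos (M.prior_pos i) hc₀
    rw [div_le_iff₀ hpos, mul_comm] at hT
    refine hT.trans (mul_le_mul_of_nonneg_left ?_ hpos.le)
    rw [Finset.sum_image fun c hc c' hc' h => hinj hc hc' h]
    have h1 : ∑ c, soleWeight (b c) (B c) σ v = ∑ c ∈ C, soleWeight (b c) (B c) σ v := by
      rw [hC, Finset.sum_filter_ne_zero]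
    rw [h1]
    refine Finset.sum_le_sum fun c hc => ?_
    obtain ⟨h2, h3⟩ := hf c (Finset.mem_filter.1 hc).2
    rw [h2]
    exact prod_soleFactor_le_pow hσ h3 fun l hl => ⟨hl.1, hvis c _ l (hfC c hc) hl.2⟩

/-- Impossibility by confusion of the labels `i` and `j` at isolated vertices. -/
lemma not_exactRecovery_of_minRatio {i j : Z} (hij : i ≠ j) {c₀ σ : ℝ} (hc₀ : 0 < c₀)
    (hσ : σ ∈ Set.Icc (0 : ℝ) 1)
    (hcσ : ∀ (T : Type) [Fintype T],
      c₀ * σ ^ Fintype.card T ≤ ∫ z, M.minRatio i j z ∂(Measure.pi fun _ : T => M.markLaw i))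
    (h : M.lam * (unitBallVolume M.d * (1 - σ)) < 1) : ¬M.ExactRecovery est := by
  classical
  set ν := unitBallVolume M.d with hν
  have hν0 : 0 < ν := unitBallVolume_pos
  -- One `ε` serves both as the relative core radius and as the slack in the number of vertices. As
  -- it tends to `0`, the exponent tends to `λ ν (1 - σ) < 1`.
  have hlim : Tendsto (fun ε : ℝ => (M.lam + ε) *
      (ν * ε ^ M.d + (1 - σ) * (ν * (1 + ε) ^ M.d))) (𝓝[>] 0)
      (𝓝 ((M.lam + 0) * (ν * 0 ^ M.d + (1 - σ) * (ν * (1 + 0) ^ M.d)))) := by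
    refine Tendsto.mono_left (Continuous.tendsto ?_ 0) nhdsWithin_le_nhds
    fun_prop
  have hlt : (M.lam + 0) * (ν * 0 ^ M.d + (1 - σ) * (ν * (1 + 0) ^ M.d)) < 1 := by
    rw [zero_pow (by have := M.d_pos; omega)]
    refine lt_of_eq_of_lt ?_ h
    ring
  obtain ⟨ε, hεκ, hεm, hε0⟩ := ((hlim.eventually (gt_mem_nhds hlt)).and
    (((eventually_lt_nhds (show (0 : ℝ) < min 1 M.lam from lt_min one_pos M.lam_pos)).filter_mono
      nhdsWithin_le_nhds).and self_mem_nhdsWithin)).exists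
  have hε : 0 < ε := hε0
  obtain ⟨hε1, hεl⟩ := lt_min_iff.1 hεm
  obtain ⟨m, hm⟩ := M.exists_sum_not_allLabels_le
  have h1σ : 0 ≤ 1 - σ := sub_nonneg.2 hσ.2
  refine M.not_exactRecovery_of_cells est
    (K := ENNReal.ofReal (M.prior i / M.prior j) * Fintype.card (Equiv.Perm Z) + 1)
    (T := 16 / (M.prior i * c₀)) (c₁ := (1 / 32) ^ M.d) (c₂ := ν * ε ^ M.d)
    (by finiteness) hε hεl
    (by positivity) hεκ (by positivity) (by positivity) hσ ?_
  -- With at least `2 * m` vertices, any set of `m` of them has at least `m` vertices in its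
  -- complement.
  have hev : ∀ᶠ n : ℕ in atTop, (2 * m : ℝ) ≤ (M.lam - ε) * n :=
    (tendsto_natCast_atTop_atTop.const_mul_atTop (sub_pos.2 hεl)).eventually_ge_atTop _
  filter_upwards [M.eventually_exists_balls hε hε1, hev]
    with n ⟨ι, _, b, B, hb, hB, hbB, hd, hcube, hcard, hbv, hBv, hvis⟩ hnm
  refine ⟨ι, inferInstance, b, B, hb, hB, hbB, hd, hcube, hcard, fun c => (hbv c).ge, fun c => ?_,
    fun N v hN hv hT => ?_⟩
  · rw [hbv, hBv]
    exact le_of_eq (by ring)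
  · have hmN : 2 * m ≤ N := by exact_mod_cast hnm.trans hN
    obtain ⟨A, -, hA⟩ := Finset.exists_subset_card_eq
      (show m ≤ (Finset.univ : Finset (Fin N)).card by rw [Finset.card_univ, Fintype.card_fin]; omega)
    refine M.half_le_failGiven_of_soleWeight est hij hc₀ hσ hcσ hbB hd
      (fun c u l hu hul => hvis c _ hu _ (hv l) hul) hT (A := A) (hm N A hA.ge ?_)
    rw [Finset.card_compl, Fintype.card_fin]
    omega

end GHCMParams

/-! ### The Chernoff–Hellinger threshold -/

namespace GHCMParams

section divergence

variable {Z : Type*} [Fintype Z] (M : GHCMParams Z)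

/-- The sum of the Hellinger integrals of order `t` in the Chernoff–Hellinger divergence. -/
noncomputable def hellinger (i j : Z) (t : ℝ) : ℝ :=
  ∑ r, M.prior r * ∫ y, M.p i r y ^ t * M.p j r y ^ (1 - t) ∂M.ref

lemma hellinger_nonneg (i j : Z) (t : ℝ) : 0 ≤ M.hellinger i j t :=
  Finset.sum_nonneg fun r _ => mul_nonneg (M.prior_pos r).le (integral_nonneg fun _ =>
    mul_nonneg (Real.rpow_nonneg (M.p_nonneg _ _ _) _) (Real.rpow_nonneg (M.p_nonneg _ _ _) _))

lemma hellinger_zero (i j : Z) : M.hellinger i j 0 = 1 := by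
  unfold hellinger
  refine Eq.trans (Finset.sum_congr rfl fun r _ => ?_) M.prior_sum
  have h1 : ∫ y, M.p i r y ^ (0 : ℝ) * M.p j r y ^ (1 - (0 : ℝ)) ∂M.ref = 1 := by
    simp only [Real.rpow_zero, sub_zero, Real.rpow_one, one_mul]
    rw [integral_eq_lintegral_of_nonneg_ae (ae_of_all _ fun y => M.p_nonneg _ _ _)
      (M.p_measurable j r).aestronglyMeasurable, M.p_lintegral, ENNReal.toReal_one]
  rw [h1, mul_one]

lemma one_sub_chDiv_le (i j : Z) {t : ℝ} (ht : t ∈ Set.Icc (0 : ℝ) 1) :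
    1 - M.chDiv i j ≤ M.hellinger i j t := by
  rw [chDiv, sub_sub_cancel]
  exact ciInf_le (f := fun t : Set.Icc (0 : ℝ) 1 => M.hellinger i j t)
    ⟨0, by rintro _ ⟨t, rfl⟩; exact M.hellinger_nonneg i j t⟩ ⟨t, ht⟩

lemma one_sub_chDiv_mem_Icc (i j : Z) : 1 - M.chDiv i j ∈ Set.Icc (0 : ℝ) 1 := by
  refine ⟨?_, (M.one_sub_chDiv_le i j ⟨le_rfl, zero_le_one⟩).trans (M.hellinger_zero i j).le⟩
  rw [chDiv, sub_sub_cancel]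
  exact Real.iInf_nonneg fun t => M.hellinger_nonneg i j t

variable [MeasurableSpace Z] [DiscreteMeasurableSpace Z]

lemma integrable_ratio (i j : Z) : Integrable (M.ratio i j) (M.markLaw i) := by
  refine integrable_finsetSum_measure.2 fun r _ =>
    Integrable.smul_measure ?_ ENNReal.ofReal_ne_top
  exact (integrable_map_measure (M.measurable_ratio i j).aestronglyMeasurable
    (by fun_prop)).2 (M.integrable_ratio_mk i j r)

/-- The ratio is `p j / p i` under a law with density `p i`, so `t` falls on `p j`, which has
exponent `1 - t` in the divergence. The endpoints are excluded because `0 ^ 0 = 1` can break the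
identity where a density vanishes. -/
lemma integral_ratio_rpow (i j : Z) {t : ℝ} (ht : t ∈ Set.Ioo (0 : ℝ) 1) :
    ∫ z, M.ratio i j z ^ t ∂(M.markLaw i) = M.hellinger i j (1 - t) := by
  have hm : Measurable fun z => M.ratio i j z ^ t := (M.measurable_ratio i j).pow_const t
  have hi : ∀ r, Integrable (fun z => M.ratio i j z ^ t) ((M.P i r).map (Prod.mk r)) := fun r => by
    refine (integrable_map_measure hm.aestronglyMeasurable (by fun_prop)).2 ?_
    refine ((integrable_const (1 : ℝ)).add (M.integrable_ratio_mk i j r)).mono'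
      (hm.comp (by fun_prop)).aestronglyMeasurable (ae_of_all _ fun y => ?_)
    have h0 := M.ratio_nonneg i j (r, y)
    simp only [Function.comp, Pi.add_apply]
    rw [Real.norm_of_nonneg (Real.rpow_nonneg h0 _)]
    rcases le_total (M.ratio i j (r, y)) 1 with h1 | h1
    · linarith [Real.rpow_le_one h0 h1 ht.1.le]
    · have := Real.rpow_le_rpow_of_exponent_le h1 ht.2.le
      rw [Real.rpow_one] at this
      linarith
  unfold markLaw hellinger
  rw [integral_finsetSum_measure fun r _ => (hi r).smul_measure ENNReal.ofReal_ne_top]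
  refine Finset.sum_congr rfl fun r _ => ?_
  rw [integral_smul_measure, ENNReal.toReal_ofReal (M.prior_pos r).le, smul_eq_mul,
    integral_map (by fun_prop) hm.aestronglyMeasurable, P,
    integral_withDensity_eq_integral_toReal_smul (M.p_measurable i r).ennreal_ofReal
      (ae_of_all _ fun _ => ENNReal.ofReal_lt_top)]
  congr 1
  refine integral_congr_ae (ae_of_all _ fun y => ?_)
  have hi0 := M.p_nonneg i r y
  have hj0 := M.p_nonneg j r y
  simp only [ratio]
  rw [ENNReal.toReal_ofReal hi0, smul_eq_mul, sub_sub_cancel]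
  rcases hi0.eq_or_lt with h0 | h0
  · rw [← h0, zero_mul, Real.zero_rpow (by linarith [ht.2]), zero_mul]
  · rw [Real.div_rpow hj0 hi0, Real.rpow_sub h0, Real.rpow_one]
    field_simp

/-- Impossibility below the Chernoff–Hellinger threshold. -/
lemma not_exactRecovery_of_chDiv_lt (est : M.Estimator) {i j : Z} (hij : i ≠ j)
    (h : M.lam * unitBallVolume M.d * M.chDiv i j < 1) : ¬M.ExactRecovery est := by
  obtain ⟨h0, h1⟩ := M.one_sub_chDiv_mem_Icc i j
  -- The Chernoff bound needs `σ` strictly below `1 - D_+`, for which the strict hypothesis leaves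
  -- room. If `D_+ = 1` there is no such nonnegative `σ`, but the bound is trivial for `σ = 0`.
  have key : ∃ σ, 0 ≤ σ ∧ σ ≤ 1 - M.chDiv i j ∧ (σ = 0 ∨ σ < 1 - M.chDiv i j) ∧
      M.lam * (unitBallVolume M.d * (1 - σ)) < 1 := by
    rcases h0.eq_or_lt with h2 | h2
    · refine ⟨0, le_rfl, h0, Or.inl rfl, ?_⟩
      have h3 : M.chDiv i j = 1 := by linarith
      rw [h3] at h
      linarith
    · have hlim : Tendsto (fun σ : ℝ => M.lam * (unitBallVolume M.d * (1 - σ)))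
          (𝓝[<] (1 - M.chDiv i j))
          (𝓝 (M.lam * (unitBallVolume M.d * (1 - (1 - M.chDiv i j))))) := by
        refine Tendsto.mono_left (Continuous.tendsto ?_ _) nhdsWithin_le_nhds
        fun_prop
      rw [sub_sub_cancel, ← mul_assoc] at hlim
      obtain ⟨σ, hσ, hσ0, hσ1⟩ := ((hlim.eventually (gt_mem_nhds h)).and
        (((lt_mem_nhds h2).filter_mono nhdsWithin_le_nhds).and self_mem_nhdsWithin)).exists
      have hσ1' : σ < 1 - M.chDiv i j := hσ1
      exact ⟨σ, hσ0.le, hσ1'.le, Or.inr hσ1', hσ⟩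
  obtain ⟨σ, hσ0, hσ1, hσ, hlt⟩ := key
  obtain ⟨c₀, hc₀, hc⟩ := exists_le_integral_min_prod (M.measurable_ratio i j)
    (M.ratio_nonneg i j) (M.integrable_ratio i j) hσ0
    (hσ.imp id fun hσ => ⟨hσ, fun t ht => (M.one_sub_chDiv_le i j
      (t := 1 - t) ⟨by linarith [ht.2], by linarith [ht.1]⟩).trans
      (M.integral_ratio_rpow i j ht).ge⟩)
  exact M.not_exactRecovery_of_minRatio est hij hc₀ ⟨hσ0, hσ1.trans h1⟩
    (fun T _ => hc T) hlt

end divergence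

end GHCMParams

/-! ### Dimension one: disconnected visibility graphs -/

namespace GHCMParams

variable {Z : Type*} [Fintype Z] (M : GHCMParams Z) {n N : ℕ}

/-- A cube with side length `R` and a corner on a sparse grid of the diagonal. -/
noncomputable def diagonalBox (n : ℕ) (R : ℝ) (c : Fin ⌊M.side n / (16 * M.radius n)⌋₊) :
    Set (Fin M.d → ℝ) :=
  Set.Icc (fun _ => 4 * M.radius n * ((c : ℕ) : ℝ)) fun _ => 4 * M.radius n * ((c : ℕ) : ℝ) + R

lemma volume_real_diagonalBox {R : ℝ} (hR : 0 ≤ R) (c) :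
    volume.real (M.diagonalBox n R c) = R ^ M.d := by
  rw [measureReal_def, diagonalBox, Real.volume_Icc_pi_toReal fun _ => by linarith]
  simp

lemma grid_gap {r : ℝ} (hr : 0 < r) {k : ℕ} {c c' : Fin k} (h : c < c') :
    4 * r * ((c : ℕ) : ℝ) + 4 * r ≤ 4 * r * ((c' : ℕ) : ℝ) := by
  have h1 : ((c : ℕ) : ℝ) + 1 ≤ ((c' : ℕ) : ℝ) := by exact_mod_cast h
  nlinarith

lemma pairwise_disjoint_diagonalBox (hn : 2 ≤ n) {R : ℝ} (hR : R < 4 * M.radius n) :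
    Pairwise fun c c' => Disjoint (M.diagonalBox n R c) (M.diagonalBox n R c') := by
  have hr := M.radius_pos hn
  have a : Fin M.d := ⟨0, M.d_pos⟩
  have key : ∀ c c', c < c' → Disjoint (M.diagonalBox n R c) (M.diagonalBox n R c') :=
    fun c c' h => Set.disjoint_left.2 fun w hw hw' => by
      have h1 := grid_gap hr h
      have h2 := hw.2 a
      have h3 := hw'.1 a
      simp only at h2 h3
      linarith
  intro c c' h
  rcases lt_or_gt_of_ne h with h | h
  exacts [key c c' h, (key c' c h).symm]

lemma diagonalBox_subset_cube (hn : 2 ≤ n) (h : 16 * M.radius n ≤ M.side n) {R : ℝ}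
    (hR : R ≤ 2 * M.radius n) (c) : M.diagonalBox n R c ⊆ M.cube n := fun w hw => by
  have hr := M.radius_pos hn
  have h0 := sixteen_mul_le_of_lt_floor hr c
  have h3 : 0 ≤ M.radius n * ((c : ℕ) : ℝ) := by positivity
  refine ⟨fun a => ?_, fun a => ?_⟩
  · have := hw.1 a
    simp only at this ⊢
    linarith
  · have := hw.2 a
    simp only at this ⊢
    linarith

/-- In dimension one, many boxes occupied by a single vertex separate the vertices into mutually
invisible parts. -/
lemma exists_invisible_cut (hd : M.d = 1) (hn : 2 ≤ n) (h32 : 32 * M.radius n ≤ M.side n)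
    {ε : ℝ} (hε : 0 < ε) (hε1 : ε < 1) {v : Locations M.d N} (hv : ∀ l, v l ∈ M.cube n)
    {C : Finset (Fin ⌊M.side n / (16 * M.radius n)⌋₊)} {m : ℕ} (hC : C.card = 2 * m + 1)
    (h : ∀ c ∈ C, ∃ u, v u ∈ M.diagonalBox n (ε * M.radius n) c ∧
      ∀ l ≠ u, v l ∉ M.diagonalBox n ((1 + ε) * M.radius n) c) :
    ∃ A : Finset (Fin N), m ≤ A.card ∧ m ≤ Aᶜ.card ∧
      ∀ u ∈ A, ∀ w ∉ A, ¬M.Visible n (v u) (v w) := by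
  have hr := M.radius_pos hn
  obtain ⟨a, ha⟩ : ∃ a : Fin M.d, ∀ a', a' = a :=
    ⟨⟨0, M.d_pos⟩, fun a' => Fin.ext (by have := a'.2; simp only; omega)⟩
  have hmem : ∀ R c (x : Fin M.d → ℝ), x ∈ M.diagonalBox n R c ↔
      4 * M.radius n * ((c : ℕ) : ℝ) ≤ x a ∧ x a ≤ 4 * M.radius n * ((c : ℕ) : ℝ) + R := fun R c x =>
    ⟨fun hx => ⟨hx.1 a, hx.2 a⟩, fun hx => ⟨fun a' => by rw [ha a']; exact hx.1,
      fun a' => by rw [ha a']; exact hx.2⟩⟩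
  have hεr : ε * M.radius n < M.radius n := by nlinarith
  have hεr0 : 0 < ε * M.radius n := by positivity
  let g := C.orderEmbOfFin hC
  have hg : ∀ k, g k ∈ C := fun k => C.orderEmbOfFin_mem hC k
  choose f hf using fun k => h (g k) (hg k)
  simp only [hmem] at hf
  have hfx : ∀ k k', k < k' → v (f k) a + 3 * M.radius n < v (f k') a := fun k k' hk => by
    have h1 := grid_gap hr (g.strictMono hk)
    linarith [(hf k).1.2, (hf k').1.1]
  have hinj : Function.Injective f := fun k k' hkk => by
    rcases lt_trichotomy k k' with hk | hk | hk
    · have := hfx k k' hk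
      rw [hkk] at this
      linarith
    · exact hk
    · have := hfx k' k hk
      rw [hkk] at this
      linarith
  -- The right end of the `k`-th core. Its occupant lies to the left of it and the rest of the box
  -- is empty, so the next vertex to the right is more than a radius away.
  let z : Fin (2 * m + 1) → ℝ := fun k => 4 * M.radius n * ((g k : ℕ) : ℝ) + ε * M.radius n
  have hgap : ∀ k l, z k < v l a → z k + M.radius n < v l a := fun k l hl => by
    have h1 : l ≠ f k := fun h => by
      have := (hf k).1.2
      rw [← h] at this
      linarith
    have h2 := (hf k).2 l h1
    by_contra h3
    simp only [z] at hl h3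
    exact h2 ⟨by linarith, by linarith⟩
  -- Cutting at cores `0` and `m` leaves the occupants of cores `1, …, m` between the cuts and those
  -- of `m + 1, …, 2 * m` beyond.
  let k₀ : Fin (2 * m + 1) := ⟨0, by omega⟩
  let k₁ : Fin (2 * m + 1) := ⟨m, by omega⟩
  let A : Finset (Fin N) := Finset.univ.filter fun l => z k₀ < v l a ∧ v l a ≤ z k₁
  have hA : ∀ l, l ∈ A ↔ z k₀ < v l a ∧ v l a ≤ z k₁ := fun l => by simp [A]
  have hlo : ∀ k k', k < k' → z k < v (f k') a := fun k k' hk => by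
    have h1 := grid_gap hr (g.strictMono hk)
    have h2 := (hf k').1.1
    simp only [z]
    linarith
  refine ⟨A, ?_, ?_, fun u hu w hw hvis => ?_⟩
  · have := Finset.card_le_card_of_injOn (s := (Finset.univ : Finset (Fin m))) (t := A)
      (fun k => f ⟨k + 1, by omega⟩) (fun k _ => ?_) (fun k _ k' _ hk => ?_)
    · simpa using this
    · refine (hA _).2 ⟨hlo _ _ (by simp [k₀, Fin.lt_def]), ?_⟩
      have h1 : g ⟨k + 1, by omega⟩ ≤ g k₁ := g.monotone (by simp only [k₁, Fin.le_def]; omega)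
      have h2 : ((g ⟨k + 1, by omega⟩ : ℕ) : ℝ) ≤ ((g k₁ : ℕ) : ℝ) := by exact_mod_cast h1
      have h3 := (hf ⟨k + 1, by omega⟩).1.2
      simp only [z]
      nlinarith
    · have := hinj hk
      simp only [Fin.mk.injEq] at this
      exact Fin.ext (by omega)
  · have := Finset.card_le_card_of_injOn (s := (Finset.univ : Finset (Fin m))) (t := Aᶜ)
      (fun k => f ⟨m + 1 + k, by omega⟩) (fun k _ => ?_) (fun k _ k' _ hk => ?_)
    · simpa using this
    · refine Finset.mem_compl.2 fun hk => ?_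
      have h1 := ((hA _).1 hk).2
      have h2 := hlo k₁ ⟨m + 1 + k, by omega⟩ (by simp only [k₁, Fin.lt_def]; omega)
      linarith
    · have := hinj hk
      simp only [Fin.mk.injEq] at this
      exact Fin.ext (by omega)
  · obtain ⟨hu0, hu1⟩ := (hA u).1 hu
    have hw1 := (hv w).1 a
    have hw2 := (hv w).2 a
    simp only at hw1 hw2
    have hz0 : 0 ≤ z k₀ := by simp only [z]; positivity
    have hz1 : z k₁ ≤ M.side n / 4 + M.radius n := by
      have := sixteen_mul_le_of_lt_floor hr (g k₁)
      simp only [z]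
      linarith
    -- The part between the cuts lies in the first quarter to the right of the origin, too far from
    -- both ends of the interval for visibility around the circle.
    have hle : |v u a - v w a| ≤ M.radius n := by
      refine abs_sub_le_of_torusDist_le hvis ?_
      change |v u a - v w a| < M.side n - M.radius n
      rw [abs_lt]
      constructor <;> linarith
    rw [abs_le] at hle
    by_cases hw0 : z k₀ < v w a
    · have h1 : z k₁ < v w a := not_le.1 fun h => hw ((hA w).2 ⟨hw0, h⟩)
      linarith [hgap k₁ w h1]
    · linarith [hgap k₀ u hu0, not_lt.1 hw0]

variable [MeasurableSpace Z] [DiscreteMeasurableSpace Z]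

/-- Impossibility in dimension one because of a disconnected visibility graph. -/
lemma not_exactRecovery_of_disconnected (est : M.Estimator) (hd : M.d = 1) (hlam : M.lam < 1)
    {τ : Equiv.Perm Z} (hτ : τ ∈ M.permissible) (hτ1 : τ ≠ 1) : ¬M.ExactRecovery est := by
  classical
  -- With `σ = 0` a cell costs core plus box, of total volume `(1 + 2 * ε) * log n`, so `λ < 1` is
  -- exactly the condition in the limit.
  have hlim : Tendsto (fun ε : ℝ => (M.lam + ε) * (ε ^ M.d + (1 + ε) ^ M.d)) (𝓝[>] 0)
      (𝓝 ((M.lam + 0) * (0 ^ M.d + (1 + 0) ^ M.d))) := by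
    refine Tendsto.mono_left (Continuous.tendsto ?_ 0) nhdsWithin_le_nhds
    fun_prop
  have hlt : (M.lam + 0) * (0 ^ M.d + (1 + 0) ^ M.d) < 1 := by
    rw [hd]
    linarith
  obtain ⟨ε, hεκ, hεm, hε0⟩ := ((hlim.eventually (gt_mem_nhds hlt)).and
    (((eventually_lt_nhds (show (0 : ℝ) < min 1 M.lam from lt_min one_pos M.lam_pos)).filter_mono
      nhdsWithin_le_nhds).and self_mem_nhdsWithin)).exists
  have hε : 0 < ε := hε0
  obtain ⟨hε1, hεl⟩ := lt_min_iff.1 hεm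
  obtain ⟨m, hm⟩ := M.exists_sum_not_allLabels_le
  have h0 : (0 : ℝ) ∈ Set.Icc (0 : ℝ) 1 := ⟨le_rfl, zero_le_one⟩
  refine M.not_exactRecovery_of_cells est (K := 1 * Fintype.card (Equiv.Perm Z) + 1)
    (T := (2 * m + 1 : ℕ)) (c₁ := 1 / 32) (c₂ := ε ^ M.d) (by finiteness) hε hεl
    (by positivity) hεκ (by positivity) (by positivity) h0 ?_
  filter_upwards [M.eventually_mul_radius_le_side 32, eventually_ge_atTop 2] with n h32 hn
  have hr := M.radius_pos hn
  have h16 : 16 * M.radius n ≤ M.side n := by linarith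
  have hL := M.side_pos (show 1 ≤ n by omega)
  refine ⟨Fin ⌊M.side n / (16 * M.radius n)⌋₊, inferInstance,
    M.diagonalBox n (ε * M.radius n), M.diagonalBox n ((1 + ε) * M.radius n),
    fun _ => measurableSet_Icc, fun _ => measurableSet_Icc,
    fun c => Set.Icc_subset_Icc_right fun _ => by simp only; nlinarith,
    M.pairwise_disjoint_diagonalBox hn (by nlinarith),
    M.diagonalBox_subset_cube hn h16 (by nlinarith), ?_, fun c => ?_, fun c => ?_,
    fun N v _ hv hT => ?_⟩
  · have h1 := M.grid_card_le hn h16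
    have h2 : Fintype.card (Fin M.d → Fin ⌊M.side n / (16 * M.radius n)⌋₊) =
        Fintype.card (Fin ⌊M.side n / (16 * M.radius n)⌋₊) := by
      rw [Fintype.card_fun, Fintype.card_fin M.d, hd, pow_one]
    rwa [h2, hd, pow_one] at h1
  · rw [M.volume_real_diagonalBox (by positivity), mul_pow, radius_pow]
  · rw [M.volume_real_diagonalBox (by positivity), M.volume_real_diagonalBox (by positivity),
      mul_pow, mul_pow, radius_pow]
    exact le_of_eq (by ring)
  · set b := M.diagonalBox n (ε * M.radius n)
    set B := M.diagonalBox n ((1 + ε) * M.radius n)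
    set C : Finset (Fin ⌊M.side n / (16 * M.radius n)⌋₊) :=
      Finset.univ.filter fun c => soleWeight (b c) (B c) 0 v ≠ 0 with hC
    -- Each weight is at most `1`, so a total of `2 * m + 1` requires that many cells with a sole
    -- occupant.
    have h1 : 2 * m + 1 ≤ C.card := by
      have h2 : ∑ c, soleWeight (b c) (B c) 0 v ≤ C.card := by
        rw [← Finset.sum_filter_ne_zero]
        exact (Finset.sum_le_card_nsmul _ _ 1 fun c _ => soleWeight_le_one h0 v).trans (by simp [hC])
      exact_mod_cast hT.trans h2
    obtain ⟨C', hC', hcard⟩ := Finset.exists_subset_card_eq h1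
    obtain ⟨A, hA1, hA2, hA⟩ := M.exists_invisible_cut hd hn h32 hε hε1 hv hcard fun c hc => by
      obtain ⟨u, -, hu⟩ := soleWeight_eq_of_ne_zero (Finset.mem_filter.1 (hC' hc)).2
      obtain ⟨h2, h3⟩ := mem_of_prod_soleFactor_ne_zero hu
      exact ⟨u, h2, fun l hl => (h3 l hl).2 rfl⟩
    exact M.half_le_failGiven_of_disconnected est hτ hτ1 hA (hm N A hA1 hA2)

end GHCMParams

/-! ### The impossibility theorem -/

theorem theorem1 {Z : Type*} [Fintype Z] [MeasurableSpace Z] [DiscreteMeasurableSpace Z]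
    (M : GHCMParams Z)
    (h : (∃ i j : Z, i ≠ j ∧ M.lam * unitBallVolume M.d * M.chDiv i j < 1) ∨
      (M.d = 1 ∧ M.lam < 1 ∧ 2 ≤ M.permissible.ncard))
    (est : M.Estimator) :
    ¬ M.ExactRecovery est := by
  rcases h with ⟨i, j, hij, h⟩ | ⟨hd, hlam, h⟩
  · exact M.not_exactRecovery_of_chDiv_lt est hij h
  · obtain ⟨τ, hτ, hτ1⟩ := Set.exists_ne_of_one_lt_ncard (s := M.permissible) h 1
    exact M.not_exactRecovery_of_disconnected est hd hlam hτ hτ1
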